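/- Let $\epsilon_0>\epsilon_1>0$, $Q=[0,1)^2$, and let $Q_0$ be a non-empty open set with $\overline{Q_0}\subset Q$ whose boundary is Lebesgue-null (for instance, sufficiently smooth). Put $Q_1=Q\setminus\overline{Q_0}$, let $\chi_i$ be the characteristic function of the $\mathbb Z^2$-periodic extension of $Q_i$, and $\gamma=\epsilon_0/\epsilon_1-1$. For $\theta\in\mathbb R^2$ let $H^1_\theta(Q)$ be the closure in $H^1(Q)$ of the smooth functions with $\varphi(y+n)=e^{2\pi i\theta\cdot n}\varphi(y)$, $n\in\mathbb Z^2$, and $$V(\theta)=\{v\in[H^1_\theta(Q)]^2:\ \operatorname{div}v=0,\ \operatorname{div}v^\perp=0\ \text{a.e. in }Q_1\},\qquad v^\perp=(-v_2,v_1).$$ Gradients are written as columns $\nabla u=(u_{1,1},u_{2,1},u_{1,2},u_{2,2})^T$. For $\varepsilon>0$ let $s_\varepsilon=\sqrt{1-\varepsilon^2/\epsilon_1}$ (only small $\varepsilon$ matter), $$A_1^\varepsilon=\begin{pmatrix}1&0&0&s_\varepsilon\\0&1&-s_\varepsilon&0\\0&-s_\varepsilon&1&0\\s_\varepsilon&0&0&1\end{pmatrix},\quad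 A_0^\varepsilon=\begin{pmatrix}\epsilon_0/\epsilon_1&0&0&s_\varepsilon\\0&1&-s_\varepsilon&0\\0&-s_\varepsilon&\epsilon_0/\epsilon_1&0\\s_\varepsilon&0&0&1\end{pmatrix},\quad \rho=\chi_1 I+\chi_0\begin{pmatrix}\epsilon_0/\epsilon_1&0\\0&1\end{pmatrix},$$ $$a^{(0)}=\frac{\chi_1}{2\epsilon_1}\begin{pmatrix}0&0&0&-1\\0&0&1&0\\0&1&0&0\\-1&0&0&0\end{pmatrix}+\frac{\chi_0}{\epsilon_0-\epsilon_1}\begin{pmatrix}\epsilon_0/\epsilon_1&0&0&1\\0&1&-1&0\\0&-1&\epsilon_0/\epsilon_1&0\\1&0&0&1\end{pmatrix}.$$ (1) Let $\varepsilon_n>0$, $\varepsilon_n\to0$, $\lambda_n\to\lambda$ in $\mathbb R$, $\theta_n\in[0,1)^2$, $\theta_n\to\theta$, and let $u^n\in[H^1_{\theta_n}(Q)]^2$ satisfy $\|u^n\|_{[L^2(Q)]^2}=1$ and $$\int_Q\Big(\tfrac1{\varepsilon_n^2}\chi_1A_1^{\varepsilon_n}+\tfrac1{\epsilon_0-\epsilon_1+\varepsilon_n^2}\chi_0A_0^{\varepsilon_n}\Big)\nabla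 u^n\cdot\overline{\nabla\phi}\,dy=\lambda_n\int_Q\rho\,u^n\cdot\overline\phi\,dy\qquad\forall\phi\in[H^1_{\theta_n}(Q)]^2 .$$ Then there are a subsequence $u^{n_k}$ and a non-zero $u\in V(\theta)$ such that $u^{n_k}\to u$ strongly in $[L^2(Q)]^2$, $\nabla u^{n_k}\rightharpoonup\nabla u$ weakly in $[L^2(Q)]^{2\times2}$, and $$\int_Q a^{(0)}\nabla u\cdot\overline{\nabla\phi}\,dy=\lambda\int_Q\rho\,u\cdot\overline\phi\,dy\qquad\forall\phi\in V(\theta).$$ (2) Let $\sigma_\varepsilon$ be the spectrum of the operator $\mathcal A^\varepsilon$ in $L^2_{\rho(\cdot/\varepsilon)}(\mathbb R^2)^2$ generated by the form $$\int_{\mathbb R^2}\Big(\chi_1A_1^\varepsilon+\tfrac{\varepsilon^2}{\epsilon_0-\epsilon_1+\varepsilon^2}\chi_0A_0^\varepsilon\Big)\!\big(\tfrac x\varepsilon\big)\nabla u\cdot\overline{\nabla v}\,dx,\qquad u,v\in[H^1(\mathbb R^2)]^2,$$ and let $\sigma_0=\bigcup_{\theta\in[0,1)^2}\sigma(\theta)$,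 where $\sigma(\theta)$ is the set of real $\lambda$ for which there is a non-zero $u\in V(\theta)$ with $$\int_Q\nabla u_1\cdot\overline{\nabla\phi_1}+\gamma^{-1}\big(\operatorname{div}u\,\overline{\operatorname{div}\phi}+\operatorname{div}u^\perp\,\overline{\operatorname{div}\phi^\perp}\big)\,dy=\lambda\int_Q\epsilon_1\big(u\cdot\overline\phi+\gamma\chi_0u_1\overline{\phi_1}\big)\,dy\qquad\forall\phi\in V(\theta).$$ Then $\lim_{\varepsilon\to0}\sigma_\varepsilon\subset\sigma_0$: if $\varepsilon_n>0$, $\varepsilon_n\to0$, $\lambda_n\in\sigma_{\varepsilon_n}$ and $\lambda_n\to\lambda$, then $\lambda\in\sigma_0$. -/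

import Mathlib

open MeasureTheory Filter Topology
open scoped ContDiff Matrix

noncomputable section

namespace HighContrast

/-- The plane `ℝ²`. -/
abbrev Plane : Type := EuclideanSpace ℝ (Fin 2)

/-- The half-open unit cell `Q = [0,1)²`. -/
def cell : Set Plane := {y | ∀ j, 0 ≤ y j ∧ y j < 1}

/-- The vector of `ℝ²` with integer coordinates `n`. -/
def latticeVec (n : Fin 2 → ℤ) : Plane := WithLp.toLp 2 (fun j => (n j : ℝ))

/-- The classical partial derivative `∂_j φ`. -/
def pderiv (j : Fin 2) (φ : Plane → ℂ) (y : Plane) : ℂ :=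
  fderiv ℝ φ y (EuclideanSpace.single j (1 : ℝ))

/-- Smooth `θ`-quasiperiodic functions on the plane:
`φ(y + n) = exp(2πi θ·n) φ(y)` for all `n ∈ ℤ²`. -/
def smoothQuasiperiodic (θ : Plane) : Set (Plane → ℂ) :=
  {φ | ContDiff ℝ ∞ φ ∧ ∀ (y : Plane) (n : Fin 2 → ℤ),
    φ (y + latticeVec n) =
      Complex.exp (2 * Real.pi * Complex.I * ((∑ j, θ j * (n j : ℝ) : ℝ) : ℂ)) * φ y}

/-- Smooth compactly supported functions on the plane. -/
def smoothCompactSupport : Set (Plane → ℂ) :=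
  {φ | ContDiff ℝ ∞ φ ∧ HasCompactSupport φ}

/-- Two-component fields `u = (u₁, u₂)` whose components lie in the closure, in the norm of
`H¹(Ω)`, of a class `S` of smooth functions. The field is stored together with its weak gradient,
`grad i j = ∂_j u_i` (determined by `u` almost everywhere on an open `Ω`). -/
structure H1Closure (S : Set (Plane → ℂ)) (Ω : Set Plane) where
  toFun : Fin 2 → Plane → ℂ
  grad : Fin 2 → Fin 2 → Plane → ℂ
  memLp_toFun : ∀ i, MemLp (toFun i) 2 (volume.restrict Ω)
  memLp_grad : ∀ i j, MemLp (grad i j) 2 (volume.restrict Ω)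
  approx : ∀ i, ∃ φ : ℕ → Plane → ℂ, (∀ k, φ k ∈ S) ∧
    Tendsto (fun k => eLpNorm (fun y => φ k y - toFun i y) 2 (volume.restrict Ω)) atTop (𝓝 0) ∧
    ∀ j, Tendsto (fun k => eLpNorm (fun y => pderiv j (φ k) y - grad i j y) 2
      (volume.restrict Ω)) atTop (𝓝 0)

/-- `[H¹_θ(Q)]²`, the closure of the smooth `θ`-quasiperiodic fields in `[H¹(Q)]²`. -/
abbrev H1Theta (θ : Plane) : Type := H1Closure (smoothQuasiperiodic θ) cell

/-- `[H¹(ℝ²)]²`, the closure of the smooth compactly supported fields. -/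
abbrev H1Plane : Type := H1Closure smoothCompactSupport Set.univ

namespace H1Closure

variable {S : Set (Plane → ℂ)} {Ω : Set Plane}

/-- The value `u(y) ∈ ℂ²`. -/
def val (u : H1Closure S Ω) (y : Plane) : Fin 2 → ℂ := fun i => u.toFun i y

/-- The gradient at `y`, written as the column `(u₁,₁, u₂,₁, u₁,₂, u₂,₂)`. -/
def gradVec (u : H1Closure S Ω) (y : Plane) : Fin 4 → ℂ :=
  ![u.grad 0 0 y, u.grad 1 0 y, u.grad 0 1 y, u.grad 1 1 y]

/-- `div u = u₁,₁ + u₂,₂`. -/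
def div (u : H1Closure S Ω) (y : Plane) : ℂ := u.grad 0 0 y + u.grad 1 1 y

/-- `div u^⊥ = - u₂,₁ + u₁,₂`, where `u^⊥ = (-u₂, u₁)`. -/
def divPerp (u : H1Closure S Ω) (y : Plane) : ℂ := - u.grad 1 0 y + u.grad 0 1 y

/-- `u = 0` as an element of `[L²(Ω)]²`. -/
def IsZero (u : H1Closure S Ω) : Prop := ∀ i, u.toFun i =ᵐ[volume.restrict Ω] 0

end H1Closure

/-- The sesquilinear expression `A ξ · conj η` for a real matrix `A`. -/
def contract {m : ℕ} (A : Matrix (Fin m) (Fin m) ℝ) (ξ η : Fin m → ℂ) : ℂ :=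
  (A.map (fun t : ℝ => (t : ℂ)) *ᵥ ξ) ⬝ᵥ star η

/-- `Q₁ = Q \ closure Q₀`. -/
def matrixPhase (Q₀ : Set Plane) : Set Plane := cell \ closure Q₀

/-- The characteristic function of the `ℤ²`-periodic extension of `P`. -/
def perChar (P : Set Plane) : Plane → ℝ :=
  Set.indicator {y | ∃ n : Fin 2 → ℤ, y + latticeVec n ∈ P} (fun _ => 1)

/-- The tensor `A₁^ε`. -/
def tensorA1 (e₁ ε : ℝ) : Matrix (Fin 4) (Fin 4) ℝ :=
  !![1, 0, 0, √(1 - ε ^ 2 / e₁);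
     0, 1, -√(1 - ε ^ 2 / e₁), 0;
     0, -√(1 - ε ^ 2 / e₁), 1, 0;
     √(1 - ε ^ 2 / e₁), 0, 0, 1]

/-- The tensor `A₀^ε`. -/
def tensorA0 (e₀ e₁ ε : ℝ) : Matrix (Fin 4) (Fin 4) ℝ :=
  !![e₀ / e₁, 0, 0, √(1 - ε ^ 2 / e₁);
     0, 1, -√(1 - ε ^ 2 / e₁), 0;
     0, -√(1 - ε ^ 2 / e₁), e₀ / e₁, 0;
     √(1 - ε ^ 2 / e₁), 0, 0, 1]

/-- The weight `ρ = χ₁ I + χ₀ diag(ε₀/ε₁, 1)`. -/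
def weight (e₀ e₁ : ℝ) (Q₀ : Set Plane) (y : Plane) : Matrix (Fin 2) (Fin 2) ℝ :=
  perChar (matrixPhase Q₀) y • !![1, 0; 0, 1] + perChar Q₀ y • !![e₀ / e₁, 0; 0, 1]

/-- The coefficient of the rescaled cell problem,
`ε⁻² χ₁ A₁^ε + (ε₀ - ε₁ + ε²)⁻¹ χ₀ A₀^ε`. -/
def cellTensor (e₀ e₁ : ℝ) (Q₀ : Set Plane) (ε : ℝ) (y : Plane) : Matrix (Fin 4) (Fin 4) ℝ :=
  (1 / ε ^ 2 * perChar (matrixPhase Q₀) y) • tensorA1 e₁ ε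
    + (1 / (e₀ - e₁ + ε ^ 2) * perChar Q₀ y) • tensorA0 e₀ e₁ ε

/-- The high-contrast coefficient `χ₁ A₁^ε + ε² (ε₀ - ε₁ + ε²)⁻¹ χ₀ A₀^ε`. -/
def planeTensor (e₀ e₁ : ℝ) (Q₀ : Set Plane) (ε : ℝ) (y : Plane) : Matrix (Fin 4) (Fin 4) ℝ :=
  perChar (matrixPhase Q₀) y • tensorA1 e₁ ε
    + (ε ^ 2 / (e₀ - e₁ + ε ^ 2) * perChar Q₀ y) • tensorA0 e₀ e₁ ε

/-- The limit tensor `a⁽⁰⁾`. -/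
def limitTensor (e₀ e₁ : ℝ) (Q₀ : Set Plane) (y : Plane) : Matrix (Fin 4) (Fin 4) ℝ :=
  (1 / (2 * e₁) * perChar (matrixPhase Q₀) y) •
      !![0, 0, 0, -1;
         0, 0, 1, 0;
         0, 1, 0, 0;
         -1, 0, 0, 0]
    + (1 / (e₀ - e₁) * perChar Q₀ y) •
      !![e₀ / e₁, 0, 0, 1;
         0, 1, -1, 0;
         0, -1, e₀ / e₁, 0;
         1, 0, 0, 1]

/-- `u` solves the `θ`-quasiperiodic rescaled cell problem with spectral parameter `l`. -/
def SolvesCellProblem (e₀ e₁ : ℝ) (Q₀ : Set Plane) (ε l : ℝ) {θ : Plane} (u : H1Theta θ) : Prop :=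
  ∀ φ : H1Theta θ,
    ∫ y in cell, contract (cellTensor e₀ e₁ Q₀ ε y) (u.gradVec y) (φ.gradVec y)
      = (l : ℂ) * ∫ y in cell, contract (weight e₀ e₁ Q₀ y) (u.val y) (φ.val y)

/-- `u ∈ H¹(ℝ²)²` solves `(𝒜^ε - l) u = f`, where `𝒜^ε` is the operator in the weighted space
`L²(ℝ², ρ(x/ε) dx)²` generated by the form `∫ A^ε(x/ε) ∇u · conj ∇φ` with form domain
`H¹(ℝ²)²`. -/
def SolvesPlaneProblem (e₀ e₁ : ℝ) (Q₀ : Set Plane) (ε l : ℝ) (u : H1Plane)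
    (f : Fin 2 → Plane → ℂ) : Prop :=
  ∀ φ : H1Plane,
    (∫ x, contract (planeTensor e₀ e₁ Q₀ ε (ε⁻¹ • x)) (u.gradVec x) (φ.gradVec x))
        - (l : ℂ) * ∫ x, contract (weight e₀ e₁ Q₀ (ε⁻¹ • x)) (u.val x) (φ.val x)
      = ∫ x, contract (weight e₀ e₁ Q₀ (ε⁻¹ • x)) (fun i => f i x) (φ.val x)

/-- The (real) spectrum `σ_ε` of `𝒜^ε`: the `l` for which `𝒜^ε - l` is not a bijection
from its domain onto `[L²(ℝ²)]²`. -/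
def planeSpectrum (e₀ e₁ : ℝ) (Q₀ : Set Plane) (ε : ℝ) : Set ℝ :=
  {l | ¬ ((∀ f : Fin 2 → Plane → ℂ, (∀ i, MemLp (f i) 2 volume) →
            ∃ u : H1Plane, SolvesPlaneProblem e₀ e₁ Q₀ ε l u f) ∧
          (∀ u : H1Plane, SolvesPlaneProblem e₀ e₁ Q₀ ε l u (fun _ _ => 0) → u.IsZero))}

/-- The space `V(θ)`: fields in `[H¹_θ(Q)]²` with `div u = div u^⊥ = 0` in `Q₁`. -/
def V (Q₀ : Set Plane) (θ : Plane) : Set (H1Theta θ) :=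
  {u | ∀ᵐ y ∂(volume.restrict (matrixPhase Q₀)), u.div y = 0 ∧ u.divPerp y = 0}

/-- `∫_Q a⁽⁰⁾ ∇u · conj ∇φ = l ∫_Q ρ u · conj φ` for all `φ ∈ V(θ)`. -/
def SolvesLimitProblem (e₀ e₁ : ℝ) (Q₀ : Set Plane) (l : ℝ) {θ : Plane} (u : H1Theta θ) : Prop :=
  ∀ φ ∈ V Q₀ θ,
    ∫ y in cell, contract (limitTensor e₀ e₁ Q₀ y) (u.gradVec y) (φ.gradVec y)
      = (l : ℂ) * ∫ y in cell, contract (weight e₀ e₁ Q₀ y) (u.val y) (φ.val y)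

/-- `σ(θ)`, the eigenvalues `l` of the limit Bloch operator: there is a non-zero `u ∈ V(θ)` with
`∫_Q ∇u₁ · conj ∇φ₁ + γ⁻¹ (div u conj(div φ) + div u^⊥ conj(div φ^⊥))
  = l ∫_Q ε₁ (u · conj φ + γ χ₀ u₁ conj φ₁)` for all `φ ∈ V(θ)`, where `γ = ε₀/ε₁ - 1`. -/
def limitBlochSpectrum (e₀ e₁ : ℝ) (Q₀ : Set Plane) (θ : Plane) : Set ℝ :=
  {l | ∃ u ∈ V Q₀ θ, ¬ u.IsZero ∧ ∀ φ ∈ V Q₀ θ,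
    ∫ y in cell, ((∑ j, u.grad 0 j y * star (φ.grad 0 j y))
        + (((e₀ / e₁ - 1)⁻¹ : ℝ) : ℂ) *
          (u.div y * star (φ.div y) + u.divPerp y * star (φ.divPerp y)))
      = (l : ℂ) * ∫ y in cell, (e₁ : ℂ) *
          ((∑ i, u.toFun i y * star (φ.toFun i y))
            + (((e₀ / e₁ - 1) * perChar Q₀ y : ℝ) : ℂ) *
              (u.toFun 0 y * star (φ.toFun 0 y)))}

/-- `σ₀`, the union of `σ(θ)` over `θ ∈ [0,1)²`. -/
def limitSpectrum (e₀ e₁ : ℝ) (Q₀ : Set Plane) : Set ℝ :=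
  ⋃ θ ∈ cell, limitBlochSpectrum e₀ e₁ Q₀ θ

end HighContrast

end

noncomputable section

namespace HighContrast

/-! ### The unit cell and the plane waves -/

open scoped ComplexConjugate ENNReal InnerProductSpace

/-! Both statements rest on one compactness result for approximate solutions of the cell problem.
The algebra behind it is `contract_tensorA1`: the form of A₁^ε is (1 − s_ε)∇u·∇φ plus s_ε times the
pairings of div u with div φ and of div u^⊥ with div φ^⊥; the form of A₀^ε adds γ∇u₁·∇φ₁. After
division by ε² the matrix phase keeps a bounded elliptic part, since (1 − s_ε)/ε² → 1/(2ε₁), and a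
penalty of order ε⁻² on the two divergences. In the inclusions, γ|∇u₁|² together with the
divergences controls the whole gradient. Hence L²-normalised fields whose residual is small relative
to H¹ norms are bounded in H¹ with divergence energy O(ε²) in the matrix phase (`energy_bound`), and
along a subsequence they converge weakly in H¹ and strongly in L² to an element of V(θ)
(`exists_subseq_h1Theta`, `mem_V_of_weak`).

The delicate point is the choice of test fields. A field in V(θ₀) is not admissible at θ_n, and a
test field outside V(θ_n) would meet the ε⁻² penalty, so elements of V(θ₀) must be strong H¹ limits
of elements of V(θ_n) (`exists_approx_V`). The combinations φ₁ ∓ iφ₂ turn the two constraints into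
Cauchy–Riemann equations for ∂₁ ± i∂₂. In Fourier variables these operators have a symbol of modulus
2π|θ + k|, invertible uniformly for θ near θ₀ except at one k; the exceptional coefficient is
corrected by a function supported in Q₀, where no constraint is imposed (`exists_approx_crDeriv`).
Such comparisons between different θ are possible because H¹_θ is characterised by Fourier
coefficients (`QuasiJet`). Tested against V(θ_n) the penalty vanishes identically and the limit can
be taken (`exists_limit_of_bounds`).

For the spectra: if λ ∈ σ_ε, the form of the operator minus λ is not bounded below in the inf–sup
sense, so there are smooth compactly supported fields of arbitrarily small relative residual
(`exists_planeWave`). Rescaling makes the coefficient 1-periodic, and a discrete Bloch transform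
over a finite grid of quasimomenta splits the field into quasiperiodic ones. If each of these had a
large residual, the test fields witnessing it, with aligned phases, superposed and cut off, would
witness a large residual in the plane. The loss is a constant independent of the grid and of the
coefficient (`exists_blochWave`). So some quasimomentum carries an approximate Bloch wave, and the
residual form of the compactness result applies. Finally, ε₁ times the limit form equals the form
defining σ(θ) on V(θ) (`bloch_form_eq`).

Throughout, a field is handled through its jet, the vector of its values and first derivatives in a
product of L² spaces. -/

theorem continuous_coord (j : Fin 2) : Continuous fun y : Plane => y j := by fun_prop

theorem measurableSet_cell : MeasurableSet cell := by
  have : cell = ⋂ j, {y : Plane | 0 ≤ y j} ∩ {y : Plane | y j < 1} := by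
    ext y; simp [cell]
  rw [this]
  exact MeasurableSet.iInter fun j =>
    (measurableSet_le measurable_const (continuous_coord j).measurable).inter
      (measurableSet_lt (continuous_coord j).measurable measurable_const)

@[simp] theorem latticeVec_apply (n : Fin 2 → ℤ) (j : Fin 2) : latticeVec n j = n j := rfl

theorem latticeVec_add (m n : Fin 2 → ℤ) : latticeVec (m + n) = latticeVec m + latticeVec n := by
  ext j; simp

theorem latticeVec_zero : latticeVec 0 = 0 := by ext j; simp

theorem latticeVec_sub (m n : Fin 2 → ℤ) : latticeVec (m - n) = latticeVec m - latticeVec n := by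
  ext j; simp

/-- Two points of the cell that differ by a lattice vector coincide. -/
theorem eq_zero_of_mem_cell {y : Plane} {n : Fin 2 → ℤ} (hy : y ∈ cell)
    (hn : y + latticeVec n ∈ cell) : n = 0 := by
  funext j
  have h1 := hy j
  have h2 := hn j
  simp only [PiLp.add_apply, latticeVec_apply] at h2
  have h3 : (-1 : ℝ) < n j := by linarith [h1.1, h1.2, h2.1, h2.2]
  have h4 : (n j : ℝ) < 1 := by linarith [h1.1, h1.2, h2.1, h2.2]
  have h5 : -1 < n j := by exact_mod_cast h3
  have h6 : n j < 1 := by exact_mod_cast h4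
  simp only [Pi.zero_apply]; omega

/-- Every point of the plane is brought into the cell by a lattice vector. -/
theorem exists_sub_mem_cell (y : Plane) : ∃ n : Fin 2 → ℤ, y - latticeVec n ∈ cell := by
  refine ⟨fun j => ⌊y j⌋, fun j => ?_⟩
  simp only [PiLp.sub_apply, latticeVec_apply]
  exact ⟨by linarith [Int.floor_le (y j)], by linarith [Int.lt_floor_add_one (y j)]⟩

/-! ### Plane waves -/

/-- The plane wave `exp(2πi ξ·y)`. -/
def mode (ξ y : Plane) : ℂ := Complex.exp (2 * Real.pi * Complex.I * ((∑ j, ξ j * y j : ℝ) : ℂ))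

theorem mode_add_left (ξ η y : Plane) : mode (ξ + η) y = mode ξ y * mode η y := by
  simp only [mode, ← Complex.exp_add]
  congr 1
  simp only [PiLp.add_apply, Fin.sum_univ_two]
  push_cast; ring

theorem mode_add_right (ξ y z : Plane) : mode ξ (y + z) = mode ξ y * mode ξ z := by
  simp only [mode, ← Complex.exp_add]
  congr 1
  simp only [PiLp.add_apply, Fin.sum_univ_two]
  push_cast; ring

theorem mode_eq_exp_I (ξ y : Plane) :
    mode ξ y = Complex.exp (((2 * Real.pi * ∑ j, ξ j * y j : ℝ) : ℂ) * Complex.I) := by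
  rw [mode]; congr 1; push_cast; ring

@[simp] theorem norm_mode (ξ y : Plane) : ‖mode ξ y‖ = 1 := by
  rw [mode_eq_exp_I, Complex.norm_exp_ofReal_mul_I]

theorem mode_ne_zero (ξ y : Plane) : mode ξ y ≠ 0 := Complex.exp_ne_zero _

theorem mode_zero_left (y : Plane) : mode 0 y = 1 := by simp [mode]

theorem mode_neg_left (ξ y : Plane) : mode (-ξ) y = conj (mode ξ y) := by
  rw [mode_eq_exp_I, mode_eq_exp_I, ← Complex.exp_conj, map_mul, Complex.conj_ofReal,
    Complex.conj_I]
  congr 1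
  simp only [PiLp.neg_apply, Fin.sum_univ_two]
  push_cast; ring

theorem mode_mul_conj (ξ y : Plane) : mode ξ y * conj (mode ξ y) = 1 := by
  rw [← mode_neg_left, ← mode_add_left, add_neg_cancel, mode_zero_left]

theorem mode_latticeVec (k n : Fin 2 → ℤ) : mode (latticeVec k) (latticeVec n) = 1 := by
  rw [mode, Complex.exp_eq_one_iff]
  refine ⟨∑ j, k j * n j, ?_⟩
  simp only [latticeVec_apply, Fin.sum_univ_two]
  push_cast; ring

theorem contDiff_mode (ξ : Plane) : ContDiff ℝ ∞ (mode ξ) := by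
  unfold mode
  refine Complex.contDiff_exp.comp (contDiff_const.mul ?_)
  have h : ContDiff ℝ ∞ fun y : Plane => ∑ j, ξ j * y j :=
    ContDiff.sum fun j _ => contDiff_const.mul (by fun_prop)
  exact Complex.ofRealCLM.contDiff.comp h

theorem continuous_mode (ξ : Plane) : Continuous (mode ξ) := (contDiff_mode ξ).continuous

theorem pderiv_mode (ξ : Plane) (j : Fin 2) (y : Plane) :
    pderiv j (mode ξ) y = 2 * Real.pi * Complex.I * ξ j * mode ξ y := by
  have h1 : HasFDerivAt (fun y : Plane => ∑ j, ξ j * y j)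
      (∑ j, ξ j • (EuclideanSpace.proj j : Plane →L[ℝ] ℝ)) y := by
    refine HasFDerivAt.fun_sum fun j _ => ?_
    exact ((EuclideanSpace.proj j : Plane →L[ℝ] ℝ).hasFDerivAt).const_mul (ξ j)
  have h2 := (Complex.ofRealCLM.hasFDerivAt.comp y h1).const_mul (2 * Real.pi * Complex.I)
  have h3 := h2.cexp
  have h4 : mode ξ = fun y => Complex.exp (2 * Real.pi * Complex.I *
    (Complex.ofRealCLM ∘ fun y : Plane => ∑ j, ξ j * y j) y) := by
    funext y; simp [mode]
  rw [pderiv, h4, h3.fderiv]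
  fin_cases j <;> simp [Fin.sum_univ_two] <;> ring

theorem mode_mem_smoothQuasiperiodic (θ : Plane) (k : Fin 2 → ℤ) :
    mode (θ + latticeVec k) ∈ smoothQuasiperiodic θ := by
  refine ⟨contDiff_mode _, fun y n => ?_⟩
  rw [mode_add_right, mul_comm]
  congr 1
  rw [mode_add_left, mode_latticeVec, mul_one]
  rfl

theorem smoothQuasiperiodic_iff (θ : Plane) (φ : Plane → ℂ) :
    φ ∈ smoothQuasiperiodic θ ↔ ContDiff ℝ ∞ φ ∧ ∀ y n, φ (y + latticeVec n) =
      mode θ (latticeVec n) * φ y := Iff.rfl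

end HighContrast
end

noncomputable section

namespace HighContrast

open scoped ComplexConjugate ENNReal InnerProductSpace

/-! ### The Fourier basis of `L²(Q)` -/

/-- Lebesgue measure on the unit cell. -/
abbrev μQ : Measure Plane := volume.restrict cell

section Torus

-- Normalised Haar measure on each factor makes `volume` on the torus the probability measure for
-- which the exponentials are orthonormal.
local instance : MeasureSpace UnitAddCircle := ⟨AddCircle.haarAddCircle⟩

local instance : IsProbabilityMeasure (volume : Measure UnitAddCircle) :=
  inferInstanceAs (IsProbabilityMeasure AddCircle.haarAddCircle)

/-- The coordinates in `(0,1]²` of a point of the torus. -/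
def torusLift (x : UnitAddTorus (Fin 2)) : Plane :=
  WithLp.toLp 2 (UnitAddTorus.measurableEquivPiIoc (fun _ : Fin 2 => (0 : ℝ)) x).1

/-- Each side differs from the closed square by a null set. Torus points are lifted to (0,1]²,
whereas the cell is [0,1)². -/
theorem cell_ae_eq : (cell : Set Plane) =ᵐ[volume]
    (WithLp.ofLp ⁻¹' {x : Fin 2 → ℝ | ∀ i, x i ∈ Set.Ioc (0 : ℝ) (0 + 1)} : Set Plane) := by
  have h1 : (cell : Set Plane) = WithLp.ofLp ⁻¹' (Set.univ.pi fun _ : Fin 2 => Set.Ico (0 : ℝ) 1) := by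
    ext y; simp [cell]
  have h2 : {x : Fin 2 → ℝ | ∀ i, x i ∈ Set.Ioc (0 : ℝ) (0 + 1)} =
      (Set.univ.pi fun _ : Fin 2 => Set.Ioc (0 : ℝ) 1) := by
    ext y; simp
  rw [h1, h2]
  refine (PiLp.volume_preserving_ofLp (Fin 2)).quasiMeasurePreserving.preimage_ae_eq ?_
  exact (Measure.univ_pi_Ico_ae_eq_Icc (μ := fun _ : Fin 2 => (volume : Measure ℝ))).trans
    (Measure.univ_pi_Ioc_ae_eq_Icc (μ := fun _ : Fin 2 => (volume : Measure ℝ))).symm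

theorem measurePreserving_torusLift :
    MeasurePreserving torusLift volume μQ := by
  set I : Set (Fin 2 → ℝ) := {x | ∀ i, x i ∈ Set.Ioc (0 : ℝ) (0 + 1)}
  have hI : MeasurableSet I := MeasurableSet.univ_pi' fun _ => measurableSet_Ioc
  have h1 := UnitAddTorus.measurePreserving_equivPiIoc (fun _ : Fin 2 => (0 : ℝ))
  have h2 := measurePreserving_subtype_coe (μa := (volume : Measure (Fin 2 → ℝ))) hI
  have h4 : MeasurePreserving (WithLp.toLp 2 : (Fin 2 → ℝ) → Plane)
      ((volume : Measure (Fin 2 → ℝ)).restrict I)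
      ((volume : Measure Plane).restrict (WithLp.ofLp ⁻¹' I)) := by
    have := (PiLp.volume_preserving_toLp (Fin 2)).restrict_preimage
      (s := (WithLp.ofLp ⁻¹' I : Set Plane)) (hI.preimage (PiLp.volume_preserving_ofLp (Fin 2)).measurable)
    exact this
  rw [μQ, Measure.restrict_congr_set cell_ae_eq]
  exact h4.comp (h2.comp h1)

theorem mode_torusLift (k : Fin 2 → ℤ) (x : UnitAddTorus (Fin 2)) :
    mode (latticeVec k) (torusLift x) = UnitAddTorus.mFourier k x := by
  obtain ⟨z, rfl⟩ := (UnitAddTorus.measurableEquivPiIoc (fun _ : Fin 2 => (0 : ℝ))).symm.surjective x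
  rw [torusLift, MeasurableEquiv.apply_symm_apply,
    UnitAddTorus.coe_symm_measurableEquivPiIoc_apply]
  simp only [UnitAddTorus.mFourier, ContinuousMap.coe_mk, fourier_coe_apply, mode,
    ← Complex.exp_sum]
  congr 1
  simp only [Fin.sum_univ_two, latticeVec_apply]
  push_cast; ring

instance : IsProbabilityMeasure μQ :=
  ⟨by rw [← measurePreserving_torusLift.map_eq,
    Measure.map_apply measurePreserving_torusLift.measurable MeasurableSet.univ]; simp⟩

/-- Plane waves as elements of `L²(Q)`. -/
theorem memLp_mode (ξ : Plane) (p : ℝ≥0∞) : MemLp (mode ξ) p μQ :=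
  MemLp.of_bound (continuous_mode ξ).aestronglyMeasurable 1 (.of_forall fun y => (norm_mode ξ y).le)

/-- `L²(Q)`. -/
abbrev L2Q : Type := Lp ℂ 2 μQ

/-- A plane wave as an element of `L²(Q)`. -/
def modeL (ξ : Plane) : L2Q := (memLp_mode ξ 2).toLp

theorem coeFn_modeL (ξ : Plane) : modeL ξ =ᵐ[μQ] mode ξ :=
  MemLp.coeFn_toLp _

/-- Pull-back of `L²(Q)` to the torus. -/
def torusPull : L2Q →ₗᵢ[ℂ] Lp ℂ 2 (volume : Measure (UnitAddTorus (Fin 2))) :=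
  Lp.compMeasurePreservingₗᵢ ℂ torusLift measurePreserving_torusLift

theorem torusPull_modeL (k : Fin 2 → ℤ) :
    torusPull (modeL (latticeVec k)) = UnitAddTorus.mFourierLp 2 k := by
  apply Lp.ext
  refine (Lp.coeFn_compMeasurePreserving _ measurePreserving_torusLift).trans ?_
  refine ((coeFn_modeL (latticeVec k)).comp_tendsto
    measurePreserving_torusLift.quasiMeasurePreserving.tendsto_ae).trans ?_
  refine EventuallyEq.trans (.of_forall fun x => ?_) (UnitAddTorus.coeFn_mFourierLp 2 k).symm
  exact mode_torusLift k x

theorem orthonormal_modeL_latticeVec :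
    Orthonormal ℂ fun k : Fin 2 → ℤ => modeL (latticeVec k) := by
  rw [← torusPull.orthonormal_comp_iff]
  have : (torusPull ∘ fun k : Fin 2 → ℤ => modeL (latticeVec k)) = UnitAddTorus.mFourierLp 2 := by
    funext k; exact torusPull_modeL k
  rw [this]
  exact UnitAddTorus.orthonormal_mFourier

/-- Completeness on the torus transfers through the isometry `torusPull`, which sends integer plane
waves to the torus basis; only injectivity of the pull-back is used, not surjectivity. -/
theorem eq_zero_of_inner_modeL_latticeVec {f : L2Q}
    (h : ∀ k : Fin 2 → ℤ, ⟪modeL (latticeVec k), f⟫_ℂ = 0) : f = 0 := by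
  have h1 : torusPull f = 0 := by
    apply UnitAddTorus.mFourierBasis.repr.injective
    rw [map_zero]
    ext k
    rw [UnitAddTorus.mFourierBasis.repr_apply_apply, UnitAddTorus.coe_mFourierBasis,
      ← torusPull_modeL, torusPull.inner_map_map, h k]
    rfl
  exact torusPull.injective (h1.trans torusPull.map_zero.symm)

end Torus

/-! ### Multiplication by bounded functions -/

section Mul

variable {μ : Measure Plane}

/-- A bounded function as an element of `L^∞`, with value `0` for unbounded functions. -/
def toLinf (μ : Measure Plane) (m : Plane → ℂ) : Lp ℂ ∞ μ :=
  open Classical in if h : MemLp m ∞ μ then h.toLp else 0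

theorem coeFn_toLinf {m : Plane → ℂ} (hm : MemLp m ∞ μ) : toLinf μ m =ᵐ[μ] m := by
  rw [toLinf, dif_pos hm]; exact hm.coeFn_toLp

theorem coeFn_toLinf_smul {m : Plane → ℂ} (hm : MemLp m ∞ μ) (f : Lp ℂ 2 μ) :
    (toLinf μ m • f : Lp ℂ 2 μ) =ᵐ[μ] fun y => m y * f y := by
  filter_upwards [Lp.coeFn_lpSMul (r := 2) (toLinf μ m) f, coeFn_toLinf hm] with y h1 h2
  rw [h1]
  simp [h2]

theorem norm_toLinf_sub_le {m m' : Plane → ℂ} (hm : MemLp m ∞ μ) (hm' : MemLp m' ∞ μ) {c : ℝ}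
    (hc : 0 ≤ c) (h : ∀ᵐ y ∂μ, ‖m y - m' y‖ ≤ c) : ‖toLinf μ m - toLinf μ m'‖ ≤ c := by
  rw [Lp.norm_def]
  refine ENNReal.toReal_le_of_le_ofReal hc ?_
  have h1 : eLpNorm (toLinf μ m - toLinf μ m' : Lp ℂ ∞ μ) ∞ μ = eLpNorm (fun y => m y - m' y) ∞ μ := by
    refine eLpNorm_congr_ae ?_
    filter_upwards [Lp.coeFn_sub (toLinf μ m) (toLinf μ m'), coeFn_toLinf hm, coeFn_toLinf hm']
      with y h1 h2 h3
    rw [h1, Pi.sub_apply, h2, h3]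
  rw [h1, eLpNorm_exponent_top]
  exact eLpNormEssSup_le_of_ae_bound h

theorem inner_toLinf_smul {m : Plane → ℂ} (hm : MemLp m ∞ μ) (f g : Lp ℂ 2 μ) :
    ⟪g, (toLinf μ m • f : Lp ℂ 2 μ)⟫_ℂ = ∫ y, m y * f y * conj (g y) ∂μ := by
  rw [L2.inner_def]
  refine integral_congr_ae ?_
  filter_upwards [coeFn_toLinf_smul hm f] with y hy
  rw [hy]; simp

end Mul

/-! ### Quasiperiodic Fourier bases -/

/-- Multiplication by a plane wave. -/
def twist (τ : Plane) (f : L2Q) : L2Q := (toLinf μQ (mode τ) • f : L2Q)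

theorem coeFn_twist (τ : Plane) (f : L2Q) :
    twist τ f =ᵐ[μQ] fun y => mode τ y * f y :=
  coeFn_toLinf_smul (memLp_mode τ ∞) f

theorem inner_twist_twist (τ : Plane) (f g : L2Q) : ⟪twist τ f, twist τ g⟫_ℂ = ⟪f, g⟫_ℂ := by
  rw [L2.inner_def, L2.inner_def]
  refine integral_congr_ae ?_
  filter_upwards [coeFn_twist τ f, coeFn_twist τ g] with y h1 h2
  rw [h1, h2]
  simp only [RCLike.inner_apply, map_mul]
  linear_combination (g y * conj (f y)) * mode_mul_conj τ y

theorem twist_modeL (τ ξ : Plane) : twist τ (modeL ξ) = modeL (τ + ξ) := by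
  apply Lp.ext
  filter_upwards [coeFn_twist τ (modeL ξ), coeFn_modeL ξ, coeFn_modeL (τ + ξ)] with y h1 h2 h3
  rw [h1, h2, h3, mode_add_left]

theorem twist_twist (σ τ : Plane) (f : L2Q) : twist σ (twist τ f) = twist (σ + τ) f := by
  apply Lp.ext
  filter_upwards [coeFn_twist σ (twist τ f), coeFn_twist τ f, coeFn_twist (σ + τ) f] with y h1 h2 h3
  rw [h1, h2, h3, mode_add_left, mul_assoc]

theorem twist_zero_left (f : L2Q) : twist 0 f = f := by
  apply Lp.ext
  filter_upwards [coeFn_twist 0 f] with y h1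
  rw [h1, mode_zero_left, one_mul]

theorem norm_twist (τ : Plane) (f : L2Q) : ‖twist τ f‖ = ‖f‖ := by
  rw [@norm_eq_sqrt_re_inner ℂ, @norm_eq_sqrt_re_inner ℂ, inner_twist_twist]

/-- The Fourier basis of `L²(Q)` made of the `θ`-quasiperiodic plane waves. -/
def fourierBasis (θ : Plane) : HilbertBasis (Fin 2 → ℤ) ℂ L2Q :=
  HilbertBasis.mkOfOrthogonalEqBot (v := fun k => modeL (θ + latticeVec k))
    (by
      rw [orthonormal_iff_ite]
      intro m n
      rw [← twist_modeL, ← twist_modeL, inner_twist_twist]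
      exact orthonormal_iff_ite.1 orthonormal_modeL_latticeVec m n)
    (by
      rw [Submodule.eq_bot_iff]
      intro f hf
      -- Untwisting by θ reduces completeness of the quasiperiodic waves to the periodic case.
      have h1 : twist (-θ) f = 0 := by
        refine eq_zero_of_inner_modeL_latticeVec fun k => ?_
        rw [← inner_twist_twist θ, twist_modeL, twist_twist, add_neg_cancel, twist_zero_left]
        exact hf _ (Submodule.subset_span ⟨k, rfl⟩)
      rw [← norm_eq_zero, ← norm_twist (-θ), h1, norm_zero])

theorem fourierBasis_apply (θ : Plane) (k : Fin 2 → ℤ) :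
    fourierBasis θ k = modeL (θ + latticeVec k) := by
  simp [fourierBasis]

theorem fourierBasis_repr (θ : Plane) (f : L2Q) (k : Fin 2 → ℤ) :
    (fourierBasis θ).repr f k = ⟪modeL (θ + latticeVec k), f⟫_ℂ := by
  rw [HilbertBasis.repr_apply_apply, fourierBasis_apply]

theorem ext_inner_modeL (θ : Plane) {f g : L2Q}
    (h : ∀ k, ⟪modeL (θ + latticeVec k), f⟫_ℂ = ⟪modeL (θ + latticeVec k), g⟫_ℂ) : f = g := by
  apply (fourierBasis θ).repr.injective
  ext k
  rw [fourierBasis_repr, fourierBasis_repr, h k]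

theorem hasSum_norm_sq_inner_modeL (θ : Plane) (f : L2Q) :
    HasSum (fun k => ‖⟪modeL (θ + latticeVec k), f⟫_ℂ‖ ^ 2) (‖f‖ ^ 2) := by
  have h := lp.hasSum_norm (p := 2) (by norm_num) ((fourierBasis θ).repr f)
  simp only [LinearIsometryEquiv.norm_map, fourierBasis_repr] at h
  simpa using h

/-- Factor out one unimodular wave and use |e^{it} − 1| ≤ |t|, the coordinates of y being at most 1.
This Lipschitz bound in the frequency, uniform on the cell, makes `twist` continuous in its
parameter. -/
theorem norm_mode_sub_le {τ τ' y : Plane} (hy : y ∈ cell) :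
    ‖mode τ y - mode τ' y‖ ≤ 2 * Real.pi * (‖(τ - τ') 0‖ + ‖(τ - τ') 1‖) := by
  have h1 : mode τ y - mode τ' y = mode τ' y * (mode (τ - τ') y - 1) := by
    rw [mul_sub, ← mode_add_left, mul_one]; congr 2; abel
  rw [h1, norm_mul, norm_mode, one_mul, mode_eq_exp_I, mul_comm _ Complex.I]
  refine (Real.norm_exp_I_mul_ofReal_sub_one_le).trans ?_
  rw [norm_mul, Real.norm_of_nonneg (by positivity : 0 ≤ 2 * Real.pi), Fin.sum_univ_two]
  refine mul_le_mul_of_nonneg_left ?_ (by positivity)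
  refine (norm_add_le _ _).trans (add_le_add ?_ ?_) <;> rw [norm_mul] <;>
    refine mul_le_of_le_one_right (norm_nonneg _) ?_
  · rw [Real.norm_of_nonneg (hy 0).1]; exact (hy 0).2.le
  · rw [Real.norm_of_nonneg (hy 1).1]; exact (hy 1).2.le

theorem tendsto_twist {ι : Type*} {l : Filter ι} {τ : ι → Plane} {τ₀ : Plane}
    (h : Tendsto τ l (𝓝 τ₀)) (f : L2Q) : Tendsto (fun n => twist (τ n) f) l (𝓝 (twist τ₀ f)) := by
  rw [tendsto_iff_norm_sub_tendsto_zero]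
  have h0 : Tendsto (fun n => 2 * Real.pi * (‖(τ n - τ₀) 0‖ + ‖(τ n - τ₀) 1‖) * ‖f‖) l (𝓝 0) := by
    have h1 : Tendsto (fun n => τ n - τ₀) l (𝓝 0) := by simpa using h.sub_const τ₀
    have h2 : ∀ j, Tendsto (fun n => ‖(τ n - τ₀) j‖) l (𝓝 0) := fun j => by
      simpa using (((continuous_coord j).tendsto 0).comp h1).norm
    simpa using (((h2 0).add (h2 1)).const_mul (2 * Real.pi)).mul_const ‖f‖
  refine squeeze_zero (fun _ => norm_nonneg _) (fun n => ?_) h0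
  have h1 : twist (τ n) f - twist τ₀ f =
      ((toLinf μQ (mode (τ n)) - toLinf μQ (mode τ₀) : Lp ℂ ∞ μQ) • f : L2Q) := by
    rw [sub_eq_add_neg (toLinf μQ (mode (τ n))), Lp.smul_add, Lp.neg_smul, ← sub_eq_add_neg]; rfl
  rw [h1]
  refine (Lp.norm_smul_le _ _).trans (mul_le_mul_of_nonneg_right ?_ (norm_nonneg _))
  refine norm_toLinf_sub_le (memLp_mode _ _) (memLp_mode _ _) (by positivity) ?_
  filter_upwards [ae_restrict_mem measurableSet_cell] with y hy
  exact norm_mode_sub_le hy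

end HighContrast
end

noncomputable section

namespace HighContrast

open scoped ComplexConjugate ENNReal InnerProductSpace

/-! ### First-order jets of vector fields -/

/-- Indices of the first-order jet of a field: the components `u_i` and the derivatives `∂_j u_i`
(indexed by `(i, j)`). -/
abbrev JetIdx : Type := Fin 2 ⊕ (Fin 2 × Fin 2)

/-- Square integrable jets. -/
abbrev JetSpace (μ : Measure Plane) : Type := PiLp 2 (fun _ : JetIdx => Lp ℂ 2 μ)

/-- The sesquilinear expression `∑ m_{pq} J_q conj(J'_p)` in jets. -/
def sesq (m : JetIdx → JetIdx → ℝ) (J J' : JetIdx → ℂ) : ℂ :=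
  ∑ p, ∑ q, (m p q : ℂ) * J q * conj (J' p)

/-- The coefficients of a sesquilinear expression are bounded measurable functions. -/
def BddCoeff (m : Plane → JetIdx → JetIdx → ℝ) : Prop :=
  (∀ p q, Measurable fun y => m y p q) ∧ ∃ C, ∀ y p q, |m y p q| ≤ C

theorem BddCoeff.memLp {m : Plane → JetIdx → JetIdx → ℝ} (hm : BddCoeff m) (μ : Measure Plane)
    (p q : JetIdx) : MemLp (fun y => (m y p q : ℂ)) ∞ μ := by
  obtain ⟨C, hC⟩ := hm.2
  refine memLp_top_of_bound (Complex.measurable_ofReal.comp (hm.1 p q)).aestronglyMeasurable C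
    (.of_forall fun y => ?_)
  simpa using hC y p q

section

variable {μ : Measure Plane}

/-- The jet of functions as an element of the space of square integrable jets. -/
def toJet (J : JetIdx → Plane → ℂ) (hJ : ∀ p, MemLp (J p) 2 μ) : JetSpace μ :=
  WithLp.toLp 2 fun p => (hJ p).toLp

theorem integrable_mul_conj {f g : Plane → ℂ} (hf : MemLp f 2 μ) (hg : MemLp g 2 μ) :
    Integrable (fun y => f y * conj (g y)) μ := by
  simpa using! hf.integrable_mul hg.star

theorem integrable_coeff_mul {m : Plane → JetIdx → JetIdx → ℝ} (hm : BddCoeff m)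
    {f g : Plane → ℂ} (hf : MemLp f 2 μ) (hg : MemLp g 2 μ) (p q : JetIdx) :
    Integrable (fun y => (m y p q : ℂ) * f y * conj (g y)) μ := by
  obtain ⟨C, hC⟩ := hm.2
  simp_rw [mul_assoc]
  refine (integrable_mul_conj hf hg).bdd_mul (c := C)
    (Complex.measurable_ofReal.comp (hm.1 p q)).aestronglyMeasurable (.of_forall fun y => ?_)
  simpa using hC y p q

theorem integrable_sesq {m : Plane → JetIdx → JetIdx → ℝ} (hm : BddCoeff m)
    {J J' : JetIdx → Plane → ℂ} (hJ : ∀ p, MemLp (J p) 2 μ) (hJ' : ∀ p, MemLp (J' p) 2 μ) :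
    Integrable (fun y => sesq (m y) (fun p => J p y) (fun p => J' p y)) μ :=
  integrable_finsetSum _ fun p _ => integrable_finsetSum _ fun q _ =>
    integrable_coeff_mul hm (hJ q) (hJ' p) p q

theorem inner_toLp_toLp {f g : Plane → ℂ} (hf : MemLp f 2 μ) (hg : MemLp g 2 μ) :
    ⟪hg.toLp, hf.toLp⟫_ℂ = ∫ y, f y * conj (g y) ∂μ := by
  rw [L2.inner_def]
  refine integral_congr_ae ?_
  filter_upwards [hf.coeFn_toLp, hg.coeFn_toLp] with y h1 h2
  rw [h1, h2]; simp

theorem norm_toLp_sq {f : Plane → ℂ} (hf : MemLp f 2 μ) :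
    ‖hf.toLp‖ ^ 2 = ∫ y, ‖f y‖ ^ 2 ∂μ := by
  have h := inner_toLp_toLp hf hf
  rw [inner_self_eq_norm_sq_to_K] at h
  have h2 : ∀ y, f y * conj (f y) = ((‖f y‖ ^ 2 : ℝ) : ℂ) := fun y => by
    rw [Complex.mul_conj']; push_cast; rfl
  simp_rw [h2] at h
  rw [integral_complex_ofReal] at h
  apply Complex.ofReal_injective
  rw [← h, Complex.ofReal_pow]; rfl

theorem integral_sesq {m : Plane → JetIdx → JetIdx → ℝ} (hm : BddCoeff m)
    {J J' : JetIdx → Plane → ℂ} (hJ : ∀ p, MemLp (J p) 2 μ) (hJ' : ∀ p, MemLp (J' p) 2 μ) :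
    ∫ y, sesq (m y) (fun p => J p y) (fun p => J' p y) ∂μ =
      ∑ p, ∑ q, ⟪(hJ' p).toLp,
        (toLinf μ (fun y => (m y p q : ℂ)) • (hJ q).toLp : Lp ℂ 2 μ)⟫_ℂ := by
  simp only [sesq]
  rw [integral_finsetSum _ fun p _ => integrable_finsetSum _ fun q _ =>
    integrable_coeff_mul hm (hJ q) (hJ' p) p q]
  refine Finset.sum_congr rfl fun p _ => ?_
  rw [integral_finsetSum _ fun q _ => integrable_coeff_mul hm (hJ q) (hJ' p) p q]
  refine Finset.sum_congr rfl fun q _ => ?_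
  rw [inner_toLinf_smul (hm.memLp μ p q)]
  refine integral_congr_ae ?_
  filter_upwards [(hJ q).coeFn_toLp, (hJ' p).coeFn_toLp] with y h1 h2
  rw [h1, h2]

/-- The bounded operator of multiplication by a matrix of bounded functions. -/
def opM (M : JetIdx → JetIdx → Lp ℂ ∞ μ) : JetSpace μ →L[ℂ] JetSpace μ :=
  (PiLp.continuousLinearEquiv 2 ℂ fun _ : JetIdx => Lp ℂ 2 μ).symm.toContinuousLinearMap ∘L
    ContinuousLinearMap.pi fun p => ∑ q,
      (ContinuousLinearMap.mul ℂ ℂ).holderL μ ∞ 2 2 (M p q) ∘L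
        PiLp.proj 2 (fun _ : JetIdx => Lp ℂ 2 μ) q

theorem inner_opM (M : JetIdx → JetIdx → Lp ℂ ∞ μ) (U Φ : JetSpace μ) :
    ⟪Φ, opM M U⟫_ℂ = ∑ p, ∑ q, ⟪Φ p, (M p q • U q : Lp ℂ 2 μ)⟫_ℂ := by
  rw [PiLp.inner_apply]
  refine Finset.sum_congr rfl fun p _ => ?_
  rw [← inner_sum]
  congr 1

theorem inner_opM_toJet {m : Plane → JetIdx → JetIdx → ℝ} (hm : BddCoeff m)
    {J J' : JetIdx → Plane → ℂ} (hJ : ∀ p, MemLp (J p) 2 μ) (hJ' : ∀ p, MemLp (J' p) 2 μ) :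
    ⟪toJet J' hJ', opM (fun p q => toLinf μ fun y => (m y p q : ℂ)) (toJet J hJ)⟫_ℂ =
      ∫ y, sesq (m y) (fun p => J p y) (fun p => J' p y) ∂μ := by
  rw [integral_sesq hm hJ hJ', inner_opM]; rfl

theorem norm_toJet_sq {J : JetIdx → Plane → ℂ} (hJ : ∀ p, MemLp (J p) 2 μ) :
    ‖toJet J hJ‖ ^ 2 = ∑ p, ∫ y, ‖J p y‖ ^ 2 ∂μ := by
  rw [PiLp.norm_sq_eq_of_L2]
  exact Finset.sum_congr rfl fun p _ => norm_toLp_sq (hJ p)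

theorem tendsto_jetSpace_iff {α : Type*} {l : Filter α} {U : α → JetSpace μ} {U₀ : JetSpace μ} :
    Tendsto U l (𝓝 U₀) ↔ ∀ p, Tendsto (fun k => U k p) l (𝓝 (U₀ p)) := by
  constructor
  · intro h p
    exact ((PiLp.proj (𝕜 := ℂ) 2 (fun _ : JetIdx => Lp ℂ 2 μ) p).continuous.tendsto U₀).comp h
  · intro h
    have h1 : Tendsto (fun k => (U k).ofLp) l (𝓝 U₀.ofLp) := tendsto_pi_nhds.2 h
    exact ((PiLp.continuous_toLp 2 (fun _ : JetIdx => Lp ℂ 2 μ)).tendsto U₀.ofLp).comp h1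

end

/-! ### Fields in the closure of a class of smooth fields -/

/-- A linear class of smooth functions with square integrable first-order jets on `Ω`. -/
structure TestClass (S : Set (Plane → ℂ)) (Ω : Set Plane) : Prop where
  zero_mem : (fun _ => 0) ∈ S
  add_mem : ∀ f ∈ S, ∀ g ∈ S, (fun y => f y + g y) ∈ S
  smul_mem : ∀ (c : ℂ), ∀ f ∈ S, (fun y => c * f y) ∈ S
  contDiff : ∀ f ∈ S, ContDiff ℝ ∞ f
  memLp : ∀ f ∈ S, MemLp f 2 (volume.restrict Ω)
  memLp_pderiv : ∀ f ∈ S, ∀ j, MemLp (pderiv j f) 2 (volume.restrict Ω)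

theorem pderiv_add {f g : Plane → ℂ} (hf : ContDiff ℝ ∞ f) (hg : ContDiff ℝ ∞ g) (j : Fin 2)
    (y : Plane) : pderiv j (fun y => f y + g y) y = pderiv j f y + pderiv j g y := by
  have h1 := (hf.differentiable (by simp)) y
  have h2 := (hg.differentiable (by simp)) y
  rw [pderiv, fderiv_fun_add h1 h2]; rfl

theorem pderiv_const_mul {f : Plane → ℂ} (hf : ContDiff ℝ ∞ f) (c : ℂ) (j : Fin 2)
    (y : Plane) : pderiv j (fun y => c * f y) y = c * pderiv j f y := by
  have h1 := (hf.differentiable (by simp)) y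
  rw [pderiv, fderiv_const_mul h1]; rfl

theorem pderiv_mul {f g : Plane → ℂ} (hf : ContDiff ℝ ∞ f) (hg : ContDiff ℝ ∞ g) (j : Fin 2)
    (y : Plane) : pderiv j (fun y => f y * g y) y = f y * pderiv j g y + pderiv j f y * g y := by
  have h1 := (hf.differentiable (by simp)) y
  have h2 := (hg.differentiable (by simp)) y
  rw [pderiv, fderiv_fun_mul h1 h2]
  simp [pderiv, mul_comm]

theorem continuous_pderiv {f : Plane → ℂ} (hf : ContDiff ℝ ∞ f) (j : Fin 2) :
    Continuous (pderiv j f) :=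
  (hf.continuous_fderiv (by simp)).clm_apply continuous_const

/-- The jet of a smooth field. -/
def smoothJet (φ : Fin 2 → Plane → ℂ) : JetIdx → Plane → ℂ :=
  Sum.elim φ fun ij => pderiv ij.2 (φ ij.1)

namespace H1Closure

variable {S : Set (Plane → ℂ)} {Ω : Set Plane}

/-- The component functions of the jet of a field. -/
def jetFun (u : H1Closure S Ω) : JetIdx → Plane → ℂ := Sum.elim u.toFun fun ij => u.grad ij.1 ij.2

theorem memLp_jetFun (u : H1Closure S Ω) : ∀ p, MemLp (u.jetFun p) 2 (volume.restrict Ω)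
  | .inl i => u.memLp_toFun i
  | .inr ij => u.memLp_grad ij.1 ij.2

/-- The square integrable jet of a field. -/
def jet (u : H1Closure S Ω) : JetSpace (volume.restrict Ω) := toJet u.jetFun u.memLp_jetFun

theorem jet_apply (u : H1Closure S Ω) (p : JetIdx) :
    u.jet p = (u.memLp_jetFun p).toLp (u.jetFun p) := rfl

theorem coeFn_jet (u : H1Closure S Ω) (p : JetIdx) :
    (u.jet p : Plane → ℂ) =ᵐ[volume.restrict Ω] u.jetFun p :=
  (u.memLp_jetFun p).coeFn_toLp

/-- The field defined by a smooth field of the class. -/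
def ofSmooth (hS : TestClass S Ω) (φ : Fin 2 → Plane → ℂ) (hφ : ∀ i, φ i ∈ S) : H1Closure S Ω where
  toFun := φ
  grad i j := pderiv j (φ i)
  memLp_toFun i := hS.memLp _ (hφ i)
  memLp_grad i j := hS.memLp_pderiv _ (hφ i) j
  approx i := ⟨fun _ => φ i, fun _ => hφ i, by simp, by simp⟩

/-- Smooth fields are dense. -/
theorem exists_seq_ofSmooth (hS : TestClass S Ω) (u : H1Closure S Ω) :
    ∃ (φ : ℕ → Fin 2 → Plane → ℂ) (hφ : ∀ k i, φ k i ∈ S),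
      Tendsto (fun k => (ofSmooth hS (φ k) (hφ k)).jet) atTop (𝓝 u.jet) := by
  choose φ hφ h0 h1 using u.approx
  refine ⟨fun k i => φ i k, fun k i => hφ i k, tendsto_jetSpace_iff.2 fun p => ?_⟩
  refine (Lp.tendsto_Lp_iff_tendsto_eLpNorm'' _ (fun k => memLp_jetFun _ p) _
    (u.memLp_jetFun p)).2 ?_
  match p with
  | .inl i => exact h0 i
  | .inr ij => exact h1 ij.1 ij.2

/-- A limit of jets of fields is the jet of a field. -/
theorem exists_jet_eq_of_tendsto (hS : TestClass S Ω) {u : ℕ → H1Closure S Ω}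
    {U : JetSpace (volume.restrict Ω)} (h : Tendsto (fun k => (u k).jet) atTop (𝓝 U)) :
    ∃ u₀ : H1Closure S Ω, u₀.jet = U ∧ ∀ p, u₀.jetFun p = U p := by
  -- Diagonal argument: each `u k` is replaced by a smooth field at distance less than 1/(k+1).
  have h1 : ∀ k : ℕ, ∃ (φ : Fin 2 → Plane → ℂ) (hφ : ∀ i, φ i ∈ S),
      dist (ofSmooth hS φ hφ).jet (u k).jet < 1 / ((k : ℝ) + 1) := by
    intro k
    obtain ⟨φ, hφ, hlim⟩ := exists_seq_ofSmooth hS (u k)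
    obtain ⟨n, hn⟩ := ((Metric.tendsto_nhds.1 hlim) (1 / ((k : ℝ) + 1)) (by positivity)).exists
    exact ⟨φ n, hφ n, hn⟩
  choose φ hφ hd using h1
  have h2 : Tendsto (fun k => (ofSmooth hS (φ k) (hφ k)).jet) atTop (𝓝 U) := by
    rw [tendsto_iff_dist_tendsto_zero] at h ⊢
    refine squeeze_zero (fun _ => dist_nonneg) (fun k => dist_triangle _ (u k).jet _) ?_
    simpa using (squeeze_zero (fun _ => dist_nonneg) (fun k => (hd k).le)
      tendsto_one_div_add_atTop_nhds_zero_nat).add h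
  rw [tendsto_jetSpace_iff] at h2
  -- The limit field is built from the chosen representatives of `U`, so its component functions
  -- equal those of `U` everywhere and not merely almost everywhere.
  let V : JetIdx → Plane → ℂ := fun p => ((U p : Lp ℂ 2 (volume.restrict Ω)) : Plane → ℂ)
  have hV : ∀ p, MemLp (V p) 2 (volume.restrict Ω) := fun p => Lp.memLp (U p)
  have hVU : ∀ p, (hV p).toLp = U p := fun p => Lp.toLp_coeFn (U p) _
  have h3 : ∀ p, Tendsto (fun k => eLpNorm (smoothJet (φ k) p - V p) 2 (volume.restrict Ω)) atTop
      (𝓝 0) := fun p => by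
    have h4 := h2 p
    rw [← hVU p] at h4
    exact (Lp.tendsto_Lp_iff_tendsto_eLpNorm'' (fun k => smoothJet (φ k) p)
      (fun k => (ofSmooth hS (φ k) (hφ k)).memLp_jetFun p) _ (hV p)).1 h4
  let u₀ : H1Closure S Ω := ⟨fun i => V (.inl i), fun i j => V (.inr (i, j)), fun i => hV _,
    fun i j => hV _, fun i => ⟨fun k => φ k i, fun k => hφ k i, h3 (.inl i),
      fun j => h3 (.inr (i, j))⟩⟩
  have h4 : u₀.jetFun = V := by
    funext p
    match p with
    | .inl i => rfl
    | .inr ij => rfl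
  refine ⟨u₀, ?_, fun p => congrFun h4 p⟩
  ext p : 1
  rw [jet_apply, ← hVU p]
  exact MemLp.toLp_congr _ _ (.of_forall fun y => by rw [h4])

theorem add_ofSmooth_jet (hS : TestClass S Ω) {φ ψ : Fin 2 → Plane → ℂ} (hφ : ∀ i, φ i ∈ S)
    (hψ : ∀ i, ψ i ∈ S) : (ofSmooth hS (fun i y => φ i y + ψ i y)
      (fun i => hS.add_mem _ (hφ i) _ (hψ i))).jet =
      (ofSmooth hS φ hφ).jet + (ofSmooth hS ψ hψ).jet := by
  ext p : 1
  rw [PiLp.add_apply, jet_apply, jet_apply, jet_apply, ← MemLp.toLp_add]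
  refine MemLp.toLp_congr _ _ (.of_forall fun y => ?_)
  match p with
  | .inl i => rfl
  | .inr ij => exact pderiv_add (hS.contDiff _ (hφ _)) (hS.contDiff _ (hψ _)) _ _

theorem smul_ofSmooth_jet (hS : TestClass S Ω) {φ : Fin 2 → Plane → ℂ} (hφ : ∀ i, φ i ∈ S)
    (c : ℂ) : (ofSmooth hS (fun i y => c * φ i y) (fun i => hS.smul_mem c _ (hφ i))).jet =
      c • (ofSmooth hS φ hφ).jet := by
  ext p : 1
  rw [PiLp.smul_apply, jet_apply, jet_apply, ← MemLp.toLp_const_smul]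
  refine MemLp.toLp_congr _ _ (.of_forall fun y => ?_)
  match p with
  | .inl i => rfl
  | .inr ij => exact pderiv_const_mul (hS.contDiff _ (hφ _)) _ _ _

/-- The jets of smooth fields of the class. -/
def smoothJets (hS : TestClass S Ω) : Submodule ℂ (JetSpace (volume.restrict Ω)) where
  carrier := {U | ∃ (φ : Fin 2 → Plane → ℂ) (hφ : ∀ i, φ i ∈ S), (ofSmooth hS φ hφ).jet = U}
  zero_mem' :=
    ⟨_, _, (smul_ofSmooth_jet hS (fun _ => hS.zero_mem) 0).trans (zero_smul ℂ _)⟩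
  add_mem' := by
    rintro _ _ ⟨φ, hφ, rfl⟩ ⟨ψ, hψ, rfl⟩
    exact ⟨_, _, add_ofSmooth_jet hS hφ hψ⟩
  smul_mem' := by
    rintro c _ ⟨φ, hφ, rfl⟩
    exact ⟨_, _, smul_ofSmooth_jet hS hφ c⟩

/-- `H1Closure` carries no vector space structure. Linear combinations, orthogonal projections and
density arguments are made in this closed subspace of a Hilbert space and brought back through the
equivalence. -/
theorem mem_closure_smoothJets (hS : TestClass S Ω) {U : JetSpace (volume.restrict Ω)} :
    U ∈ (smoothJets hS).topologicalClosure ↔ ∃ u : H1Closure S Ω, u.jet = U := by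
  rw [← SetLike.mem_coe, Submodule.topologicalClosure_coe]
  constructor
  · intro h
    obtain ⟨x, hx, hlim⟩ := mem_closure_iff_seq_limit.1 h
    choose φ hφ hx using hx
    rw [show x = fun k => (ofSmooth hS (φ k) (hφ k)).jet from funext fun k => (hx k).symm] at hlim
    obtain ⟨u, hu, -⟩ := exists_jet_eq_of_tendsto hS hlim
    exact ⟨u, hu⟩
  · rintro ⟨u, rfl⟩
    obtain ⟨φ, hφ, hlim⟩ := exists_seq_ofSmooth hS u
    exact mem_closure_of_tendsto hlim (.of_forall fun k => ⟨_, _, rfl⟩)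

end H1Closure

end HighContrast
end

noncomputable section

namespace HighContrast

open scoped ComplexConjugate ENNReal InnerProductSpace

/-! ### Fourier description of `H¹_θ(Q)` -/

theorem cell_ae_eq_Icc : (cell : Set Plane) =ᵐ[volume]
    (WithLp.ofLp ⁻¹' Set.Icc (0 : Fin 2 → ℝ) 1 : Set Plane) := by
  have h1 : (cell : Set Plane) = WithLp.ofLp ⁻¹' (Set.univ.pi fun _ : Fin 2 => Set.Ico (0 : ℝ) 1) := by
    ext y; simp [cell]
  rw [h1]
  refine (PiLp.volume_preserving_ofLp (Fin 2)).quasiMeasurePreserving.preimage_ae_eq ?_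
  exact Measure.univ_pi_Ico_ae_eq_Icc (μ := fun _ : Fin 2 => (volume : Measure ℝ))

theorem setIntegral_cell_eq (F : Plane → ℂ) :
    ∫ y in cell, F y = ∫ x in Set.Icc (0 : Fin 2 → ℝ) 1, F (WithLp.toLp 2 x) := by
  rw [setIntegral_congr_set cell_ae_eq_Icc,
    ← (PiLp.volume_preserving_ofLp (Fin 2)).setIntegral_preimage_emb
      (MeasurableEquiv.toLp 2 (Fin 2 → ℝ)).symm.measurableEmbedding]

/-- The derivative of a smooth periodic function has mean zero over the cell. -/
theorem integral_pderiv_eq_zero {ψ : Plane → ℂ} (hψ : ContDiff ℝ ∞ ψ)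
    (hper : ∀ y n, ψ (y + latticeVec n) = ψ y) (j : Fin 2) : ∫ y in cell, pderiv j ψ y = 0 := by
  rw [setIntegral_cell_eq]
  -- The divergence theorem on the square is applied to the vector field whose only component is ψ,
  -- in direction j; periodicity cancels the two opposite faces.
  let f : Fin 2 → (Fin 2 → ℝ) → ℂ := fun i x => if i = j then ψ (WithLp.toLp 2 x) else 0
  let f' : Fin 2 → (Fin 2 → ℝ) → (Fin 2 → ℝ) →L[ℝ] ℂ := fun i x =>
    if i = j then (fderiv ℝ ψ (WithLp.toLp 2 x)).comp
      (PiLp.continuousLinearEquiv 2 ℝ (fun _ : Fin 2 => ℝ)).symm.toContinuousLinearMap else 0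
  have hcont : Continuous fun x : Fin 2 → ℝ => (WithLp.toLp 2 x : Plane) :=
    PiLp.continuous_toLp 2 _
  have hsum : ∀ x : Fin 2 → ℝ, ∑ i, f' i x (Pi.single i 1) = pderiv j ψ (WithLp.toLp 2 x) := by
    intro x
    rw [Finset.sum_eq_single j (fun i _ hi => by simp [f', hi]) (by simp)]
    simp only [f', if_true, pderiv]
    rfl
  have hdiv := integral_divergence_of_hasFDerivAt_off_countable' (0 : Fin 2 → ℝ) 1 zero_le_one f f'
    ∅ Set.countable_empty
    (fun i => by
      by_cases hi : i = j
      · simp only [f, hi, if_true]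
        exact (hψ.continuous.comp hcont).continuousOn
      · simp only [f, hi, if_false]
        exact continuousOn_const)
    (fun x _ i => by
      by_cases hi : i = j
      · simp only [f, f', hi, if_true]
        have h1 := ((hψ.differentiable (by simp)) (WithLp.toLp 2 x)).hasFDerivAt
        exact h1.comp x
          (PiLp.continuousLinearEquiv 2 ℝ (fun _ : Fin 2 => ℝ)).symm.toContinuousLinearMap.hasFDerivAt
      · simp only [f, f', hi, if_false]
        exact hasFDerivAt_const _ _)
    (by
      simp_rw [hsum]
      exact ((continuous_pderiv hψ j).comp hcont).continuousOn.integrableOn_compact isCompact_Icc)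
  simp_rw [hsum] at hdiv
  rw [hdiv]
  refine Finset.sum_eq_zero fun i _ => sub_eq_zero.2 ?_
  refine integral_congr_ae (.of_forall fun x => ?_)
  simp only [f]
  by_cases hi : i = j
  · subst hi
    simp only [if_true]
    rw [← hper (WithLp.toLp 2 (i.insertNth ((0 : Fin 2 → ℝ) i) x)) (Pi.single i 1)]
    congr 1
    ext k
    simp only [PiLp.add_apply, latticeVec_apply]
    by_cases hk : k = i
    · subst hk; simp
    · obtain ⟨m, rfl⟩ := Fin.exists_succAbove_eq hk
      simp
  · simp [hi]

theorem norm_le_two_of_mem_cell {y : Plane} (hy : y ∈ cell) : ‖y‖ ≤ 2 := by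
  rw [EuclideanSpace.norm_eq, Fin.sum_univ_two]
  refine Real.sqrt_le_iff.2 ⟨by norm_num, ?_⟩
  have h0 := hy 0
  have h1 := hy 1
  rw [Real.norm_of_nonneg h0.1, Real.norm_of_nonneg h1.1]
  nlinarith

theorem memLp_cell_of_continuous {f : Plane → ℂ} (hf : Continuous f) (p : ℝ≥0∞) : MemLp f p μQ := by
  obtain ⟨C, hC⟩ := (isCompact_closedBall (0 : Plane) 2).exists_bound_of_continuousOn hf.continuousOn
  refine MemLp.of_bound hf.aestronglyMeasurable C ?_
  filter_upwards [ae_restrict_mem measurableSet_cell] with y hy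
  exact hC y (by simpa using norm_le_two_of_mem_cell hy)

theorem testClass_smoothQuasiperiodic (θ : Plane) : TestClass (smoothQuasiperiodic θ) cell where
  zero_mem := ⟨contDiff_const, fun _ _ => by simp⟩
  add_mem f hf g hg := ⟨hf.1.add hg.1, fun y n => by beta_reduce; rw [hf.2, hg.2]; ring⟩
  smul_mem c f hf := ⟨contDiff_const.mul hf.1, fun y n => by beta_reduce; rw [hf.2]; ring⟩
  contDiff f hf := hf.1
  memLp f hf := memLp_cell_of_continuous hf.1.continuous _
  memLp_pderiv f hf j := memLp_cell_of_continuous (continuous_pderiv hf.1 j) _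

/-- The derivatives `h j` of `g` have the Fourier coefficients of the derivatives of a
`θ`-quasiperiodic function. -/
def QuasiJet (θ : Plane) (g : L2Q) (h : Fin 2 → L2Q) : Prop :=
  ∀ k j, ⟪modeL (θ + latticeVec k), h j⟫_ℂ =
    2 * Real.pi * Complex.I * (θ + latticeVec k) j * ⟪modeL (θ + latticeVec k), g⟫_ℂ

theorem inner_modeL_toLp (ξ : Plane) {f : Plane → ℂ} (hf : MemLp f 2 μQ) :
    ⟪modeL ξ, hf.toLp⟫_ℂ = ∫ y in cell, f y * mode (-ξ) y := by
  rw [modeL, inner_toLp_toLp]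
  simp_rw [mode_neg_left]

/-- Integration by parts without boundary terms: φ times the conjugate wave is periodic, since the
quasiperiodic phases cancel, so the derivative of the product has mean zero. -/
theorem inner_modeL_pderiv {θ : Plane} {φ : Plane → ℂ} (hφ : φ ∈ smoothQuasiperiodic θ)
    (k : Fin 2 → ℤ) (j : Fin 2) :
    ∫ y in cell, pderiv j φ y * mode (-(θ + latticeVec k)) y =
      2 * Real.pi * Complex.I * (θ + latticeVec k) j *
        ∫ y in cell, φ y * mode (-(θ + latticeVec k)) y := by
  set ξ := θ + latticeVec k
  have h0 := integral_pderiv_eq_zero (hφ.1.mul (contDiff_mode (-ξ))) (fun y n => by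
    rw [((smoothQuasiperiodic_iff θ φ).1 hφ).2, mode_add_right, mode_neg_left ξ (latticeVec n)]
    have h1 : mode ξ (latticeVec n) = mode θ (latticeVec n) := by
      rw [mode_add_left, mode_latticeVec, mul_one]
    rw [h1]
    linear_combination (φ y * mode (-ξ) y) * mode_mul_conj θ (latticeVec n)) j
  simp_rw [pderiv_mul hφ.1 (contDiff_mode (-ξ)), pderiv_mode] at h0
  have i1 : Integrable (fun y => φ y * mode (-ξ) y) μQ :=
    memLp_one_iff_integrable.1
      (memLp_cell_of_continuous (hφ.1.continuous.mul (continuous_mode _)) 1)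
  have i2 : Integrable (fun y => pderiv j φ y * mode (-ξ) y) μQ :=
    memLp_one_iff_integrable.1
      (memLp_cell_of_continuous ((continuous_pderiv hφ.1 j).mul (continuous_mode _)) 1)
  have h2 : ∀ y, φ y * (2 * Real.pi * Complex.I * ((-ξ) j : ℝ) * mode (-ξ) y) =
      -(2 * Real.pi * Complex.I * ξ j) * (φ y * mode (-ξ) y) := fun y => by
    rw [PiLp.neg_apply]; push_cast; ring
  simp_rw [h2] at h0
  rw [integral_add (i1.const_mul _) i2, integral_const_mul] at h0
  linear_combination h0

theorem quasiJet_jet {θ : Plane} (u : H1Theta θ) (i : Fin 2) :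
    QuasiJet θ (u.jet (.inl i)) fun j => u.jet (.inr (i, j)) := by
  intro k j
  obtain ⟨φ, hφ, hlim⟩ := u.exists_seq_ofSmooth (testClass_smoothQuasiperiodic θ)
  rw [tendsto_jetSpace_iff] at hlim
  have h1 : Tendsto (fun n => ⟪modeL (θ + latticeVec k),
      (H1Closure.ofSmooth (testClass_smoothQuasiperiodic θ) (φ n) (hφ n)).jet (.inl i)⟫_ℂ) atTop
      (𝓝 ⟪modeL (θ + latticeVec k), u.jet (.inl i)⟫_ℂ) :=
    tendsto_const_nhds.inner (hlim (.inl i))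
  have h2 : Tendsto (fun n => ⟪modeL (θ + latticeVec k),
      (H1Closure.ofSmooth (testClass_smoothQuasiperiodic θ) (φ n) (hφ n)).jet (.inr (i, j))⟫_ℂ) atTop
      (𝓝 ⟪modeL (θ + latticeVec k), u.jet (.inr (i, j))⟫_ℂ) :=
    tendsto_const_nhds.inner (hlim (.inr (i, j)))
  refine tendsto_nhds_unique h2 ((h1.const_mul _).congr fun n => ?_)
  rw [H1Closure.jet_apply, H1Closure.jet_apply, inner_modeL_toLp, inner_modeL_toLp]
  exact (inner_modeL_pderiv (hφ n i) k j).symm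

/-- A trigonometric polynomial. -/
def trigPoly (θ : Plane) (s : Finset (Fin 2 → ℤ)) (c : (Fin 2 → ℤ) → ℂ) (y : Plane) : ℂ :=
  ∑ k ∈ s, c k * mode (θ + latticeVec k) y

theorem trigPoly_mem (θ : Plane) (s : Finset (Fin 2 → ℤ)) (c : (Fin 2 → ℤ) → ℂ) :
    trigPoly θ s c ∈ smoothQuasiperiodic θ := by
  refine ⟨ContDiff.sum fun k _ => contDiff_const.mul (contDiff_mode _), fun y n => ?_⟩
  simp only [trigPoly, Finset.mul_sum]
  refine Finset.sum_congr rfl fun k _ => ?_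
  rw [(mode_mem_smoothQuasiperiodic θ k).2 y n]; ring

theorem pderiv_trigPoly (θ : Plane) (s : Finset (Fin 2 → ℤ)) (c : (Fin 2 → ℤ) → ℂ) (j : Fin 2)
    (y : Plane) : pderiv j (trigPoly θ s c) y =
      trigPoly θ s (fun k => 2 * Real.pi * Complex.I * (θ + latticeVec k) j * c k) y := by
  unfold trigPoly
  rw [pderiv, fderiv_fun_sum (fun k _ =>
    ((contDiff_mode (θ + latticeVec k)).differentiable (by simp) y).const_mul (c k)),
    sum_apply]
  refine Finset.sum_congr rfl fun k _ => ?_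
  have := pderiv_const_mul (contDiff_mode (θ + latticeVec k)) (c k) j y
  rw [pderiv] at this
  rw [this, pderiv_mode]; ring

theorem toLp_trigPoly (θ : Plane) (s : Finset (Fin 2 → ℤ)) (c : (Fin 2 → ℤ) → ℂ)
    {f : Plane → ℂ} (hf : MemLp f 2 μQ) (h : ∀ y, f y = trigPoly θ s c y) :
    hf.toLp = ∑ k ∈ s, c k • modeL (θ + latticeVec k) := by
  apply Lp.ext
  have h1 : ∀ᵐ y ∂μQ, ∀ k : Fin 2 → ℤ, (c k • modeL (θ + latticeVec k) : L2Q) y =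
      c k * mode (θ + latticeVec k) y := ae_all_iff.2 fun k => by
    filter_upwards [Lp.coeFn_smul (c k) (modeL (θ + latticeVec k)), coeFn_modeL (θ + latticeVec k)]
      with y h1 h2
    rw [h1, Pi.smul_apply, h2, smul_eq_mul]
  filter_upwards [hf.coeFn_toLp, h1, Lp.coeFn_finsetSum s fun k => c k • modeL (θ + latticeVec k)]
    with y h2 h3 h4
  rw [h2, h4, h y, Finset.sum_apply, trigPoly]
  exact Finset.sum_congr rfl fun k _ => (h3 k).symm

/-- Converse of `quasiJet_jet`. The truncated Fourier series of the values are smooth and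
θ-quasiperiodic, and by the coefficient relation their derivatives are the truncated Fourier series
of the remaining entries; all of them converge in L². -/
theorem exists_h1Theta_of_quasiJet {θ : Plane} {U : JetSpace μQ}
    (hU : ∀ i, QuasiJet θ (U (.inl i)) fun j => U (.inr (i, j))) :
    ∃ u : H1Theta θ, u.jet = U ∧ ∀ p, u.jetFun p = U p := by
  -- `H1Closure` asks for sequences, so the unconditional Fourier sums are read along one sequence
  -- of finite sets tending to `atTop`.
  obtain ⟨s, hs⟩ := exists_seq_tendsto (atTop : Filter (Finset (Fin 2 → ℤ)))
  have hconv : ∀ f : L2Q, Tendsto (fun n => ∑ k ∈ s n,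
      ⟪modeL (θ + latticeVec k), f⟫_ℂ • modeL (θ + latticeVec k)) atTop (𝓝 f) := fun f => by
    have h := ((fourierBasis θ).hasSum_repr f)
    simp only [fourierBasis_apply, fourierBasis_repr] at h
    exact h.comp hs
  refine H1Closure.exists_jet_eq_of_tendsto (testClass_smoothQuasiperiodic θ)
    (u := fun n => H1Closure.ofSmooth (testClass_smoothQuasiperiodic θ)
      (fun i => trigPoly θ (s n) fun k => ⟪modeL (θ + latticeVec k), U (.inl i)⟫_ℂ)
      fun i => trigPoly_mem _ _ _) (tendsto_jetSpace_iff.2 fun p => ?_)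
  match p with
  | .inl i =>
    refine (hconv (U (.inl i))).congr fun n => ?_
    rw [H1Closure.jet_apply]
    exact (toLp_trigPoly θ _ _ _ fun y => rfl).symm
  | .inr ij =>
    refine (hconv (U (.inr ij))).congr fun n => ?_
    rw [H1Closure.jet_apply]
    refine (toLp_trigPoly θ _ _ _ fun y => ?_).symm
    refine (pderiv_trigPoly _ _ _ _ _).trans ?_
    simp only [trigPoly]
    refine Finset.sum_congr rfl fun k _ => ?_
    rw [← hU ij.1 k ij.2]

end HighContrast
end

noncomputable section

namespace HighContrast

open scoped ComplexConjugate ENNReal InnerProductSpace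

/-! ### Weak and strong compactness -/

/-- Bounded sequences in a separable Hilbert space have weakly convergent subsequences. -/
theorem exists_weak_subseq {H : Type*} [NormedAddCommGroup H] [InnerProductSpace ℂ H]
    [CompleteSpace H] [TopologicalSpace.SeparableSpace H] {x : ℕ → H} {C : ℝ}
    (hx : ∀ n, ‖x n‖ ≤ C) : ∃ (x₀ : H) (s : ℕ → ℕ), StrictMono s ∧
      ∀ g, Tendsto (fun k => ⟪g, x (s k)⟫_ℂ) atTop (𝓝 ⟪g, x₀⟫_ℂ) := by
  obtain ⟨f, -, s, hs, hlim⟩ := WeakDual.isSeqCompact_closedBall ℂ H 0 C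
    (x := fun n => WeakDual.toStrongDual.symm (InnerProductSpace.toDual ℂ H (x n)))
    (fun n => by simpa using hx n)
  refine ⟨(InnerProductSpace.toDual ℂ H).symm (WeakDual.toStrongDual f), s, hs, fun g => ?_⟩
  have h1 := (tendsto_iff_forall_eval_tendsto_topDualPairing.1 hlim) g
  have h2 : Tendsto (fun k => ⟪x (s k), g⟫_ℂ) atTop (𝓝 (f g)) := h1
  have h3 : ⟪g, (InnerProductSpace.toDual ℂ H).symm (WeakDual.toStrongDual f)⟫_ℂ = conj (f g) := by
    rw [← inner_conj_symm, InnerProductSpace.toDual_symm_apply]; rfl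
  rw [h3]
  refine ((Complex.continuous_conj.tendsto _).comp h2).congr fun k => ?_
  exact inner_conj_symm _ _

/-- The pairing of a weakly convergent bounded sequence and a strongly convergent sequence,
with strongly convergent bounded weights. -/
theorem tendsto_inner_smul {μ : Measure Plane} {f g : ℕ → Lp ℂ 2 μ} {f₀ g₀ : Lp ℂ 2 μ}
    {m : ℕ → Lp ℂ ∞ μ} {m₀ : Lp ℂ ∞ μ} {C : ℝ} (hf : ∀ n, ‖f n‖ ≤ C)
    (hw : ∀ g, Tendsto (fun n => ⟪g, f n⟫_ℂ) atTop (𝓝 ⟪g, f₀⟫_ℂ))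
    (hg : Tendsto g atTop (𝓝 g₀)) (hm : Tendsto m atTop (𝓝 m₀)) :
    Tendsto (fun n => ⟪g n, (m n • f n : Lp ℂ 2 μ)⟫_ℂ) atTop (𝓝 ⟪g₀, (m₀ • f₀ : Lp ℂ 2 μ)⟫_ℂ) := by
  let T : Lp ℂ 2 μ →L[ℂ] Lp ℂ 2 μ := (ContinuousLinearMap.mul ℂ ℂ).holderL μ ∞ 2 2 m₀
  have hT : ∀ f, T f = (m₀ • f : Lp ℂ 2 μ) := fun f => rfl
  -- For fixed weight and fixed test function, the adjoint of the multiplication moves the weight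
  -- onto the test function, and weak convergence applies.
  have h1 : Tendsto (fun n => ⟪g₀, (m₀ • f n : Lp ℂ 2 μ)⟫_ℂ) atTop
      (𝓝 ⟪g₀, (m₀ • f₀ : Lp ℂ 2 μ)⟫_ℂ) := by
    have := hw (ContinuousLinearMap.adjoint T g₀)
    simp only [ContinuousLinearMap.adjoint_inner_left, hT] at this
    exact this
  have h2 : Tendsto (fun n => ‖g n‖ * (‖m n - m₀‖ * C) + ‖g n - g₀‖ * (‖m₀‖ * C)) atTop (𝓝 0) := by
    have e1 := tendsto_iff_norm_sub_tendsto_zero.1 hm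
    have e2 := tendsto_iff_norm_sub_tendsto_zero.1 hg
    simpa using (hg.norm.mul (e1.mul_const C)).add (e2.mul_const (‖m₀‖ * C))
  have h3 : Tendsto (fun n => ⟪g n, (m n • f n : Lp ℂ 2 μ)⟫_ℂ - ⟪g₀, (m₀ • f n : Lp ℂ 2 μ)⟫_ℂ) atTop
      (𝓝 0) := by
    refine squeeze_zero_norm (fun n => ?_) h2
    have e : ⟪g n, (m n • f n : Lp ℂ 2 μ)⟫_ℂ - ⟪g₀, (m₀ • f n : Lp ℂ 2 μ)⟫_ℂ =
        ⟪g n, ((m n - m₀ : Lp ℂ ∞ μ) • f n : Lp ℂ 2 μ)⟫_ℂ +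
          ⟪g n - g₀, (m₀ • f n : Lp ℂ 2 μ)⟫_ℂ := by
      rw [sub_eq_add_neg (m n), Lp.smul_add, Lp.neg_smul, inner_add_right, inner_neg_right,
        inner_sub_left]
      ring
    rw [e]
    have hC : 0 ≤ C := (norm_nonneg _).trans (hf n)
    refine (norm_add_le _ _).trans (add_le_add ?_ ?_)
    · refine (norm_inner_le_norm _ _).trans (mul_le_mul_of_nonneg_left ?_ (norm_nonneg _))
      exact (Lp.norm_smul_le _ _).trans (mul_le_mul_of_nonneg_left (hf n) (norm_nonneg _))
    · refine (norm_inner_le_norm _ _).trans (mul_le_mul_of_nonneg_left ?_ (norm_nonneg _))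
      exact (Lp.norm_smul_le _ _).trans (mul_le_mul_of_nonneg_left (hf n) (norm_nonneg _))
  simpa using h3.add h1

theorem tendsto_modeL {ι : Type*} {l : Filter ι} {ξ : ι → Plane} {ξ₀ : Plane}
    (h : Tendsto ξ l (𝓝 ξ₀)) : Tendsto (fun n => modeL (ξ n)) l (𝓝 (modeL ξ₀)) := by
  have := tendsto_twist h (modeL 0)
  simpa only [twist_modeL, add_zero] using this

/-- Weakly convergent bounded sequences paired with strongly convergent ones. -/
theorem tendsto_inner_of_weak {H : Type*} [NormedAddCommGroup H] [InnerProductSpace ℂ H]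
    {f g : ℕ → H} {f₀ g₀ : H} {C : ℝ} (hf : ∀ n, ‖f n‖ ≤ C)
    (hw : ∀ g, Tendsto (fun n => ⟪g, f n⟫_ℂ) atTop (𝓝 ⟪g, f₀⟫_ℂ))
    (hg : Tendsto g atTop (𝓝 g₀)) : Tendsto (fun n => ⟪g n, f n⟫_ℂ) atTop (𝓝 ⟪g₀, f₀⟫_ℂ) := by
  have h3 : Tendsto (fun n => ⟪g n - g₀, f n⟫_ℂ) atTop (𝓝 0) := by
    refine squeeze_zero_norm (fun n => ?_)
      (by simpa using (tendsto_iff_norm_sub_tendsto_zero.1 hg).mul_const C)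
    exact (norm_inner_le_norm _ _).trans (mul_le_mul_of_nonneg_left (hf n) (norm_nonneg _))
  have h4 := h3.add (hw g₀)
  rw [zero_add] at h4
  refine h4.congr fun n => ?_
  rw [inner_sub_left]; ring

/-- Every relation involves a single Fourier coefficient, taken against a plane wave converging
strongly in L². Weak convergence therefore suffices even though the quasimomentum moves. -/
theorem quasiJet_of_weak {θ : ℕ → Plane} {θ₀ : Plane} (hθ : Tendsto θ atTop (𝓝 θ₀))
    {g : ℕ → L2Q} {h : ℕ → Fin 2 → L2Q} {g₀ : L2Q} {h₀ : Fin 2 → L2Q} {C : ℝ}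
    (hgC : ∀ n, ‖g n‖ ≤ C) (hhC : ∀ n j, ‖h n j‖ ≤ C)
    (hg : ∀ f, Tendsto (fun n => ⟪f, g n⟫_ℂ) atTop (𝓝 ⟪f, g₀⟫_ℂ))
    (hh : ∀ j f, Tendsto (fun n => ⟪f, h n j⟫_ℂ) atTop (𝓝 ⟪f, h₀ j⟫_ℂ))
    (hq : ∀ n, QuasiJet (θ n) (g n) (h n)) : QuasiJet θ₀ g₀ h₀ := by
  intro k j
  have h1 : Tendsto (fun n => θ n + latticeVec k) atTop (𝓝 (θ₀ + latticeVec k)) := hθ.add_const _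
  have h2 := tendsto_inner_of_weak hgC hg (tendsto_modeL h1)
  have h3 := tendsto_inner_of_weak (fun n => hhC n j) (hh j) (tendsto_modeL h1)
  have h4 : Tendsto (fun n => (((θ n + latticeVec k) j : ℝ) : ℂ)) atTop
      (𝓝 (((θ₀ + latticeVec k) j : ℝ) : ℂ)) :=
    (Complex.continuous_ofReal.tendsto _).comp (((continuous_coord j).tendsto _).comp h1)
  refine tendsto_nhds_unique h3 (((h4.const_mul (2 * Real.pi * Complex.I)).mul h2).congr fun n => ?_)
  exact (hq n k j).symm

/-! ### Rellich compactness through Fourier tails -/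

/-- The frequencies with both coordinates at most `R` in modulus. -/
def freqBox (R : ℕ) : Finset (Fin 2 → ℤ) := Fintype.piFinset fun _ => Finset.Icc (-(R : ℤ)) R

/-- Outside the box some coordinate of θ + k has modulus at least R, so the coefficient of g is at
most that of h j divided by 2πR. Both derivatives are summed because j depends on k, and the factor
2π is discarded. -/
theorem tail_le {θ : Plane} (hθ : ∀ j, 0 ≤ θ j ∧ θ j ≤ 1) {g : L2Q} {h : Fin 2 → L2Q}
    (hq : QuasiJet θ g h) {R : ℕ} (hR : 0 < R) :
    ‖g‖ ^ 2 ≤ ∑ k ∈ freqBox R, ‖⟪modeL (θ + latticeVec k), g⟫_ℂ‖ ^ 2 +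
      (‖h 0‖ ^ 2 + ‖h 1‖ ^ 2) / R ^ 2 := by
  have hg := hasSum_norm_sq_inner_modeL θ g
  have h0 := hasSum_norm_sq_inner_modeL θ (h 0)
  have h1 := hasSum_norm_sq_inner_modeL θ (h 1)
  have hRpos : (0 : ℝ) < R := by exact_mod_cast hR
  have hb : HasSum (fun k => if k ∈ freqBox R then ‖⟪modeL (θ + latticeVec k), g⟫_ℂ‖ ^ 2 else 0)
      (∑ k ∈ freqBox R, ‖⟪modeL (θ + latticeVec k), g⟫_ℂ‖ ^ 2) := by
    have : HasSum _ _ := hasSum_sum_of_ne_finset_zero (s := freqBox R)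
      (f := fun k => if k ∈ freqBox R then ‖⟪modeL (θ + latticeVec k), g⟫_ℂ‖ ^ 2 else 0)
      (fun k hk => by simp [hk])
    rwa [Finset.sum_congr rfl fun k hk => if_pos hk] at this
  refine hasSum_le (fun k => ?_) hg (hb.add ((h0.add h1).div_const ((R : ℝ) ^ 2)))
  by_cases hk : k ∈ freqBox R
  · simp only [hk, if_true, le_add_iff_nonneg_right]
    positivity
  · simp only [hk, if_false, zero_add]
    rw [le_div_iff₀ (by positivity)]
    have key : ∀ j, (R : ℝ) ≤ |(θ + latticeVec k) j| →
        ‖⟪modeL (θ + latticeVec k), g⟫_ℂ‖ ^ 2 * (R : ℝ) ^ 2 ≤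
          ‖⟪modeL (θ + latticeVec k), h j⟫_ℂ‖ ^ 2 := by
      intro j hj
      rw [hq k j, ← mul_pow, norm_mul]
      refine pow_le_pow_left₀ (by positivity) ?_ 2
      rw [mul_comm]
      refine mul_le_mul_of_nonneg_right ?_ (norm_nonneg _)
      simp only [norm_mul, Complex.norm_real, Complex.norm_I, Complex.norm_ofNat, mul_one]
      rw [Real.norm_of_nonneg Real.pi_pos.le, Real.norm_eq_abs]
      nlinarith [Real.pi_gt_three, abs_nonneg ((θ + latticeVec k) j)]
    have hex : ∃ j, (R : ℝ) ≤ |(θ + latticeVec k) j| := by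
      simp only [freqBox, Fintype.mem_piFinset, Finset.mem_Icc, not_forall, not_and_or, not_le] at hk
      obtain ⟨j, hj⟩ := hk
      refine ⟨j, ?_⟩
      simp only [PiLp.add_apply, latticeVec_apply]
      rcases hj with hj | hj
      -- Integrality gains a full unit, which absorbs θ j ≤ 1.
      · have h2 : (k j : ℝ) ≤ -R - 1 := by exact_mod_cast (by omega : k j ≤ -R - 1)
        rw [le_abs]; right; linarith [(hθ j).2]
      · have h2 : (R : ℝ) + 1 ≤ k j := by exact_mod_cast (by omega : (R : ℤ) + 1 ≤ k j)
        rw [le_abs]; left; linarith [(hθ j).1]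
    obtain ⟨j, hj⟩ := hex
    have := key j hj
    fin_cases j
    · exact this.trans (le_add_of_nonneg_right (by positivity))
    · exact this.trans (le_add_of_nonneg_left (by positivity))

/-- Rellich's theorem for quasiperiodic functions with converging quasimomenta. -/
theorem tendsto_of_weak_quasiJet {θ : ℕ → Plane} {θ₀ : Plane} (hθ : Tendsto θ atTop (𝓝 θ₀))
    (hcell : ∀ n, θ n ∈ cell) {g : ℕ → L2Q} {h : ℕ → Fin 2 → L2Q} {g₀ : L2Q} {C : ℝ}
    (hgC : ∀ n, ‖g n‖ ≤ C) (hhC : ∀ n j, ‖h n j‖ ≤ C)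
    (hg : ∀ f, Tendsto (fun n => ⟪f, g n⟫_ℂ) atTop (𝓝 ⟪f, g₀⟫_ℂ))
    (hq : ∀ n, QuasiJet (θ n) (g n) (h n)) : Tendsto g atTop (𝓝 g₀) := by
  have hC : 0 ≤ C := (norm_nonneg _).trans (hgC 0)
  -- For a weakly convergent sequence it is enough that the upper limit of the norms does not exceed
  -- the norm of the limit. The finitely many low frequencies converge, and `tail_le` makes the rest
  -- uniformly small.
  have hsum : ∀ R, Tendsto (fun n => ∑ k ∈ freqBox R, ‖⟪modeL (θ n + latticeVec k), g n⟫_ℂ‖ ^ 2) atTop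
      (𝓝 (∑ k ∈ freqBox R, ‖⟪modeL (θ₀ + latticeVec k), g₀⟫_ℂ‖ ^ 2)) := fun R =>
    tendsto_finsetSum _ fun k _ => ((tendsto_inner_of_weak hgC hg
      (tendsto_modeL (hθ.add_const (latticeVec k)))).norm).pow 2
  have hinner : Tendsto (fun n => Complex.re ⟪g₀, g n⟫_ℂ) atTop (𝓝 (‖g₀‖ ^ 2)) := by
    have h1 := (Complex.continuous_re.tendsto _).comp (hg g₀)
    rw [inner_self_eq_norm_sq_to_K] at h1
    have h2 : Complex.re (((‖g₀‖ : ℝ) : ℂ) ^ 2) = ‖g₀‖ ^ 2 := by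
      rw [← Complex.ofReal_pow, Complex.ofReal_re]
    rw [← h2]; exact h1
  have hsq : Tendsto (fun n => ‖g n - g₀‖ ^ 2) atTop (𝓝 0) := by
    rw [Metric.tendsto_nhds]
    intro δ hδ
    -- The tail is at most 2C²/R². The summand 1 ensures R ≤ R², so that 2C² < Rδ/4 already gives
    -- the bound δ/4.
    obtain ⟨R, hR⟩ := exists_nat_gt (8 * C ^ 2 / δ + 1)
    have hR1 : (1 : ℝ) < R := lt_of_le_of_lt (by have : 0 ≤ 8 * C ^ 2 / δ := by positivity
                                                 linarith) hR
    have hRpos : 0 < R := by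
      have : (0 : ℝ) < R := by linarith
      exact_mod_cast this
    have hfin : ∑ k ∈ freqBox R, ‖⟪modeL (θ₀ + latticeVec k), g₀⟫_ℂ‖ ^ 2 ≤ ‖g₀‖ ^ 2 :=
      sum_le_hasSum _ (fun _ _ => by positivity) (hasSum_norm_sq_inner_modeL θ₀ g₀)
    filter_upwards [(Metric.tendsto_nhds.1 (hsum R)) (δ / 4) (by positivity),
      (Metric.tendsto_nhds.1 hinner) (δ / 8) (by positivity)] with n h1 h2
    rw [Real.dist_eq, abs_lt] at h1 h2
    rw [Real.dist_eq, sub_zero, abs_of_nonneg (by positivity)]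
    have h3 := tail_le (fun j => ⟨(hcell n j).1, (hcell n j).2.le⟩) (hq n) hRpos
    have h4 : (‖h n 0‖ ^ 2 + ‖h n 1‖ ^ 2) / (R : ℝ) ^ 2 ≤ δ / 4 := by
      rw [div_le_iff₀ (by positivity)]
      have e0 : ‖h n 0‖ ^ 2 ≤ C ^ 2 := pow_le_pow_left₀ (norm_nonneg _) (hhC n 0) 2
      have e1 : ‖h n 1‖ ^ 2 ≤ C ^ 2 := pow_le_pow_left₀ (norm_nonneg _) (hhC n 1) 2
      have e2 : 8 * C ^ 2 < R * δ := by
        have : 8 * C ^ 2 / δ < R := by linarith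
        rwa [div_lt_iff₀ hδ] at this
      nlinarith
    have h5 : ‖g n - g₀‖ ^ 2 = ‖g n‖ ^ 2 - 2 * Complex.re ⟪g₀, g n⟫_ℂ + ‖g₀‖ ^ 2 := by
      rw [@norm_sub_sq ℂ, inner_re_symm]; rfl
    rw [h5]
    linarith [h1.2, h2.1]
  rw [tendsto_iff_norm_sub_tendsto_zero]
  have := hsq.sqrt
  simpa using this

local instance : Fact ((2 : ℝ≥0∞) ≠ ⊤) := ⟨by simp⟩

theorem norm_apply_le_jet {μ : Measure Plane} (U : JetSpace μ) (p : JetIdx) : ‖U p‖ ≤ ‖U‖ :=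
  PiLp.norm_apply_le U p

theorem weak_apply {μ : Measure Plane} {U : ℕ → JetSpace μ} {U₀ : JetSpace μ}
    (h : ∀ G, Tendsto (fun k => ⟪G, U k⟫_ℂ) atTop (𝓝 ⟪G, U₀⟫_ℂ)) (p : JetIdx) (f : Lp ℂ 2 μ) :
    Tendsto (fun k => ⟪f, U k p⟫_ℂ) atTop (𝓝 ⟪f, U₀ p⟫_ℂ) := by
  have h1 := h (WithLp.toLp 2 (Pi.single p f))
  have h2 : ∀ V : JetSpace μ, ⟪(WithLp.toLp 2 (Pi.single p f) : JetSpace μ), V⟫_ℂ = ⟪f, V p⟫_ℂ := by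
    intro V
    rw [PiLp.inner_apply, Finset.sum_eq_single p (fun q _ hq => by simp [hq]) (by simp)]
    simp
  simpa only [h2] using h1

/-- Sequences of quasiperiodic fields with bounded jets and converging quasimomenta are relatively
compact, weakly in `H¹` and strongly in `L²`. -/
theorem exists_subseq_h1Theta {θ : ℕ → Plane} {θ₀ : Plane} (hθ : Tendsto θ atTop (𝓝 θ₀))
    (hcell : ∀ n, θ n ∈ cell) (u : ∀ n, H1Theta (θ n)) {C : ℝ} (hC : ∀ n, ‖(u n).jet‖ ≤ C) :
    ∃ (s : ℕ → ℕ) (u₀ : H1Theta θ₀), StrictMono s ∧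
      (∀ p f, Tendsto (fun k => ⟪f, (u (s k)).jet p⟫_ℂ) atTop (𝓝 ⟪f, u₀.jet p⟫_ℂ)) ∧
      ∀ i, Tendsto (fun k => (u (s k)).jet (.inl i)) atTop (𝓝 (u₀.jet (.inl i))) := by
  obtain ⟨U, s, hs, hlim⟩ := exists_weak_subseq hC
  have hw := weak_apply hlim
  have hθs := hθ.comp hs.tendsto_atTop
  have hb : ∀ k p, ‖(u (s k)).jet p‖ ≤ C := fun k p => (norm_apply_le_jet _ p).trans (hC _)
  obtain ⟨u₀, hu₀, -⟩ := exists_h1Theta_of_quasiJet (θ := θ₀) (U := U) fun i =>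
    quasiJet_of_weak hθs (fun k => hb k (.inl i)) (fun k j => hb k (.inr (i, j))) (hw (.inl i))
      (fun j => hw (.inr (i, j))) fun k => quasiJet_jet (u (s k)) i
  subst hu₀
  exact ⟨s, u₀, hs, hw, fun i => tendsto_of_weak_quasiJet hθs (fun k => hcell (s k))
    (fun k => hb k (.inl i)) (fun k j => hb k (.inr (i, j))) (hw (.inl i))
    fun k => quasiJet_jet (u (s k)) i⟩

end HighContrast
end

noncomputable section

namespace HighContrast

open scoped ComplexConjugate ENNReal InnerProductSpace

/-! ### Fourier multipliers and the continuity of `V(θ)` in `θ` -/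

theorem inner_modeL_modeL (θ : Plane) (k k' : Fin 2 → ℤ) :
    ⟪modeL (θ + latticeVec k), modeL (θ + latticeVec k')⟫_ℂ = if k = k' then 1 else 0 := by
  have := orthonormal_iff_ite.1 (fourierBasis θ).orthonormal k k'
  simpa only [fourierBasis_apply] using this

/-- Twisting by θ' − θ carries the Fourier expansion at θ to the one at θ' coefficient by
coefficient. Functions with different quasimomenta are compared in this way. -/
theorem inner_modeL_twist {θ θ' : Plane} (k : Fin 2 → ℤ) (f : L2Q) :
    ⟪modeL (θ' + latticeVec k), twist (θ' - θ) f⟫_ℂ = ⟪modeL (θ + latticeVec k), f⟫_ℂ := by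
  rw [← inner_twist_twist (θ' - θ) (modeL (θ + latticeVec k)), twist_modeL]
  congr 2; abel

theorem norm_le_of_inner_modeL (θ : Plane) {f F : L2Q} {B : ℝ} (hB : 0 ≤ B)
    (h : ∀ k, ‖⟪modeL (θ + latticeVec k), F⟫_ℂ‖ ≤ B * ‖⟪modeL (θ + latticeVec k), f⟫_ℂ‖) :
    ‖F‖ ≤ B * ‖f‖ := by
  have h1 := hasSum_le (fun k => by
      have := pow_le_pow_left₀ (norm_nonneg _) (h k) 2
      rwa [mul_pow] at this)
    (hasSum_norm_sq_inner_modeL θ F) ((hasSum_norm_sq_inner_modeL θ f).mul_left (B ^ 2))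
  rw [← mul_pow] at h1
  exact (pow_le_pow_iff_left₀ (norm_nonneg _) (by positivity) (by norm_num)).1 h1

/-- Bounded Fourier multipliers act on `L²(Q)`. -/
theorem exists_multiplier (θ : Plane) {w : (Fin 2 → ℤ) → ℂ} {B : ℝ} (hw : ∀ k, ‖w k‖ ≤ B) (f : L2Q) :
    ∃ F : L2Q, ∀ k, ⟪modeL (θ + latticeVec k), F⟫_ℂ = w k * ⟪modeL (θ + latticeVec k), f⟫_ℂ := by
  have hmem : Memℓp (fun k => w k * ⟪modeL (θ + latticeVec k), f⟫_ℂ) 2 := by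
    refine memℓp_gen ?_
    simp only [ENNReal.toReal_ofNat, Real.rpow_two]
    refine Summable.of_nonneg_of_le (fun k => by positivity) (fun k => ?_)
      ((hasSum_norm_sq_inner_modeL θ f).summable.mul_left (B ^ 2))
    rw [norm_mul, mul_pow]
    exact mul_le_mul_of_nonneg_right (pow_le_pow_left₀ (norm_nonneg _) (hw k) 2) (by positivity)
  refine ⟨(fourierBasis θ).repr.symm ⟨_, hmem⟩, fun k => ?_⟩
  rw [← fourierBasis_repr, LinearIsometryEquiv.apply_symm_apply]

theorem tendsto_twist_of_tendsto {τ : ℕ → Plane} (hτ : Tendsto τ atTop (𝓝 0)) {x : ℕ → L2Q}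
    {x₀ : L2Q} (hx : Tendsto x atTop (𝓝 x₀)) : Tendsto (fun n => twist (τ n) (x n)) atTop (𝓝 x₀) := by
  have h1 := tendsto_twist hτ x₀
  rw [twist_zero_left] at h1
  have h2 : Tendsto (fun n => twist (τ n) (x n) - twist (τ n) x₀) atTop (𝓝 0) := by
    refine squeeze_zero_norm (fun n => ?_) (tendsto_iff_norm_sub_tendsto_zero.1 hx)
    have : twist (τ n) (x n) - twist (τ n) x₀ = twist (τ n) (x n - x₀) := by
      rw [sub_eq_add_neg (x n), twist, twist, twist, Lp.add_smul, Lp.smul_neg, sub_eq_add_neg]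
    rw [this, norm_twist]
  simpa using h2.add h1

/-- Convergence of Fourier multipliers with converging symbols and quasimomenta. -/
theorem tendsto_multiplier {θ : ℕ → Plane} {θ₀ : Plane} (hθ : Tendsto θ atTop (𝓝 θ₀))
    {w : ℕ → (Fin 2 → ℤ) → ℂ} {w₀ : (Fin 2 → ℤ) → ℂ} {B : ℝ} {δ : ℕ → ℝ}
    (hw : ∀ n k, ‖w n k‖ ≤ B) (hδ : Tendsto δ atTop (𝓝 0))
    (hwδ : ∀ n k, ‖w n k - w₀ k‖ ≤ δ n) {x F : ℕ → L2Q} {x₀ F₀ : L2Q}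
    (hx : Tendsto x atTop (𝓝 x₀))
    (hF : ∀ n k, ⟪modeL (θ n + latticeVec k), F n⟫_ℂ = w n k * ⟪modeL (θ₀ + latticeVec k), x n⟫_ℂ)
    (hF₀ : ∀ k, ⟪modeL (θ₀ + latticeVec k), F₀⟫_ℂ = w₀ k * ⟪modeL (θ₀ + latticeVec k), x₀⟫_ℂ) :
    Tendsto F atTop (𝓝 F₀) := by
  have hB : 0 ≤ B := (norm_nonneg _).trans (hw 0 0)
  have h1 : Tendsto (fun n => twist (θ₀ - θ n) (F n)) atTop (𝓝 F₀) := by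
    rw [tendsto_iff_norm_sub_tendsto_zero]
    have hlim : Tendsto (fun n => B * ‖x n - x₀‖ + δ n * ‖x₀‖) atTop (𝓝 0) := by
      simpa using ((tendsto_iff_norm_sub_tendsto_zero.1 hx).const_mul B).add (hδ.mul_const ‖x₀‖)
    refine squeeze_zero (fun _ => norm_nonneg _) (fun n => ?_) hlim
    -- Intermediate function: the new symbol acting on the old function. It separates the error due
    -- to `x n - x₀` from the error due to the change of symbol.
    obtain ⟨G, hG⟩ := exists_multiplier θ₀ (hw n) x₀
    have e1 : ‖twist (θ₀ - θ n) (F n) - G‖ ≤ B * ‖x n - x₀‖ := by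
      refine norm_le_of_inner_modeL θ₀ hB fun k => ?_
      rw [inner_sub_right, inner_sub_right, inner_modeL_twist, hF, hG, ← mul_sub, norm_mul]
      exact mul_le_mul_of_nonneg_right (hw n k) (norm_nonneg _)
    have e2 : ‖G - F₀‖ ≤ δ n * ‖x₀‖ := by
      refine norm_le_of_inner_modeL θ₀ ((norm_nonneg _).trans (hwδ n 0)) fun k => ?_
      rw [inner_sub_right, hG, hF₀, ← sub_mul, norm_mul]
      exact mul_le_mul_of_nonneg_right (hwδ n k) (norm_nonneg _)
    calc ‖twist (θ₀ - θ n) (F n) - F₀‖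
        = ‖(twist (θ₀ - θ n) (F n) - G) + (G - F₀)‖ := by congr 1; abel
      _ ≤ _ := (norm_add_le _ _).trans (add_le_add e1 e2)
  have h2 : Tendsto (fun n => θ n - θ₀) atTop (𝓝 0) := by simpa using hθ.sub_const θ₀
  refine (tendsto_twist_of_tendsto h2 h1).congr fun n => ?_
  rw [twist_twist, sub_add_sub_cancel, sub_self, twist_zero_left]

/-- The symbol of `(2πi)⁻¹ (∂₁ + σ i ∂₂)`. -/
def crSymbol (σ : ℝ) (ξ : Plane) : ℂ := ξ 0 + σ * Complex.I * ξ 1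

/-- Ellipticity of the Cauchy–Riemann operator: since σ = ±1, the symbol has modulus |ξ|. Hence the
quotients ξ_j / symbol are bounded by 1. -/
theorem le_norm_crSymbol {σ : ℝ} (hσ : σ ^ 2 = 1) (ξ : Plane) (j : Fin 2) :
    |ξ j| ≤ ‖crSymbol σ ξ‖ := by
  have h1 : ‖crSymbol σ ξ‖ ^ 2 = ξ 0 ^ 2 + ξ 1 ^ 2 := by
    rw [← Complex.normSq_eq_norm_sq, Complex.normSq_apply]
    simp [crSymbol]
    linear_combination ξ 1 ^ 2 * hσ
  refine abs_le_of_sq_le_sq ?_ (norm_nonneg _)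
  rw [h1]
  fin_cases j
  · simpa using sq_nonneg (ξ 1)
  · simpa using sq_nonneg (ξ 0)

theorem norm_crSymbol_sub_le {σ : ℝ} (hσ : σ ^ 2 = 1) (ξ η : Plane) :
    ‖crSymbol σ ξ - crSymbol σ η‖ ≤ |(ξ - η) 0| + |(ξ - η) 1| := by
  have h1 : crSymbol σ ξ - crSymbol σ η =
      (((ξ - η) 0 : ℝ) : ℂ) + (σ : ℂ) * Complex.I * (((ξ - η) 1 : ℝ) : ℂ) := by
    simp only [crSymbol, PiLp.sub_apply]; push_cast; ring
  have hσ1 : |σ| = 1 := by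
    rw [← sq_eq_sq₀ (abs_nonneg _) zero_le_one, sq_abs, hσ, one_pow]
  rw [h1]
  refine (norm_add_le _ _).trans ?_
  simp only [norm_mul, Complex.norm_real, Complex.norm_I, Real.norm_eq_abs, hσ1, mul_one, one_mul,
    le_refl]

/-- Take for k₀ the negative of the coordinatewise rounding of θ. The symbol can be small or zero at
this frequency only. -/
theorem exists_nearest_lattice (θ : Plane) : ∃ k₀ : Fin 2 → ℤ, ∀ k ≠ k₀, ∃ j,
    1 / 2 ≤ |(θ + latticeVec k) j| := by
  refine ⟨fun j => -round (θ j), fun k hk => ?_⟩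
  obtain ⟨j, hj⟩ := Function.ne_iff.1 hk
  refine ⟨j, ?_⟩
  have h1 : |θ j - round (θ j)| ≤ 1 / 2 := abs_sub_round (θ j)
  have h2 : (1 : ℝ) ≤ |((k j + round (θ j) : ℤ) : ℝ)| := by
    rw [← Int.cast_abs]
    have : k j + round (θ j) ≠ 0 := fun h => hj (by omega)
    exact_mod_cast Int.one_le_abs this
  simp only [PiLp.add_apply, latticeVec_apply]
  have h3 : ((k j + round (θ j) : ℤ) : ℝ) = (θ j + k j) - (θ j - round (θ j)) := by push_cast; ring
  rw [h3] at h2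
  linarith [abs_sub (θ j + (k j : ℝ)) (θ j - round (θ j))]

theorem QuasiJet.add {θ : Plane} {g g' : L2Q} {h h' : Fin 2 → L2Q} (H : QuasiJet θ g h)
    (H' : QuasiJet θ g' h') : QuasiJet θ (g + g') fun j => h j + h' j := fun k j => by
  rw [inner_add_right, inner_add_right, H, H']; ring

theorem QuasiJet.smul {θ : Plane} {g : L2Q} {h : Fin 2 → L2Q} (H : QuasiJet θ g h) (c : ℂ) :
    QuasiJet θ (c • g) fun j => c • h j := fun k j => by
  rw [inner_smul_right, inner_smul_right, H]; ring

/-- The lower bound 1/4 is what remains of the distance 1/2 from `exists_nearest_lattice` after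
moving the quasimomentum by at most 1/4. -/
theorem norm_inv_sub_inv_le {z w : ℂ} (hz : 1 / 4 ≤ ‖z‖) (hw : 1 / 4 ≤ ‖w‖) :
    ‖z⁻¹ - w⁻¹‖ ≤ 16 * ‖z - w‖ := by
  have hz0 : z ≠ 0 := norm_pos_iff.1 (by linarith)
  have hw0 : w ≠ 0 := norm_pos_iff.1 (by linarith)
  rw [inv_sub_inv hz0 hw0, norm_div, norm_mul, norm_sub_rev, div_le_iff₀ (by positivity)]
  have : 1 / 16 ≤ ‖z‖ * ‖w‖ := by nlinarith
  nlinarith [norm_nonneg (z - w)]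

/-- The numerators grow with the frequency, so the bound must not involve their size: |y| ≤ ‖w‖
makes the error term free of y, hence uniform over all lattice frequencies. -/
theorem norm_div_sub_div_le {z w : ℂ} {x y : ℝ} (hz : 1 / 4 ≤ ‖z‖) (hw : 1 / 4 ≤ ‖w‖)
    (hy : |y| ≤ ‖w‖) : ‖(x : ℂ) / z - y / w‖ ≤ 4 * |x - y| + 4 * ‖z - w‖ := by
  have hz0 : z ≠ 0 := norm_pos_iff.1 (by linarith)
  have hw0 : w ≠ 0 := norm_pos_iff.1 (by linarith)
  have h1 : (x : ℂ) / z - y / w = ((x - y : ℝ) : ℂ) * z⁻¹ + (y / w) * ((w - z) * z⁻¹) := by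
    push_cast; field_simp; ring
  have h2 : ‖z⁻¹‖ ≤ 4 := by
    rw [norm_inv, inv_le_comm₀ (by linarith) (by norm_num)]; linarith
  have h3 : ‖(y : ℂ) / w‖ ≤ 1 := by
    rw [norm_div, Complex.norm_real, Real.norm_eq_abs]
    exact div_le_one_of_le₀ hy (norm_nonneg _)
  rw [h1]
  refine (norm_add_le _ _).trans (add_le_add ?_ ?_)
  · rw [norm_mul, Complex.norm_real, Real.norm_eq_abs, mul_comm]
    exact mul_le_mul_of_nonneg_right h2 (abs_nonneg _)
  · rw [norm_mul, norm_mul, norm_sub_rev]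
    calc ‖(y : ℂ) / w‖ * (‖z - w‖ * ‖z⁻¹‖) ≤ 1 * (‖z - w‖ * 4) := by gcongr
      _ = 4 * ‖z - w‖ := by ring

/-- A quasiperiodic function whose Cauchy-Riemann derivative `∂₁ + σ i ∂₂` vanishes outside `S` is
a limit of such functions with prescribed converging quasimomenta. -/
theorem exists_approx_crDeriv {σ : ℝ} (hσ : σ ^ 2 = 1) {θ : ℕ → Plane} {θ₀ : Plane}
    (hθ : Tendsto θ atTop (𝓝 θ₀)) (hclose : ∀ n j, |(θ n - θ₀) j| ≤ 1 / 4) {S : Set Plane}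
    (hq : ∀ ξ, ∃ q : L2Q, ⟪modeL ξ, q⟫_ℂ = 1 ∧ ∀ᵐ y ∂μQ, y ∉ S → q y = 0)
    {g : L2Q} {h : Fin 2 → L2Q} (H : QuasiJet θ₀ g h)
    (hd : ∀ᵐ y ∂μQ, y ∉ S → (h 0 + ((σ : ℂ) * Complex.I) • h 1 : L2Q) y = 0) :
    ∃ (G : ℕ → L2Q) (K : ℕ → Fin 2 → L2Q), (∀ n, QuasiJet (θ n) (G n) (K n)) ∧
      Tendsto G atTop (𝓝 g) ∧ (∀ j, Tendsto (fun n => K n j) atTop (𝓝 (h j))) ∧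
      ∀ n, ∀ᵐ y ∂μQ, y ∉ S → (K n 0 + ((σ : ℂ) * Complex.I) • K n 1 : L2Q) y = 0 := by
  -- At `k₀` the symbol cannot be inverted uniformly. The function `q`, supported in S and with unit
  -- coefficient there, serves to prescribe this one coefficient.
  obtain ⟨k₀, hk₀⟩ := exists_nearest_lattice θ₀
  obtain ⟨q, hq1, hqS⟩ := hq (θ₀ + latticeVec k₀)
  set d : L2Q := h 0 + ((σ : ℂ) * Complex.I) • h 1 with hd_def
  set c : ℂ := ⟪modeL (θ₀ + latticeVec k₀), g⟫_ℂ with hc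
  let z : Plane → (Fin 2 → ℤ) → ℂ := fun ξ k => crSymbol σ (ξ + latticeVec k)
  let P : ℂ := 2 * Real.pi * Complex.I
  have hP : P ≠ 0 := Complex.two_pi_I_ne_zero
  have hPn : ‖P⁻¹‖ ≤ 1 := by
    have : ‖P‖ = 2 * Real.pi := by
      simp [P, abs_of_pos Real.pi_pos]
    rw [norm_inv, this]
    exact inv_le_one_of_one_le₀ (by nlinarith [Real.pi_gt_three])
  -- lower bounds and continuity of the symbols
  have hz0 : ∀ k ≠ k₀, 1 / 4 ≤ ‖z θ₀ k‖ := fun k hk => by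
    obtain ⟨j, hj⟩ := hk₀ k hk
    linarith [le_norm_crSymbol hσ (θ₀ + latticeVec k) j]
  have hzn : ∀ n, ∀ k ≠ k₀, 1 / 4 ≤ ‖z (θ n) k‖ := fun n k hk => by
    obtain ⟨j, hj⟩ := hk₀ k hk
    refine le_trans ?_ (le_norm_crSymbol hσ (θ n + latticeVec k) j)
    have h1 : (θ₀ + latticeVec k) j = (θ n + latticeVec k) j - (θ n - θ₀) j := by
      simp only [PiLp.add_apply, PiLp.sub_apply]; ring
    rw [h1] at hj
    linarith [abs_sub ((θ n + latticeVec k) j) ((θ n - θ₀) j), hclose n j]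
  let η : ℕ → ℝ := fun n => |(θ n - θ₀) 0| + |(θ n - θ₀) 1|
  have hη0 : ∀ n, 0 ≤ η n := fun n => by positivity
  have hη : Tendsto η atTop (𝓝 0) := by
    have h1 : Tendsto (fun n => θ n - θ₀) atTop (𝓝 0) := by simpa using hθ.sub_const θ₀
    have h2 : ∀ j, Tendsto (fun n => |(θ n - θ₀) j|) atTop (𝓝 0) := fun j => by
      simpa using (((continuous_coord j).tendsto 0).comp h1).abs
    have h3 := (h2 0).add (h2 1)
    rwa [add_zero] at h3
  have hzd : ∀ n k, ‖z (θ n) k - z θ₀ k‖ ≤ η n := fun n k => by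
    refine (norm_crSymbol_sub_le hσ _ _).trans_eq ?_
    rw [add_sub_add_right_eq_sub]
  have hcoord : ∀ n k j, |(θ n + latticeVec k) j - (θ₀ + latticeVec k) j| ≤ η n := fun n k j => by
    have h1 : (θ n + latticeVec k) j - (θ₀ + latticeVec k) j = (θ n - θ₀) j := by simp
    rw [h1]
    fin_cases j
    · exact le_add_of_nonneg_right (abs_nonneg _)
    · exact le_add_of_nonneg_left (abs_nonneg _)
  -- the Fourier multipliers
  let w : Plane → (Fin 2 → ℤ) → ℂ := fun ξ k => if k = k₀ then 0 else P⁻¹ * (z ξ k)⁻¹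
  let v : Fin 2 → Plane → (Fin 2 → ℤ) → ℂ := fun j ξ k =>
    if k = k₀ then 0 else ((ξ + latticeVec k) j : ℂ) / z ξ k
  have hw : ∀ n k, ‖w (θ n) k‖ ≤ 4 := fun n k => by
    by_cases hk : k = k₀
    · simp [w, hk]
    · simp only [w, hk, if_false, norm_mul]
      have h2 : ‖(z (θ n) k)⁻¹‖ ≤ 4 := by
        rw [norm_inv, inv_le_comm₀ (by linarith [hzn n k hk]) (by norm_num)]
        linarith [hzn n k hk]
      nlinarith [norm_nonneg P⁻¹, norm_nonneg (z (θ n) k)⁻¹]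
  have hv : ∀ j n k, ‖v j (θ n) k‖ ≤ 1 := fun j n k => by
    by_cases hk : k = k₀
    · simp [v, hk]
    · simp only [v, hk, if_false, norm_div, Complex.norm_real, Real.norm_eq_abs]
      exact div_le_one_of_le₀ (le_norm_crSymbol hσ _ j) (norm_nonneg _)
  have hwd : ∀ n k, ‖w (θ n) k - w θ₀ k‖ ≤ 16 * η n := fun n k => by
    by_cases hk : k = k₀
    · simpa [w, hk] using hη0 n
    · simp only [w, hk, if_false, ← mul_sub, norm_mul]
      have h2 := (norm_inv_sub_inv_le (hzn n k hk) (hz0 k hk)).trans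
        (mul_le_mul_of_nonneg_left (hzd n k) (by norm_num))
      exact (mul_le_of_le_one_left (norm_nonneg _) hPn).trans h2
  have hvd : ∀ j n k, ‖v j (θ n) k - v j θ₀ k‖ ≤ 8 * η n := fun j n k => by
    by_cases hk : k = k₀
    · simpa [v, hk] using hη0 n
    · simp only [v, hk, if_false]
      refine (norm_div_sub_div_le (hzn n k hk) (hz0 k hk) (le_norm_crSymbol hσ _ j)).trans ?_
      linarith [hcoord n k j, hzd n k]
  -- the modified Cauchy-Riemann derivatives
  let t : ℕ → ℂ := fun n => P * (z (θ n) k₀ - z θ₀ k₀) * c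
  have ht : Tendsto t atTop (𝓝 0) := by
    have h1 : Tendsto (fun n => z (θ n) k₀ - z θ₀ k₀) atTop (𝓝 0) :=
      squeeze_zero_norm (fun n => hzd n k₀) hη
    simpa using (h1.const_mul P).mul_const c
  -- The correction vanishes off S and gives `x n` exactly the k₀-coefficient of the Cauchy–Riemann
  -- derivative of c times the wave θ n + k₀. Its effect on the other coefficients is harmless, as
  -- the symbol is inverted there.
  let x : ℕ → L2Q := fun n => d + t n • q
  have hx : Tendsto x atTop (𝓝 d) := by
    simpa using (ht.smul_const q).const_add d
  have hxk₀ : ∀ n, ⟪modeL (θ₀ + latticeVec k₀), x n⟫_ℂ = P * z (θ n) k₀ * c := fun n => by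
    simp only [x, d, inner_add_right, inner_smul_right, hq1, H k₀, t, z, P, crSymbol]
    rw [← hc]; ring
  have hdk : ∀ k, ⟪modeL (θ₀ + latticeVec k), d⟫_ℂ =
      P * z θ₀ k * ⟪modeL (θ₀ + latticeVec k), g⟫_ℂ := fun k => by
    simp only [d, inner_add_right, inner_smul_right, H k, z, P, crSymbol]; ring
  choose F hF using fun n => exists_multiplier (θ n) (hw n) (twist (θ n - θ₀) (x n))
  choose K hK using fun n j => exists_multiplier (θ n) (hv j n) (twist (θ n - θ₀) (x n))
  simp only [inner_modeL_twist] at hF hK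
  have hmode : Tendsto (fun n => modeL (θ n + latticeVec k₀)) atTop (𝓝 (modeL (θ₀ + latticeVec k₀))) :=
    tendsto_modeL (hθ.add_const _)
  have hk₀lim : ∀ j, Tendsto (fun n => P * ((θ n + latticeVec k₀) j : ℂ) * c) atTop
      (𝓝 (P * ((θ₀ + latticeVec k₀) j : ℂ) * c)) := fun j => by
    have h4 : Tendsto (fun n => (((θ n + latticeVec k₀) j : ℝ) : ℂ)) atTop
        (𝓝 (((θ₀ + latticeVec k₀) j : ℝ) : ℂ)) :=
      (Complex.continuous_ofReal.tendsto _).comp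
        (((continuous_coord j).tendsto _).comp (hθ.add_const _))
    exact (h4.const_mul P).mul_const c
  -- Away from k₀ the new function is the inverse symbol applied to the twisted `x n`; at k₀ it
  -- keeps the coefficient c of g, moved to the new frequency.
  refine ⟨fun n => F n + c • modeL (θ n + latticeVec k₀),
    fun n j => K n j + (P * ((θ n + latticeVec k₀) j : ℂ) * c) • modeL (θ n + latticeVec k₀),
    ?_, ?_, ?_, ?_⟩
  · intro n k j
    rw [inner_add_right, inner_add_right, inner_smul_right, inner_smul_right, inner_modeL_modeL,
      hF, hK]
    by_cases hk : k = k₀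
    · subst hk; simp [w, v, P]
    · have : z (θ n) k ≠ 0 := norm_pos_iff.1 (by linarith [hzn n k hk])
      simp only [w, v, hk, if_false, mul_zero, add_zero]
      change _ = P * _ * _
      field_simp
  · obtain ⟨B, hB⟩ : ∃ F₀ : L2Q, F₀ = g - c • modeL (θ₀ + latticeVec k₀) := ⟨_, rfl⟩
    have h1 : Tendsto F atTop (𝓝 B) := by
      refine tendsto_multiplier hθ (w := fun n => w (θ n)) (w₀ := w θ₀) hw
        (by simpa using hη.const_mul 16) hwd hx hF fun k => ?_
      rw [hB, inner_sub_right, inner_smul_right, inner_modeL_modeL, hdk]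
      by_cases hk : k = k₀
      · subst hk; simp [w, hc]
      · have : z θ₀ k ≠ 0 := norm_pos_iff.1 (by linarith [hz0 k hk])
        simp only [w, hk, if_false, mul_zero, sub_zero]
        field_simp
    have h2 := h1.add (hmode.const_smul c)
    rwa [hB, sub_add_cancel] at h2
  · intro j
    obtain ⟨B, hB⟩ : ∃ F₀ : L2Q, F₀ = h j - (P * ((θ₀ + latticeVec k₀) j : ℂ) * c) •
      modeL (θ₀ + latticeVec k₀) := ⟨_, rfl⟩
    have h1 : Tendsto (fun n => K n j) atTop (𝓝 B) := by
      refine tendsto_multiplier hθ (w := fun n => v j (θ n)) (w₀ := v j θ₀) (hv j)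
        (by simpa using hη.const_mul 8) (hvd j) hx (fun n k => hK n j k) fun k => ?_
      rw [hB, inner_sub_right, inner_smul_right, inner_modeL_modeL, hdk, H k j]
      by_cases hk : k = k₀
      · subst hk; simp [v, hc, P]
      · have : z θ₀ k ≠ 0 := norm_pos_iff.1 (by linarith [hz0 k hk])
        simp only [v, hk, if_false, mul_zero, sub_zero]
        change P * _ * _ = _
        field_simp
    have h2 := h1.add ((hk₀lim j).smul hmode)
    rwa [hB, sub_add_cancel] at h2
  · intro n
    -- The Cauchy–Riemann derivative of the new function is the twisted `x n`, and multiplication by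
    -- a plane wave preserves vanishing off S.
    have h1 : (K n 0 + (P * ((θ n + latticeVec k₀) 0 : ℂ) * c) • modeL (θ n + latticeVec k₀) +
        ((σ : ℂ) * Complex.I) • (K n 1 + (P * ((θ n + latticeVec k₀) 1 : ℂ) * c) •
          modeL (θ n + latticeVec k₀)) : L2Q) = twist (θ n - θ₀) (x n) := by
      refine ext_inner_modeL (θ n) fun k => ?_
      simp only [inner_add_right, inner_smul_right, inner_modeL_modeL, hK, inner_modeL_twist]
      by_cases hk : k = k₀
      · subst hk
        rw [hxk₀]
        simp [v, z, crSymbol]; ring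
      · have : z (θ n) k ≠ 0 := norm_pos_iff.1 (by linarith [hzn n k hk])
        simp only [v, hk, if_false, mul_zero, add_zero]
        have e : ((θ n + latticeVec k) 0 : ℂ) / z (θ n) k +
            σ * Complex.I * (((θ n + latticeVec k) 1 : ℂ) / z (θ n) k) = 1 := by
          rw [mul_div_assoc', ← add_div, div_eq_one_iff_eq this]; rfl
        linear_combination ⟪modeL (θ₀ + latticeVec k), x n⟫_ℂ * e
    rw [h1]
    filter_upwards [coeFn_twist (θ n - θ₀) (x n), Lp.coeFn_add d (t n • q), Lp.coeFn_smul (t n) q,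
      hd, hqS] with y e1 e2 e3 e4 e5 hy
    rw [e1, e2, Pi.add_apply, e3, Pi.smul_apply, e4 hy, e5 hy]
    simp

/-! ### Localised modes and approximation of V(θ₀) by V(θ) -/

/-- A normalized multiple of a plane wave, supported in a given open set of the cell. -/
theorem exists_localized_mode {Q₀ : Set Plane} (hopen : IsOpen Q₀) (hne : Q₀.Nonempty)
    (hsub : Q₀ ⊆ cell) (ξ : Plane) :
    ∃ q : L2Q, ⟪modeL ξ, q⟫_ℂ = 1 ∧ ∀ᵐ y ∂μQ, y ∉ Q₀ → q y = 0 := by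
  have hμ : μQ Q₀ = volume Q₀ := by
    rw [μQ, Measure.restrict_apply hopen.measurableSet, Set.inter_eq_left.2 hsub]
  have hpos : 0 < (μQ Q₀).toReal :=
    ENNReal.toReal_pos (by rw [hμ]; exact (hopen.measure_pos volume hne).ne') (measure_ne_top _ _)
  set c : ℂ := (((μQ Q₀).toReal : ℝ) : ℂ)⁻¹
  have hc : c * ((μQ Q₀).toReal : ℝ) = 1 :=
    inv_mul_cancel₀ (by exact_mod_cast hpos.ne')
  have hf : MemLp (Q₀.indicator fun y => c * mode ξ y) 2 μQ :=
    ((memLp_mode ξ 2).const_mul c).indicator hopen.measurableSet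
  refine ⟨hf.toLp, ?_, ?_⟩
  · rw [inner_modeL_toLp]
    have h1 : ∀ y, Q₀.indicator (fun y => c * mode ξ y) y * mode (-ξ) y =
        Q₀.indicator (fun _ => c) y := fun y => by
      by_cases hy : y ∈ Q₀
      · simp only [Set.indicator_of_mem hy, mode_neg_left]
        linear_combination c * mode_mul_conj ξ y
      · simp [hy]
    simp_rw [h1]
    rw [integral_indicator_const _ hopen.measurableSet, Measure.real, Complex.real_smul, mul_comm, hc]
  · filter_upwards [hf.coeFn_toLp] with y hy hyQ
    rw [hy, Set.indicator_of_notMem hyQ]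

theorem ae_matrixPhase_of_ae_cell {Q₀ : Set Plane} {p : Plane → Prop} (h : ∀ᵐ y ∂μQ, p y) :
    ∀ᵐ y ∂(volume.restrict (matrixPhase Q₀)), p y :=
  ae_restrict_of_ae_restrict_of_subset Set.sdiff_subset h

theorem measurableSet_matrixPhase (Q₀ : Set Plane) : MeasurableSet (matrixPhase Q₀) :=
  measurableSet_cell.diff isClosed_closure.measurableSet

/-- As Q₀ is open, a point of the cell in neither phase lies in the boundary of Q₀, which is null.
-/
theorem mem_or_mem_matrixPhase {Q₀ : Set Plane} (hbd : volume (frontier Q₀) = 0)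
    (hopen : IsOpen Q₀) : ∀ᵐ y ∂μQ, y ∉ Q₀ → y ∈ matrixPhase Q₀ := by
  have h1 : ∀ᵐ y ∂(volume : Measure Plane), y ∉ frontier Q₀ := measure_eq_zero_iff_ae_notMem.1 hbd
  filter_upwards [ae_restrict_mem measurableSet_cell, ae_restrict_of_ae h1] with y hy h2 h3
  refine ⟨hy, fun h4 => h2 ?_⟩
  rw [hopen.frontier_eq]
  exact ⟨h4, h3⟩

theorem mem_V_iff {Q₀ : Set Plane} {θ : Plane} (u : H1Theta θ) :
    u ∈ V Q₀ θ ↔ ∀ᵐ y ∂μQ, y ∈ matrixPhase Q₀ → u.div y = 0 ∧ u.divPerp y = 0 := by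
  constructor
  · intro h
    have h1 := (ae_restrict_iff' (measurableSet_matrixPhase Q₀)).1 h
    exact ae_restrict_of_ae h1
  · intro h
    filter_upwards [ae_matrixPhase_of_ae_cell h, ae_restrict_mem (measurableSet_matrixPhase Q₀)]
      with y h1 h2 using h1 h2

theorem coeFn_add_smul {μ : Measure Plane} (f g : Lp ℂ 2 μ) (c : ℂ) :
    (f + c • g : Lp ℂ 2 μ) =ᵐ[μ] fun y => f y + c * g y := by
  filter_upwards [Lp.coeFn_add f (c • g), Lp.coeFn_smul c g] with y h1 h2
  rw [h1, Pi.add_apply, h2]; rfl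

theorem coeFn_smul_add_smul {μ : Measure Plane} (f g : Lp ℂ 2 μ) (b c : ℂ) :
    (b • f + c • g : Lp ℂ 2 μ) =ᵐ[μ] fun y => b * f y + c * g y := by
  filter_upwards [coeFn_add_smul (b • f) g c, Lp.coeFn_smul b f] with y h1 h2
  rw [h1, h2]; rfl

/-- Elements of `V(θ₀)` are limits of elements of `V(θ n)` when `θ n → θ₀`. -/
theorem exists_approx_V {Q₀ : Set Plane} (hopen : IsOpen Q₀) (hne : Q₀.Nonempty)
    (hsub : Q₀ ⊆ cell) (hbd : volume (frontier Q₀) = 0) {θ : ℕ → Plane} {θ₀ : Plane}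
    (hθ : Tendsto θ atTop (𝓝 θ₀)) (hclose : ∀ n j, |(θ n - θ₀) j| ≤ 1 / 4)
    {φ : H1Theta θ₀} (hφ : φ ∈ V Q₀ θ₀) :
    ∃ ψ : ∀ n, H1Theta (θ n), (∀ n, ψ n ∈ V Q₀ (θ n)) ∧
      ∀ p, Tendsto (fun n => (ψ n).jet p) atTop (𝓝 (φ.jet p)) := by
  have hq := exists_localized_mode hopen hne hsub
  have hI : Complex.I * Complex.I = -1 := Complex.I_mul_I
  -- the two Cauchy-Riemann combinations
  have key : ∀ σ : ℝ, σ ^ 2 = 1 →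
      ∃ (G : ℕ → L2Q) (K : ℕ → Fin 2 → L2Q), (∀ n, QuasiJet (θ n) (G n) (K n)) ∧
      Tendsto G atTop (𝓝 (φ.jet (.inl 0) + (-(σ : ℂ) * Complex.I) • φ.jet (.inl 1))) ∧
      (∀ j, Tendsto (fun n => K n j) atTop
        (𝓝 (φ.jet (.inr (0, j)) + (-(σ : ℂ) * Complex.I) • φ.jet (.inr (1, j))))) ∧
      ∀ n, ∀ᵐ y ∂μQ, y ∉ Q₀ → (K n 0 + ((σ : ℂ) * Complex.I) • K n 1 : L2Q) y = 0 := by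
    intro σ hσ
    have hσ' : (σ : ℂ) ^ 2 = 1 := by exact_mod_cast hσ
    -- Since σ² = 1, (∂₁ + σi∂₂)(φ₁ − σiφ₂) = div φ + σi div φ^⊥, which vanishes in the matrix
    -- phase.
    refine exists_approx_crDeriv hσ hθ hclose hq
      ((quasiJet_jet φ 0).add ((quasiJet_jet φ 1).smul (-(σ : ℂ) * Complex.I))) ?_
    filter_upwards [mem_or_mem_matrixPhase hbd hopen, (mem_V_iff φ).1 hφ,
      φ.coeFn_jet (.inr (0, 0)), φ.coeFn_jet (.inr (0, 1)), φ.coeFn_jet (.inr (1, 0)),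
      φ.coeFn_jet (.inr (1, 1)),
      coeFn_add_smul (φ.jet (.inr (0, 0)) + (-(σ : ℂ) * Complex.I) • φ.jet (.inr (1, 0)))
        (φ.jet (.inr (0, 1)) + (-(σ : ℂ) * Complex.I) • φ.jet (.inr (1, 1))) ((σ : ℂ) * Complex.I),
      coeFn_add_smul (φ.jet (.inr (0, 0))) (φ.jet (.inr (1, 0))) (-(σ : ℂ) * Complex.I),
      coeFn_add_smul (φ.jet (.inr (0, 1))) (φ.jet (.inr (1, 1))) (-(σ : ℂ) * Complex.I)]
      with y h1 h2 e1 e2 e3 e4 a1 a2 a3 hy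
    obtain ⟨hdiv, hperp⟩ := h2 (h1 hy)
    rw [a1, a2, a3, e1, e2, e3, e4]
    simp only [H1Closure.div, H1Closure.divPerp] at hdiv hperp
    simp only [H1Closure.jetFun, Sum.elim_inr]
    linear_combination hdiv + σ * Complex.I * hperp + φ.grad 1 1 y * hσ' -
      φ.grad 1 1 y * σ ^ 2 * hI
  obtain ⟨G, K, hGK, hG, hK, hd⟩ := key 1 (by norm_num)
  obtain ⟨G', K', hGK', hG', hK', hd'⟩ := key (-1) (by norm_num)
  -- Inverts g = φ₁ − iφ₂, g' = φ₁ + iφ₂: φ₁ is their mean and φ₂ = (i/2)(g − g').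
  let U : ℕ → JetSpace μQ := fun n => WithLp.toLp 2 (Sum.elim
    (fun i => ![(1 / 2 : ℂ) • G n + (1 / 2 : ℂ) • G' n,
      (Complex.I / 2) • G n + (-Complex.I / 2) • G' n] i)
    (fun ij => ![(1 / 2 : ℂ) • K n ij.2 + (1 / 2 : ℂ) • K' n ij.2,
      (Complex.I / 2) • K n ij.2 + (-Complex.I / 2) • K' n ij.2] ij.1))
  have hU : ∀ n i, QuasiJet (θ n) (U n (.inl i)) fun j => U n (.inr (i, j)) := by
    intro n i
    fin_cases i
    · exact ((hGK n).smul _).add ((hGK' n).smul _)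
    · exact ((hGK n).smul _).add ((hGK' n).smul _)
  choose ψ hψ hψf using fun n => exists_h1Theta_of_quasiJet (hU n)
  refine ⟨ψ, fun n => ?_, fun p => ?_⟩
  · rw [mem_V_iff]
    filter_upwards [hd n, hd' n, coeFn_add_smul (K n 0) (K n 1) (((1 : ℝ) : ℂ) * Complex.I),
      coeFn_add_smul (K' n 0) (K' n 1) (((-1 : ℝ) : ℂ) * Complex.I),
      coeFn_smul_add_smul (K n 0) (K' n 0) (1 / 2) (1 / 2),
      coeFn_smul_add_smul (K n 1) (K' n 1) (1 / 2) (1 / 2),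
      coeFn_smul_add_smul (K n 0) (K' n 0) (Complex.I / 2) (-Complex.I / 2),
      coeFn_smul_add_smul (K n 1) (K' n 1) (Complex.I / 2) (-Complex.I / 2)]
      with y h1 h2 a1 a2 b00 b01 b10 b11 hy
    have hyQ : y ∉ Q₀ := fun h => hy.2 (subset_closure h)
    have c1 := a1.symm.trans (h1 hyQ)
    have c2 := a2.symm.trans (h2 hyQ)
    push_cast at c1 c2
    have g00 : (ψ n).grad 0 0 y = _ := (congrFun (hψf n (.inr (0, 0))) y).trans b00
    have g01 : (ψ n).grad 0 1 y = _ := (congrFun (hψf n (.inr (0, 1))) y).trans b01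
    have g10 : (ψ n).grad 1 0 y = _ := (congrFun (hψf n (.inr (1, 0))) y).trans b10
    have g11 : (ψ n).grad 1 1 y = _ := (congrFun (hψf n (.inr (1, 1))) y).trans b11
    simp only [H1Closure.div, H1Closure.divPerp, g00, g01, g10, g11]
    constructor
    · linear_combination (1 / 2) * c1 + (1 / 2) * c2
    · linear_combination (-Complex.I / 2) * c1 + (Complex.I / 2) * c2 +
        (K n 1 y + K' n 1 y) / 2 * hI
  · have e0 : ∀ a b : L2Q, (1 / 2 : ℂ) • (a + (-((1 : ℝ) : ℂ) * Complex.I) • b) +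
        (1 / 2 : ℂ) • (a + (-((-1 : ℝ) : ℂ) * Complex.I) • b) = a := fun a b => by
      push_cast; module
    have e1 : ∀ a b : L2Q, (Complex.I / 2) • (a + (-((1 : ℝ) : ℂ) * Complex.I) • b) +
        (-Complex.I / 2) • (a + (-((-1 : ℝ) : ℂ) * Complex.I) • b) = b := fun a b => by
      have : (-(Complex.I * Complex.I)) • b = b := by rw [hI, neg_neg, one_smul]
      nth_rewrite 3 [← this]
      push_cast; module
    simp only [hψ]
    match p with
    | .inl i =>
      fin_cases i
      · have := (hG.const_smul (1 / 2 : ℂ)).add (hG'.const_smul (1 / 2 : ℂ))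
        rw [e0] at this; exact this
      · have := (hG.const_smul (Complex.I / 2)).add (hG'.const_smul (-Complex.I / 2))
        rw [e1] at this; exact this
    | .inr (i, j) =>
      fin_cases i
      · have := ((hK j).const_smul (1 / 2 : ℂ)).add ((hK' j).const_smul (1 / 2 : ℂ))
        rw [e0] at this; exact this
      · have := ((hK j).const_smul (Complex.I / 2)).add ((hK' j).const_smul (-Complex.I / 2))
        rw [e1] at this; exact this

end HighContrast
end

noncomputable section

namespace HighContrast

open scoped ComplexConjugate ENNReal InnerProductSpace

/-! ### Coefficients in jet notation -/

theorem measurable_perChar {P : Set Plane} (hP : MeasurableSet P) : Measurable (perChar P) := by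
  refine measurable_const.indicator ?_
  have : {y : Plane | ∃ n : Fin 2 → ℤ, y + latticeVec n ∈ P} =
      ⋃ n : Fin 2 → ℤ, (fun y => y + latticeVec n) ⁻¹' P := by ext y; simp
  rw [this]
  exact MeasurableSet.iUnion fun n => hP.preimage (measurable_id.add_const _)

theorem perChar_nonneg (P : Set Plane) (y : Plane) : 0 ≤ perChar P y :=
  Set.indicator_nonneg (fun _ _ => zero_le_one) y

theorem perChar_le_one (P : Set Plane) (y : Plane) : perChar P y ≤ 1 :=
  Set.indicator_le_self' (f := fun _ => (1 : ℝ)) (fun _ _ => zero_le_one) y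

theorem perChar_add_latticeVec (P : Set Plane) (y : Plane) (n : Fin 2 → ℤ) :
    perChar P (y + latticeVec n) = perChar P y := by
  have h : (∃ m : Fin 2 → ℤ, y + latticeVec n + latticeVec m ∈ P) ↔
      ∃ m : Fin 2 → ℤ, y + latticeVec m ∈ P := by
    constructor
    · rintro ⟨m, hm⟩
      exact ⟨n + m, by rwa [latticeVec_add, ← add_assoc]⟩
    · rintro ⟨m, hm⟩
      exact ⟨m - n, by rwa [latticeVec_sub, add_assoc, add_sub_cancel]⟩
  classical
  simp only [perChar, Set.indicator, Set.mem_ofPred_eq]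
  exact if_congr h rfl rfl

theorem perChar_of_mem_cell {P : Set Plane} (hP : P ⊆ cell) {y : Plane} (hy : y ∈ cell) :
    perChar P y = P.indicator (fun _ => 1) y := by
  have h : (∃ m : Fin 2 → ℤ, y + latticeVec m ∈ P) ↔ y ∈ P := by
    constructor
    · rintro ⟨m, hm⟩
      have := eq_zero_of_mem_cell hy (hP hm)
      subst this
      rwa [latticeVec_zero, add_zero] at hm
    · exact fun h => ⟨0, by rwa [latticeVec_zero, add_zero]⟩
  classical
  simp only [perChar, Set.indicator, Set.mem_ofPred_eq, h]

/-- The position of `∂_j u_i` in the column `(u₁,₁, u₂,₁, u₁,₂, u₂,₂)`. -/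
def gradIdx (ij : Fin 2 × Fin 2) : Fin 4 := ![![0, 2], ![1, 3]] ij.1 ij.2

/-- The matrix acting on jets by `A` on the gradient and by `R` on the values. -/
def block (A : Matrix (Fin 4) (Fin 4) ℝ) (R : Matrix (Fin 2) (Fin 2) ℝ) : JetIdx → JetIdx → ℝ
  | .inl i, .inl j => R i j
  | .inr a, .inr b => A (gradIdx a) (gradIdx b)
  | _, _ => 0

/-- The coefficient equal to `B₁` in the matrix phase and to `B₀` in the inclusions. -/
def phaseCoeff (Q₀ : Set Plane) (B₁ B₀ : JetIdx → JetIdx → ℝ) (y : Plane) : JetIdx → JetIdx → ℝ :=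
  fun p q => perChar (matrixPhase Q₀) y * B₁ p q + perChar Q₀ y * B₀ p q

theorem bddCoeff_phaseCoeff {Q₀ : Set Plane} (hQ₀ : MeasurableSet Q₀) (B₁ B₀ : JetIdx → JetIdx → ℝ) :
    BddCoeff (phaseCoeff Q₀ B₁ B₀) := by
  refine ⟨fun p q => ((measurable_perChar (measurableSet_matrixPhase Q₀)).mul_const _).add
    ((measurable_perChar hQ₀).mul_const _), ∑ p, ∑ q, (|B₁ p q| + |B₀ p q|), fun y p q => ?_⟩
  have h1 : |phaseCoeff Q₀ B₁ B₀ y p q| ≤ |B₁ p q| + |B₀ p q| := by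
    refine (abs_add_le _ _).trans (add_le_add ?_ ?_) <;> rw [abs_mul] <;>
      refine mul_le_of_le_one_left (abs_nonneg _) ?_ <;>
      rw [abs_of_nonneg (perChar_nonneg _ _)] <;> exact perChar_le_one _ _
  refine h1.trans ?_
  refine le_trans ?_ (Finset.single_le_sum (f := fun p => ∑ q, (|B₁ p q| + |B₀ p q|))
    (fun p _ => Finset.sum_nonneg fun q _ => by positivity) (Finset.mem_univ p))
  exact Finset.single_le_sum (f := fun q => |B₁ p q| + |B₀ p q|) (fun q _ => by positivity)
    (Finset.mem_univ q)

theorem sesq_add (m m' : JetIdx → JetIdx → ℝ) (J J' : JetIdx → ℂ) :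
    sesq (fun p q => m p q + m' p q) J J' = sesq m J J' + sesq m' J J' := by
  simp only [sesq, ← Finset.sum_add_distrib]
  refine Finset.sum_congr rfl fun p _ => Finset.sum_congr rfl fun q _ => ?_
  push_cast; ring

theorem sesq_mul (c : ℝ) (m : JetIdx → JetIdx → ℝ) (J J' : JetIdx → ℂ) :
    sesq (fun p q => c * m p q) J J' = c * sesq m J J' := by
  simp only [sesq, Finset.mul_sum]
  refine Finset.sum_congr rfl fun p _ => Finset.sum_congr rfl fun q _ => ?_
  push_cast; ring

theorem sesq_phaseCoeff (Q₀ : Set Plane) (B₁ B₀ : JetIdx → JetIdx → ℝ) (y : Plane)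
    (J J' : JetIdx → ℂ) : sesq (phaseCoeff Q₀ B₁ B₀ y) J J' =
      perChar (matrixPhase Q₀) y * sesq B₁ J J' + perChar Q₀ y * sesq B₀ J J' := by
  rw [← sesq_mul, ← sesq_mul, ← sesq_add]; rfl

/-- The gradient column of a jet. -/
def gradCol (J : JetIdx → ℂ) : Fin 4 → ℂ :=
  ![J (.inr (0, 0)), J (.inr (1, 0)), J (.inr (0, 1)), J (.inr (1, 1))]

theorem sesq_block (A : Matrix (Fin 4) (Fin 4) ℝ) (R : Matrix (Fin 2) (Fin 2) ℝ)
    (J J' : JetIdx → ℂ) : sesq (block A R) J J' =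
      contract A (gradCol J) (gradCol J') + contract R (fun i => J (.inl i)) (fun i => J' (.inl i)) := by
  simp only [sesq, contract, block, gradIdx, gradCol, dotProduct, Matrix.mulVec, Matrix.map_apply,
    Fintype.sum_sum_type, Fintype.sum_prod_type, Fin.sum_univ_two, Fin.sum_univ_four, Pi.star_apply,
    RCLike.star_def, Matrix.cons_val_zero, Matrix.cons_val_one, Matrix.cons_val, Matrix.cons_val_fin_one]
  simp
  ring

theorem contract_add {m : ℕ} (A B : Matrix (Fin m) (Fin m) ℝ) (ξ η : Fin m → ℂ) :
    contract (A + B) ξ η = contract A ξ η + contract B ξ η := by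
  rw [contract, Matrix.map_add _ (fun a b => Complex.ofReal_add a b), Matrix.add_mulVec,
    add_dotProduct]; rfl

theorem contract_smul {m : ℕ} (c : ℝ) (A : Matrix (Fin m) (Fin m) ℝ) (ξ η : Fin m → ℂ) :
    contract (c • A) ξ η = c * contract A ξ η := by
  have : (c • A).map (fun t : ℝ => (t : ℂ)) = (c : ℂ) • A.map (fun t : ℝ => (t : ℂ)) := by
    ext i j; simp
  rw [contract, this, Matrix.smul_mulVec, smul_dotProduct, smul_eq_mul]; rfl

/-- The tensor `a⁽⁰⁾` in the matrix phase. -/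
def limitMatrix : Matrix (Fin 4) (Fin 4) ℝ :=
  !![0, 0, 0, -1; 0, 0, 1, 0; 0, 1, 0, 0; -1, 0, 0, 0]

/-- The weight in the inclusions. -/
def inclWeight (e₀ e₁ : ℝ) : Matrix (Fin 2) (Fin 2) ℝ := !![e₀ / e₁, 0; 0, 1]

variable (e₀ e₁ : ℝ) (Q₀ : Set Plane)

/-- The coefficient of the rescaled cell problem. -/
def cellCoeff (ε l : ℝ) : Plane → JetIdx → JetIdx → ℝ :=
  phaseCoeff Q₀ (block ((1 / ε ^ 2) • tensorA1 e₁ ε) ((-l) • !![1, 0; 0, 1]))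
    (block ((1 / (e₀ - e₁ + ε ^ 2)) • tensorA0 e₀ e₁ ε) ((-l) • inclWeight e₀ e₁))

/-- The coefficient of the high-contrast problem in the plane. -/
def planeCoeff (ε l : ℝ) : Plane → JetIdx → JetIdx → ℝ :=
  phaseCoeff Q₀ (block (tensorA1 e₁ ε) ((-l) • !![1, 0; 0, 1]))
    (block ((ε ^ 2 / (e₀ - e₁ + ε ^ 2)) • tensorA0 e₀ e₁ ε) ((-l) • inclWeight e₀ e₁))

/-- The coefficient of the limit problem. -/
def limitCoeff (l : ℝ) : Plane → JetIdx → JetIdx → ℝ :=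
  phaseCoeff Q₀ (block ((1 / (2 * e₁)) • limitMatrix) ((-l) • !![1, 0; 0, 1]))
    (block ((1 / (e₀ - e₁)) • tensorA0 e₀ e₁ 0) ((-l) • inclWeight e₀ e₁))

variable {e₀ e₁ Q₀}

theorem sesq_phase_tensors (M₁ M₀ : Matrix (Fin 4) (Fin 4) ℝ) (R₁ R₀ : Matrix (Fin 2) (Fin 2) ℝ)
    (y : Plane) (J J' : JetIdx → ℂ) :
    sesq (phaseCoeff Q₀ (block M₁ R₁) (block M₀ R₀) y) J J' =
      contract (perChar (matrixPhase Q₀) y • M₁ + perChar Q₀ y • M₀) (gradCol J) (gradCol J') +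
      contract (perChar (matrixPhase Q₀) y • R₁ + perChar Q₀ y • R₀)
        (fun i => J (.inl i)) (fun i => J' (.inl i)) := by
  rw [sesq_phaseCoeff, sesq_block, sesq_block]
  simp only [contract_add, contract_smul]
  ring

theorem contract_zero {m : ℕ} (ξ η : Fin m → ℂ) : contract 0 ξ η = 0 := by
  have := contract_smul 0 (0 : Matrix (Fin m) (Fin m) ℝ) ξ η
  simpa using this

theorem BddCoeff.comp {m : Plane → JetIdx → JetIdx → ℝ} (hm : BddCoeff m) {g : Plane → Plane}
    (hg : Measurable g) : BddCoeff fun y => m (g y) :=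
  ⟨fun p q => (hm.1 p q).comp hg, hm.2.imp fun _ h y => h (g y)⟩

/-- The map `g` is the identity for the cell problems and x ↦ x/ε for the problem in the plane. The
term with the spectral parameter sits in the value block, so each problem is governed by a single
sesquilinear form. -/
theorem integral_sesq_phase_comp {μ : Measure Plane} (hQ₀ : MeasurableSet Q₀) {g : Plane → Plane}
    (hg : Measurable g)
    (M₁ M₀ : Matrix (Fin 4) (Fin 4) ℝ) (l : ℝ)
    {J J' : JetIdx → Plane → ℂ} (hJ : ∀ p, MemLp (J p) 2 μ) (hJ' : ∀ p, MemLp (J' p) 2 μ) :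
    ∫ y, sesq (phaseCoeff Q₀ (block M₁ ((-l) • !![1, 0; 0, 1])) (block M₀ ((-l) • inclWeight e₀ e₁)) (g y))
        (fun p => J p y) (fun p => J' p y) ∂μ =
      ∫ y, contract (perChar (matrixPhase Q₀) (g y) • M₁ + perChar Q₀ (g y) • M₀)
        (gradCol fun p => J p y) (gradCol fun p => J' p y) ∂μ -
      l * ∫ y, contract (weight e₀ e₁ Q₀ (g y)) (fun i => J (.inl i) y) (fun i => J' (.inl i) y) ∂μ := by
  have h1 : Integrable (fun y => contract (perChar (matrixPhase Q₀) (g y) • M₁ + perChar Q₀ (g y) • M₀)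
      (gradCol fun p => J p y) (gradCol fun p => J' p y)) μ := by
    have := integrable_sesq ((bddCoeff_phaseCoeff hQ₀ (block M₁ 0) (block M₀ 0)).comp hg) hJ hJ'
    simpa only [sesq_phase_tensors, smul_zero, add_zero, contract_zero] using this
  have h2 : Integrable (fun y => contract (weight e₀ e₁ Q₀ (g y))
      (fun i => J (.inl i) y) (fun i => J' (.inl i) y)) μ := by
    have := integrable_sesq ((bddCoeff_phaseCoeff hQ₀ (block 0 !![1, 0; 0, 1])
      (block 0 (inclWeight e₀ e₁))).comp hg) hJ hJ'
    simp only [sesq_phase_tensors, smul_zero, add_zero, zero_add, contract_zero] at this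
    exact this
  rw [← integral_const_mul, ← integral_sub h1 (h2.const_mul _)]
  refine integral_congr_ae (.of_forall fun y => ?_)
  simp only [sesq_phase_tensors, weight, inclWeight, contract_add, contract_smul]
  push_cast; ring

theorem integral_sesq_phase {μ : Measure Plane} (hQ₀ : MeasurableSet Q₀)
    (M₁ M₀ : Matrix (Fin 4) (Fin 4) ℝ) (l : ℝ)
    {J J' : JetIdx → Plane → ℂ} (hJ : ∀ p, MemLp (J p) 2 μ) (hJ' : ∀ p, MemLp (J' p) 2 μ) :
    ∫ y, sesq (phaseCoeff Q₀ (block M₁ ((-l) • !![1, 0; 0, 1])) (block M₀ ((-l) • inclWeight e₀ e₁)) y)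
        (fun p => J p y) (fun p => J' p y) ∂μ =
      ∫ y, contract (perChar (matrixPhase Q₀) y • M₁ + perChar Q₀ y • M₀)
        (gradCol fun p => J p y) (gradCol fun p => J' p y) ∂μ -
      l * ∫ y, contract (weight e₀ e₁ Q₀ y) (fun i => J (.inl i) y) (fun i => J' (.inl i) y) ∂μ :=
  integral_sesq_phase_comp hQ₀ measurable_id M₁ M₀ l hJ hJ'

theorem H1Closure.gradVec_eq {S : Set (Plane → ℂ)} {Ω : Set Plane} (u : H1Closure S Ω) (y : Plane) :
    u.gradVec y = gradCol fun p => u.jetFun p y := rfl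

theorem integral_cellCoeff (hQ₀ : MeasurableSet Q₀) (ε l : ℝ) {θ : Plane} (u φ : H1Theta θ) :
    ∫ y in cell, sesq (cellCoeff e₀ e₁ Q₀ ε l y) (fun p => u.jetFun p y) (fun p => φ.jetFun p y) =
      (∫ y in cell, contract (cellTensor e₀ e₁ Q₀ ε y) (u.gradVec y) (φ.gradVec y)) -
        l * ∫ y in cell, contract (weight e₀ e₁ Q₀ y) (u.val y) (φ.val y) := by
  rw [cellCoeff, integral_sesq_phase hQ₀ _ _ _ u.memLp_jetFun φ.memLp_jetFun]
  refine congrArg₂ (fun a b : ℂ => a - b) (integral_congr_ae (.of_forall fun y => ?_)) rfl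
  simp only [cellTensor, contract_add, contract_smul, H1Closure.gradVec_eq]
  push_cast; ring

theorem integral_limitCoeff (hQ₀ : MeasurableSet Q₀) (l : ℝ) {θ : Plane} (u φ : H1Theta θ) :
    ∫ y in cell, sesq (limitCoeff e₀ e₁ Q₀ l y) (fun p => u.jetFun p y) (fun p => φ.jetFun p y) =
      (∫ y in cell, contract (limitTensor e₀ e₁ Q₀ y) (u.gradVec y) (φ.gradVec y)) -
        l * ∫ y in cell, contract (weight e₀ e₁ Q₀ y) (u.val y) (φ.val y) := by
  rw [limitCoeff, integral_sesq_phase hQ₀ _ _ _ u.memLp_jetFun φ.memLp_jetFun]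
  refine congrArg₂ (fun a b : ℂ => a - b) (integral_congr_ae (.of_forall fun y => ?_)) rfl
  have : tensorA0 e₀ e₁ 0 = !![e₀ / e₁, 0, 0, 1; 0, 1, -1, 0; 0, -1, e₀ / e₁, 0; 1, 0, 0, 1] := by
    simp [tensorA0]
  simp only [limitTensor, limitMatrix, this, contract_add, contract_smul, H1Closure.gradVec_eq]
  push_cast; ring

end HighContrast
end

noncomputable section

namespace HighContrast

open scoped ComplexConjugate ENNReal InnerProductSpace

/-! ### Coercivity of the rescaled cell problem -/

/-- The divergence in terms of jets. -/
def jdiv (J : JetIdx → ℂ) : ℂ := J (.inr (0, 0)) + J (.inr (1, 1))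

/-- The divergence of the rotated field in terms of jets. -/
def jperp (J : JetIdx → ℂ) : ℂ := -J (.inr (1, 0)) + J (.inr (0, 1))

/-- The pairing of gradients. -/
def gradPair (J J' : JetIdx → ℂ) : ℂ := ∑ ij, J (.inr ij) * conj (J' (.inr ij))

/-- The factor `s_ε`. -/
def sEps (e₁ ε : ℝ) : ℝ := √(1 - ε ^ 2 / e₁)

/-- The entries ±s are the cross terms of |div|² and |div^⊥|², whose diagonal terms add up to the
squared gradient. After division by ε² the first summand stays bounded and the second becomes the
penalty. -/
theorem contract_tensorA1 (e₁ ε : ℝ) (J J' : JetIdx → ℂ) :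
    contract (tensorA1 e₁ ε) (gradCol J) (gradCol J') = (1 - sEps e₁ ε : ℝ) * gradPair J J' +
      sEps e₁ ε * (jdiv J * conj (jdiv J') + jperp J * conj (jperp J')) := by
  simp only [contract, tensorA1, gradCol, gradPair, jdiv, jperp, sEps, dotProduct, Matrix.mulVec,
    Matrix.map_apply, Fintype.sum_prod_type, Fin.sum_univ_two, Fin.sum_univ_four, Pi.star_apply,
    RCLike.star_def, map_add, map_neg]
  simp
  ring

theorem contract_tensorA0 (e₀ e₁ ε : ℝ) (J J' : JetIdx → ℂ) :
    contract (tensorA0 e₀ e₁ ε) (gradCol J) (gradCol J') =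
      contract (tensorA1 e₁ ε) (gradCol J) (gradCol J') + (e₀ / e₁ - 1 : ℝ) *
        (J (.inr (0, 0)) * conj (J' (.inr (0, 0))) + J (.inr (0, 1)) * conj (J' (.inr (0, 1)))) := by
  simp only [contract, tensorA0, tensorA1, gradCol, dotProduct, Matrix.mulVec,
    Matrix.map_apply, Fin.sum_univ_four, Pi.star_apply, RCLike.star_def]
  simp
  ring

/-- `limitMatrix` is symmetric and fixes every column with vanishing div and div^⊥, so it disappears
once moved onto the test column. Only the test field needs the constraint. -/
theorem contract_limitMatrix {J J' : JetIdx → ℂ} (h1 : jdiv J' = 0) (h2 : jperp J' = 0) :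
    contract limitMatrix (gradCol J) (gradCol J') = gradPair J J' := by
  have e1 : J' (.inr (1, 1)) = -J' (.inr (0, 0)) := by
    simp only [jdiv] at h1; linear_combination h1
  have e2 : J' (.inr (0, 1)) = J' (.inr (1, 0)) := by
    simp only [jperp] at h2; linear_combination h2
  simp only [contract, limitMatrix, gradCol, gradPair, dotProduct, Matrix.mulVec,
    Matrix.map_apply, Fintype.sum_prod_type, Fin.sum_univ_two, Fin.sum_univ_four, Pi.star_apply,
    RCLike.star_def, e1, e2, map_neg]
  simp
  ring

theorem gradPair_self (J : JetIdx → ℂ) : gradPair J J = ((∑ ij, ‖J (.inr ij)‖ ^ 2 : ℝ) : ℂ) := by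
  simp only [gradPair, Complex.mul_conj']
  push_cast; rfl

theorem sEps_nonneg (e₁ ε : ℝ) : 0 ≤ sEps e₁ ε := Real.sqrt_nonneg _

/-- This is √(1 − t) ≤ 1 − t/2 with t = ε²/e₁; it gives the lower bound 1/(2e₁) for (1 − s_ε)/ε². -/
theorem sEps_le {e₁ ε : ℝ} (he₁ : 0 < e₁) (hε : ε ^ 2 ≤ e₁ / 2) :
    sEps e₁ ε ≤ 1 - ε ^ 2 / (2 * e₁) := by
  have h1 : ε ^ 2 / e₁ ≤ 1 / 2 := by rw [div_le_iff₀ he₁]; linarith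
  have h2 : ε ^ 2 / (2 * e₁) = (ε ^ 2 / e₁) / 2 := by field_simp
  rw [sEps, h2]
  refine Real.sqrt_le_iff.2 ⟨by linarith, ?_⟩
  nlinarith [sq_nonneg (ε ^ 2 / e₁)]

theorem half_le_sEps {e₁ ε : ℝ} (he₁ : 0 < e₁) (hε : ε ^ 2 ≤ e₁ / 2) : 1 / 2 ≤ sEps e₁ ε := by
  have h1 : ε ^ 2 / e₁ ≤ 1 / 2 := by rw [div_le_iff₀ he₁]; linarith
  rw [sEps]
  refine Real.le_sqrt_of_sq_le ?_
  linarith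

/-- The coercivity constant of the rescaled cell problem. -/
def coercConst (e₀ e₁ : ℝ) : ℝ :=
  min (1 / (2 * e₁)) (1 / ((e₀ - e₁ + 1) * (4 + 3 / (e₀ / e₁ - 1))))

variable {e₀ e₁ : ℝ} {Q₀ : Set Plane}

theorem gamma_pos (he₁ : 0 < e₁) (he : e₁ < e₀) : 0 < e₀ / e₁ - 1 := by
  rw [sub_pos, lt_div_iff₀ he₁]; linarith

theorem coercConst_pos (he₁ : 0 < e₁) (he : e₁ < e₀) : 0 < coercConst e₀ e₁ := by
  have := gamma_pos he₁ he
  have : 0 < e₀ - e₁ + 1 := by linarith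
  exact lt_min (by positivity) (by positivity)

theorem re_contract_A1 (he₁ : 0 < e₁) {ε : ℝ} (hε0 : 0 < ε) (hε : ε ^ 2 ≤ e₁ / 2) (J : JetIdx → ℂ) :
    coercConst e₀ e₁ * ∑ ij, ‖J (.inr ij)‖ ^ 2 +
      1 / (2 * ε ^ 2) * (‖jdiv J‖ ^ 2 + ‖jperp J‖ ^ 2) ≤
    (contract ((1 / ε ^ 2) • tensorA1 e₁ ε) (gradCol J) (gradCol J)).re := by
  rw [contract_smul, contract_tensorA1, gradPair_self, Complex.mul_conj', Complex.mul_conj']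
  have hreal : ((1 / ε ^ 2 : ℝ) : ℂ) * ((1 - sEps e₁ ε : ℝ) * ((∑ ij, ‖J (.inr ij)‖ ^ 2 : ℝ) : ℂ) +
      sEps e₁ ε * ((‖jdiv J‖ : ℂ) ^ 2 + (‖jperp J‖ : ℂ) ^ 2)) =
      ((1 / ε ^ 2 * ((1 - sEps e₁ ε) * ∑ ij, ‖J (.inr ij)‖ ^ 2 +
        sEps e₁ ε * (‖jdiv J‖ ^ 2 + ‖jperp J‖ ^ 2)) : ℝ) : ℂ) := by push_cast; ring
  rw [hreal, Complex.ofReal_re, mul_add (1 / ε ^ 2)]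
  have hε2 : 0 < ε ^ 2 := by positivity
  refine add_le_add ?_ ?_
  · rw [← mul_assoc]
    refine mul_le_mul_of_nonneg_right ((min_le_left _ _).trans ?_)
      (Finset.sum_nonneg fun _ _ => by positivity)
    have h1 := sEps_le he₁ hε
    have h2 : 1 / (2 * e₁) = 1 / ε ^ 2 * (ε ^ 2 / (2 * e₁)) := by field_simp
    rw [h2]
    exact mul_le_mul_of_nonneg_left (by linarith) (by positivity)
  · rw [← mul_assoc]
    refine mul_le_mul_of_nonneg_right ?_ (by positivity)
    have h2 : 1 / (2 * ε ^ 2) = 1 / ε ^ 2 * (1 / 2) := by field_simp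
    rw [h2]
    exact mul_le_mul_of_nonneg_left (half_le_sEps he₁ hε) (by positivity)

theorem norm_add_sq_le (z w : ℂ) : ‖z + w‖ ^ 2 ≤ 2 * ‖z‖ ^ 2 + 2 * ‖w‖ ^ 2 := by
  have h1 := norm_add_le z w
  have h2 : ‖z + w‖ ^ 2 ≤ (‖z‖ + ‖w‖) ^ 2 := pow_le_pow_left₀ (norm_nonneg _) h1 2
  nlinarith [sq_nonneg (‖z‖ - ‖w‖)]

/-- The tensor controls γ|∇u₁|² and half of the squared divergences. The gradient of u₂ follows from
∂₂u₂ = div u − ∂₁u₁ and ∂₁u₂ = ∂₂u₁ − div u^⊥. No penalty is left over here. -/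
theorem re_contract_A0 (he₁ : 0 < e₁) (he : e₁ < e₀) {ε : ℝ} (hε0 : 0 < ε) (hε : ε ^ 2 ≤ e₁ / 2)
    (hε1 : ε ^ 2 ≤ 1) (J : JetIdx → ℂ) :
    coercConst e₀ e₁ * ∑ ij, ‖J (.inr ij)‖ ^ 2 ≤
    (contract ((1 / (e₀ - e₁ + ε ^ 2)) • tensorA0 e₀ e₁ ε) (gradCol J) (gradCol J)).re := by
  have hγ := gamma_pos he₁ he
  set γ := e₀ / e₁ - 1 with hγdef
  rw [contract_smul, contract_tensorA0, contract_tensorA1, gradPair_self]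
  simp only [Complex.mul_conj']
  have hreal : ((1 / (e₀ - e₁ + ε ^ 2) : ℝ) : ℂ) * ((1 - sEps e₁ ε : ℝ) *
      ((∑ ij, ‖J (.inr ij)‖ ^ 2 : ℝ) : ℂ) +
      sEps e₁ ε * ((‖jdiv J‖ : ℂ) ^ 2 + (‖jperp J‖ : ℂ) ^ 2) +
      (e₀ / e₁ - 1 : ℝ) * ((‖J (.inr (0, 0))‖ : ℂ) ^ 2 + (‖J (.inr (0, 1))‖ : ℂ) ^ 2)) =
      ((1 / (e₀ - e₁ + ε ^ 2) * ((1 - sEps e₁ ε) * ∑ ij, ‖J (.inr ij)‖ ^ 2 +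
        sEps e₁ ε * (‖jdiv J‖ ^ 2 + ‖jperp J‖ ^ 2) +
        γ * (‖J (.inr (0, 0))‖ ^ 2 + ‖J (.inr (0, 1))‖ ^ 2)) : ℝ) : ℂ) := by
    rw [hγdef]; push_cast; ring
  rw [hreal, Complex.ofReal_re]
  have hs1 := half_le_sEps he₁ hε
  have hs2 : sEps e₁ ε ≤ 1 := (sEps_le he₁ hε).trans (by
    have : 0 ≤ ε ^ 2 / (2 * e₁) := by positivity
    linarith)
  have hsum : ∑ ij, ‖J (.inr ij)‖ ^ 2 = ‖J (.inr (0, 0))‖ ^ 2 + ‖J (.inr (0, 1))‖ ^ 2 +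
      (‖J (.inr (1, 0))‖ ^ 2 + ‖J (.inr (1, 1))‖ ^ 2) := by
    simp [Fintype.sum_prod_type, Fin.sum_univ_two]
  have h11 : ‖J (.inr (1, 1))‖ ^ 2 ≤ 2 * ‖jdiv J‖ ^ 2 + 2 * ‖J (.inr (0, 0))‖ ^ 2 := by
    have := norm_add_sq_le (jdiv J) (-J (.inr (0, 0)))
    rwa [norm_neg, show jdiv J + -J (.inr (0, 0)) = J (.inr (1, 1)) by simp only [jdiv]; ring] at this
  have h10 : ‖J (.inr (1, 0))‖ ^ 2 ≤ 2 * ‖jperp J‖ ^ 2 + 2 * ‖J (.inr (0, 1))‖ ^ 2 := by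
    have := norm_add_sq_le (-jperp J) (J (.inr (0, 1)))
    rwa [norm_neg, show -jperp J + J (.inr (0, 1)) = J (.inr (1, 0)) by simp only [jperp]; ring] at this
  set X := ∑ ij, ‖J (.inr ij)‖ ^ 2
  have hX0 : 0 ≤ X := Finset.sum_nonneg fun _ _ => by positivity
  set D := ‖jdiv J‖ ^ 2 + ‖jperp J‖ ^ 2 with hD
  set E := ‖J (.inr (0, 0))‖ ^ 2 + ‖J (.inr (0, 1))‖ ^ 2 with hE
  have hD0 : 0 ≤ D := by positivity
  have hE0 : 0 ≤ E := by positivity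
  have hXDE : X ≤ 2 * D + 3 * E := by rw [hsum]; linarith
  -- The constant is chosen so that 4·(1/2) = 2 and (3/γ)·γ = 3 reproduce 2D + 3E; the remaining
  -- cross terms are nonnegative.
  have hM : X ≤ (4 + 3 / γ) * (1 / 2 * D + γ * E) := by
    have h1 : (4 + 3 / γ) * (1 / 2 * D + γ * E) = 2 * D + 3 * E + (4 * γ * E + 3 / γ * (1 / 2) * D) := by
      field_simp; ring
    rw [h1]
    have : 0 ≤ 4 * γ * E + 3 / γ * (1 / 2) * D := by positivity
    linarith
  have hM2 : 1 / (4 + 3 / γ) * X ≤ (1 - sEps e₁ ε) * X + sEps e₁ ε * D + γ * E := by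
    have h1 : 1 / (4 + 3 / γ) * X ≤ 1 / 2 * D + γ * E := by
      rw [one_div, inv_mul_le_iff₀ (by positivity)]; exact hM
    have h2 : 0 ≤ (1 - sEps e₁ ε) * X := mul_nonneg (by linarith) hX0
    have h3 : 1 / 2 * D ≤ sEps e₁ ε * D := mul_le_mul_of_nonneg_right hs1 hD0
    linarith
  have hβ : 1 / (e₀ - e₁ + 1) ≤ 1 / (e₀ - e₁ + ε ^ 2) :=
    one_div_le_one_div_of_le (by nlinarith [sq_pos_of_pos hε0]) (by linarith)
  have he' : 0 < e₀ - e₁ + 1 := by linarith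
  have hE3 : 0 < 4 + 3 / γ := by positivity
  calc coercConst e₀ e₁ * X ≤ 1 / ((e₀ - e₁ + 1) * (4 + 3 / γ)) * X :=
        mul_le_mul_of_nonneg_right (min_le_right _ _) hX0
    _ = 1 / (e₀ - e₁ + 1) * (1 / (4 + 3 / γ) * X) := by field_simp
    _ ≤ _ := mul_le_mul hβ hM2 (by positivity) (by
      have : 0 < e₀ - e₁ + ε ^ 2 := by nlinarith [sq_pos_of_pos hε0]
      positivity)

theorem perChar_cases (hsub : Q₀ ⊆ cell) (hbd : volume (frontier Q₀) = 0) (hopen : IsOpen Q₀) :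
    ∀ᵐ y ∂μQ, (y ∈ matrixPhase Q₀ ∧ perChar (matrixPhase Q₀) y = 1 ∧ perChar Q₀ y = 0) ∨
      (y ∉ matrixPhase Q₀ ∧ perChar (matrixPhase Q₀) y = 0 ∧ perChar Q₀ y = 1) := by
  filter_upwards [ae_restrict_mem measurableSet_cell, mem_or_mem_matrixPhase hbd hopen] with y hy h
  rw [perChar_of_mem_cell hsub hy, perChar_of_mem_cell (P := matrixPhase Q₀) Set.sdiff_subset hy]
  by_cases hyQ : y ∈ Q₀
  · have : y ∉ matrixPhase Q₀ := fun h => h.2 (subset_closure hyQ)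
    right; simp [this, hyQ]
  · left; simp [h hyQ, hyQ]

/-- The values of the weight form. -/
theorem re_contract_weight (he₁ : 0 < e₁) (he : e₁ < e₀) (l : ℝ) (ξ : Fin 2 → ℂ) :
    -(|l| * (e₀ / e₁)) * ∑ i, ‖ξ i‖ ^ 2 ≤ (contract ((-l) • !![1, 0; 0, 1]) ξ ξ).re ∧
    -(|l| * (e₀ / e₁)) * ∑ i, ‖ξ i‖ ^ 2 ≤ (contract ((-l) • inclWeight e₀ e₁) ξ ξ).re := by
  have hγ := gamma_pos he₁ he
  have h1 : contract !![1, 0; 0, 1] ξ ξ = ((‖ξ 0‖ ^ 2 + ‖ξ 1‖ ^ 2 : ℝ) : ℂ) := by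
    push_cast
    rw [← Complex.mul_conj', ← Complex.mul_conj']
    simp [contract, dotProduct, Matrix.mulVec, Fin.sum_univ_two]
  have h2 : contract (inclWeight e₀ e₁) ξ ξ = ((e₀ / e₁ * ‖ξ 0‖ ^ 2 + ‖ξ 1‖ ^ 2 : ℝ) : ℂ) := by
    push_cast
    rw [← Complex.mul_conj', ← Complex.mul_conj']
    simp [contract, inclWeight, dotProduct, Matrix.mulVec, Fin.sum_univ_two]
    ring
  have h3 : ∀ t : ℝ, 0 ≤ t → t ≤ (e₀ / e₁) * (‖ξ 0‖ ^ 2 + ‖ξ 1‖ ^ 2) →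
      -(|l| * (e₀ / e₁)) * (‖ξ 0‖ ^ 2 + ‖ξ 1‖ ^ 2) ≤ -l * t := fun t ht ht2 => by
    have h4 : l * t ≤ |l| * t := mul_le_mul_of_nonneg_right (le_abs_self l) ht
    have h5 := mul_le_mul_of_nonneg_left ht2 (abs_nonneg l)
    linarith
  rw [Fin.sum_univ_two, contract_smul, contract_smul, h1, h2, ← Complex.ofReal_mul,
    ← Complex.ofReal_mul, Complex.ofReal_re, Complex.ofReal_re]
  exact ⟨h3 _ (by positivity) (by nlinarith [sq_nonneg ‖ξ 0‖, sq_nonneg ‖ξ 1‖]),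
    h3 _ (by nlinarith [sq_nonneg ‖ξ 0‖, sq_nonneg ‖ξ 1‖])
      (by nlinarith [sq_nonneg ‖ξ 0‖, sq_nonneg ‖ξ 1‖])⟩

/-- Pointwise coercivity of the coefficient of the rescaled cell problem. -/
theorem re_sesq_cellCoeff (he₁ : 0 < e₁) (he : e₁ < e₀) (hsub : Q₀ ⊆ cell)
    (hbd : volume (frontier Q₀) = 0) (hopen : IsOpen Q₀) {ε : ℝ} (hε0 : 0 < ε)
    (hε : ε ^ 2 ≤ e₁ / 2) (hε1 : ε ^ 2 ≤ 1) (l : ℝ) :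
    ∀ᵐ y ∂μQ, ∀ J : JetIdx → ℂ, coercConst e₀ e₁ * ∑ ij, ‖J (.inr ij)‖ ^ 2 +
      (matrixPhase Q₀).indicator (fun _ => 1 / (2 * ε ^ 2) * (‖jdiv J‖ ^ 2 + ‖jperp J‖ ^ 2)) y -
      (|l| * (e₀ / e₁)) * ∑ i, ‖J (.inl i)‖ ^ 2 ≤ (sesq (cellCoeff e₀ e₁ Q₀ ε l y) J J).re := by
  filter_upwards [perChar_cases hsub hbd hopen] with y hy J
  rw [cellCoeff, sesq_phaseCoeff, sesq_block, sesq_block]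
  have hw := re_contract_weight he₁ he l fun i => J (.inl i)
  rcases hy with ⟨h1, h2, h3⟩ | ⟨h1, h2, h3⟩
  · rw [h2, h3, Set.indicator_of_mem h1]
    have := re_contract_A1 (e₀ := e₀) he₁ hε0 hε J
    simp only [Complex.ofReal_one, one_mul, Complex.ofReal_zero, zero_mul, add_zero, Complex.add_re]
    linarith [hw.1]
  · rw [h2, h3, Set.indicator_of_notMem h1]
    have := re_contract_A0 he₁ he hε0 hε hε1 J
    simp only [Complex.ofReal_one, one_mul, Complex.ofReal_zero, zero_mul, zero_add, Complex.add_re]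
    linarith [hw.2]

end HighContrast
end

noncomputable section

namespace HighContrast

open scoped ComplexConjugate ENNReal InnerProductSpace

/-! ### The limit of approximate solutions of the rescaled cell problems -/

variable {e₀ e₁ : ℝ} {Q₀ : Set Plane}

theorem integrable_norm_sq {μ : Measure Plane} {f : Plane → ℂ} (hf : MemLp f 2 μ) :
    Integrable (fun y => ‖f y‖ ^ 2) μ := by
  simpa using hf.integrable_norm_pow (p := 2) (by simp)

/-- The energy of the divergence and of the rotated divergence in the matrix phase. -/
def phaseEnergy (Q₀ : Set Plane) {θ : Plane} (u : H1Theta θ) : ℝ :=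
  ∫ y in cell, (matrixPhase Q₀).indicator (fun y => ‖u.div y‖ ^ 2 + ‖u.divPerp y‖ ^ 2) y

theorem memLp_div {θ : Plane} (u : H1Theta θ) : MemLp u.div 2 μQ :=
  (u.memLp_grad 0 0).add (u.memLp_grad 1 1)

theorem memLp_divPerp {θ : Plane} (u : H1Theta θ) : MemLp u.divPerp 2 μQ :=
  (u.memLp_grad 1 0).neg.add (u.memLp_grad 0 1)

theorem integrable_phaseEnergy {θ : Plane} (u : H1Theta θ) : Integrable
    ((matrixPhase Q₀).indicator fun y => ‖u.div y‖ ^ 2 + ‖u.divPerp y‖ ^ 2) μQ :=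
  ((integrable_norm_sq (memLp_div u)).add (integrable_norm_sq (memLp_divPerp u))).indicator
    (measurableSet_matrixPhase Q₀)

theorem coercive_cellCoeff (he₁ : 0 < e₁) (he : e₁ < e₀) (hsub : Q₀ ⊆ cell)
    (hbd : volume (frontier Q₀) = 0) (hopen : IsOpen Q₀) {ε : ℝ} (hε0 : 0 < ε)
    (hε : ε ^ 2 ≤ e₁ / 2) (hε1 : ε ^ 2 ≤ 1) (l : ℝ) {θ : Plane} (u : H1Theta θ) :
    coercConst e₀ e₁ * ∑ ij, ‖u.jet (.inr ij)‖ ^ 2 + 1 / (2 * ε ^ 2) * phaseEnergy Q₀ u -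
      (|l| * (e₀ / e₁)) * ∑ i, ‖u.jet (.inl i)‖ ^ 2 ≤
    (∫ y in cell, sesq (cellCoeff e₀ e₁ Q₀ ε l y) (fun p => u.jetFun p y)
      (fun p => u.jetFun p y)).re := by
  have hsq : ∀ p, Integrable (fun y => ‖u.jetFun p y‖ ^ 2) μQ := fun p =>
    integrable_norm_sq (u.memLp_jetFun p)
  have i1 : Integrable (fun y => coercConst e₀ e₁ * ∑ ij, ‖u.jetFun (.inr ij) y‖ ^ 2) μQ :=
    (integrable_finsetSum _ fun ij _ => hsq (.inr ij)).const_mul _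
  have i2 := (integrable_phaseEnergy (Q₀ := Q₀) u).const_mul (1 / (2 * ε ^ 2))
  have i3 : Integrable (fun y => (|l| * (e₀ / e₁)) * ∑ i, ‖u.jetFun (.inl i) y‖ ^ 2) μQ :=
    (integrable_finsetSum _ fun i _ => hsq (.inl i)).const_mul _
  have i4 := integrable_sesq (bddCoeff_phaseCoeff hopen.measurableSet
    (block ((1 / ε ^ 2) • tensorA1 e₁ ε) ((-l) • !![1, 0; 0, 1]))
    (block ((1 / (e₀ - e₁ + ε ^ 2)) • tensorA0 e₀ e₁ ε) ((-l) • inclWeight e₀ e₁)))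
    u.memLp_jetFun u.memLp_jetFun
  have hle := integral_mono_ae ((i1.add i2).sub i3) i4.re (by
    filter_upwards [re_sesq_cellCoeff he₁ he hsub hbd hopen hε0 hε hε1 l] with y hy
    refine le_trans (le_of_eq ?_) (hy fun p => u.jetFun p y)
    simp only [Pi.add_apply, Pi.sub_apply]
    congr 2
    by_cases h : y ∈ matrixPhase Q₀
    · rw [Set.indicator_of_mem h, Set.indicator_of_mem h]; rfl
    · rw [Set.indicator_of_notMem h, Set.indicator_of_notMem h, mul_zero])
  rw [integral_sub' (i1.add i2) i3, integral_add' i1 i2, integral_const_mul, integral_const_mul,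
    integral_const_mul, integral_finsetSum _ fun ij _ => hsq (.inr ij),
    integral_finsetSum _ fun i _ => hsq (.inl i)] at hle
  have hre := integral_re i4
  simp only [RCLike.re_eq_complex_re] at hre hle
  rw [hre] at hle
  simp only [H1Closure.jet_apply, norm_toLp_sq]
  exact hle

theorem norm_jet_sq {S : Set (Plane → ℂ)} {Ω : Set Plane} (u : H1Closure S Ω) :
    ‖u.jet‖ ^ 2 = ∑ i, ‖u.jet (.inl i)‖ ^ 2 + ∑ ij, ‖u.jet (.inr ij)‖ ^ 2 := by
  rw [PiLp.norm_sq_eq_of_L2, Fintype.sum_sum_type]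

/-- A priori bounds for approximate solutions of the rescaled cell problem. -/
theorem energy_bound (he₁ : 0 < e₁) (he : e₁ < e₀) (hsub : Q₀ ⊆ cell)
    (hbd : volume (frontier Q₀) = 0) (hopen : IsOpen Q₀) {ε : ℝ} (hε0 : 0 < ε)
    (hε : ε ^ 2 ≤ e₁ / 2) (hε1 : ε ^ 2 ≤ 1) {l L δ : ℝ} (hL : |l| ≤ L) {θ : Plane} (u : H1Theta θ)
    (hδ : δ ≤ coercConst e₀ e₁ / 2) (hnorm : ∑ i, ‖u.jet (.inl i)‖ ^ 2 = 1)
    (hres : ‖∫ y in cell, sesq (cellCoeff e₀ e₁ Q₀ ε l y) (fun p => u.jetFun p y)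
      (fun p => u.jetFun p y)‖ ≤ δ * ‖u.jet‖ * ‖u.jet‖) :
    ‖u.jet‖ ≤ 2 + 2 * (L * (e₀ / e₁)) / coercConst e₀ e₁ ∧
    phaseEnergy Q₀ u ≤ 2 * ε ^ 2 * (coercConst e₀ e₁ + L * (e₀ / e₁)) := by
  have hc := coercConst_pos he₁ he
  have h1 := coercive_cellCoeff he₁ he hsub hbd hopen hε0 hε hε1 l u
  have h2 := (Complex.re_le_norm _).trans hres
  have hsum := norm_jet_sq u
  rw [hnorm] at h1 hsum
  set c := coercConst e₀ e₁
  set X := ∑ ij, ‖u.jet (.inr ij)‖ ^ 2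
  have hX : 0 ≤ X := Finset.sum_nonneg fun _ _ => by positivity
  have hE : 0 ≤ phaseEnergy Q₀ u :=
    integral_nonneg fun y => Set.indicator_nonneg (fun _ _ => by positivity) y
  -- Testing with u itself: by normalisation ‖u‖² = 1 + X in H¹, so a residual with δ ≤ c/2 is
  -- absorbed by half of the coercivity.
  have h3 : δ * ‖u.jet‖ * ‖u.jet‖ ≤ c / 2 * (1 + X) := by
    rw [mul_assoc, ← pow_two, hsum]
    exact mul_le_mul_of_nonneg_right hδ (by linarith)
  have hg : |l| * (e₀ / e₁) ≤ L * (e₀ / e₁) :=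
    mul_le_mul_of_nonneg_right hL (div_pos (he₁.trans he) he₁).le
  have hε2 : 0 < 2 * ε ^ 2 := by positivity
  have hE2 : 0 ≤ 1 / (2 * ε ^ 2) * phaseEnergy Q₀ u := by positivity
  have h4 : c / 2 * X + 1 / (2 * ε ^ 2) * phaseEnergy Q₀ u ≤ c / 2 + L * (e₀ / e₁) := by linarith
  set G := L * (e₀ / e₁)
  have hG0 : 0 ≤ G := by
    have : 0 ≤ |l| * (e₀ / e₁) := mul_nonneg (abs_nonneg l) (div_pos (he₁.trans he) he₁).le
    linarith
  have hGc : 0 ≤ 2 * G / c := by positivity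
  constructor
  · have hX2 : X ≤ 1 + 2 * G / c := by
      have e1 : c / 2 * (1 + 2 * G / c) = c / 2 + G := by field_simp
      refine le_of_mul_le_mul_left ?_ (half_pos hc)
      linarith
    refine abs_le_of_sq_le_sq' ?_ (by linarith) |>.2
    rw [hsum]
    nlinarith
  · have : 1 / (2 * ε ^ 2) * phaseEnergy Q₀ u ≤ c + G := by
      have : 0 ≤ c / 2 * X := by positivity
      linarith
    rw [one_div, inv_mul_le_iff₀ hε2] at this
    exact this

/-- Weak limits inherit asymptotic vanishing on a set. -/
theorem ae_eq_zero_of_weak {P : Set Plane} (hP : MeasurableSet P) {f : ℕ → L2Q} {f₀ : L2Q} {C : ℝ}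
    (hf : ∀ n, ‖f n‖ ≤ C) (hw : ∀ g, Tendsto (fun n => ⟪g, f n⟫_ℂ) atTop (𝓝 ⟪g, f₀⟫_ℂ))
    (h0 : Tendsto (fun n => ∫ y in cell, P.indicator (fun y => ‖f n y‖ ^ 2) y) atTop (𝓝 0)) :
    ∀ᵐ y ∂μQ, y ∈ P → f₀ y = 0 := by
  have hm : MemLp (P.indicator fun _ => (1 : ℂ)) ∞ μQ :=
    (memLp_const 1).indicator hP
  set m := toLinf μQ (P.indicator fun _ => (1 : ℂ)) with hmdef
  have hval : ∀ g : L2Q, (m • g : L2Q) =ᵐ[μQ] P.indicator g := fun g => by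
    filter_upwards [coeFn_toLinf_smul hm g] with y hy
    rw [hy]
    by_cases h : y ∈ P <;> simp [h]
  have hnorm : ∀ n, ‖(m • f n : L2Q)‖ ^ 2 = ∫ y in cell, P.indicator (fun y => ‖f n y‖ ^ 2) y :=
    fun n => by
      have h1 := norm_toLp_sq (Lp.memLp (m • f n : L2Q))
      rw [Lp.toLp_coeFn] at h1
      rw [h1]
      refine integral_congr_ae ?_
      filter_upwards [hval (f n)] with y hy
      rw [hy]
      by_cases h : y ∈ P <;> simp [h]
  have hs : Tendsto (fun n => (m • f n : L2Q)) atTop (𝓝 0) := by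
    rw [tendsto_zero_iff_norm_tendsto_zero]
    have h1 : Tendsto (fun n => √(‖(m • f n : L2Q)‖ ^ 2)) atTop (𝓝 √0) := by
      refine (Real.continuous_sqrt.tendsto 0).comp ?_
      simpa only [hnorm] using h0
    simpa only [Real.sqrt_sq (norm_nonneg _), Real.sqrt_zero] using h1
  -- Multiplication by the indicator is weakly continuous, so the strong limit 0 is also the weak
  -- limit `m • f₀`.
  have hzero : (m • f₀ : L2Q) = 0 := by
    refine ext_inner_left ℂ fun g => ?_
    have h1 := tendsto_inner_smul (g := fun _ => g) (m := fun _ => m) hf hw tendsto_const_nhds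
      tendsto_const_nhds
    have h2 : Tendsto (fun n => ⟪g, (m • f n : L2Q)⟫_ℂ) atTop (𝓝 ⟪g, (0 : L2Q)⟫_ℂ) :=
      tendsto_const_nhds.inner hs
    exact tendsto_nhds_unique h1 h2
  have h1 := hval f₀
  rw [hzero] at h1
  filter_upwards [h1, Lp.coeFn_zero ℂ 2 μQ] with y h2 h3 hy
  rw [h3, Set.indicator_of_mem hy] at h2
  exact h2.symm

/-- Each divergence is a sum of two derivatives with a unimodular coefficient, is linear in the jet,
and has its squared norm on the matrix phase bounded by the phase energy; `ae_eq_zero_of_weak`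
applies to both. -/
theorem mem_V_of_weak {θ : ℕ → Plane} {θ₀ : Plane} {u : ∀ n, H1Theta (θ n)} {u₀ : H1Theta θ₀} {C : ℝ}
    (hC : ∀ n, ‖(u n).jet‖ ≤ C)
    (hw : ∀ p f, Tendsto (fun k => ⟪f, (u k).jet p⟫_ℂ) atTop (𝓝 ⟪f, u₀.jet p⟫_ℂ))
    (h0 : Tendsto (fun n => phaseEnergy Q₀ (u n)) atTop (𝓝 0)) : u₀ ∈ V Q₀ θ₀ := by
  have hP := measurableSet_matrixPhase Q₀
  have key : ∀ (a b : JetIdx) (s : ℂ), ‖s‖ = 1 →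
      (∀ (n : ℕ) (y : Plane), ‖(u n).jetFun b y + s * (u n).jetFun a y‖ ^ 2 ≤
        ‖(u n).div y‖ ^ 2 + ‖(u n).divPerp y‖ ^ 2) →
      ∀ᵐ y ∂μQ, y ∈ matrixPhase Q₀ → u₀.jetFun b y + s * u₀.jetFun a y = 0 := by
    intro a b s hs hle
    have hval : ∀ {θ : Plane} (v : H1Theta θ), (v.jet b + s • v.jet a : L2Q) =ᵐ[μQ]
        fun y => v.jetFun b y + s * v.jetFun a y := fun v => by
      filter_upwards [coeFn_add_smul (v.jet b) (v.jet a) s, v.coeFn_jet a, v.coeFn_jet b]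
        with y h1 h2 h3
      rw [h1, h2, h3]
    have h1 := ae_eq_zero_of_weak (f := fun n => ((u n).jet b + s • (u n).jet a : L2Q))
      (f₀ := (u₀.jet b + s • u₀.jet a : L2Q)) (C := C + C) hP
      (fun n => by
        refine (norm_add_le _ _).trans (add_le_add ((norm_apply_le_jet _ _).trans (hC n)) ?_)
        rw [norm_smul, hs, one_mul]
        exact (norm_apply_le_jet _ _).trans (hC n))
      (fun g => by
        simp only [inner_add_right, inner_smul_right]
        exact (hw b g).add ((hw a g).const_mul s))
      (by
        refine squeeze_zero (fun n => integral_nonneg fun y =>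
          Set.indicator_nonneg (fun _ _ => by positivity) y) (fun n => ?_) h0
        refine integral_mono_ae ?_ (integrable_phaseEnergy (u n)) ?_
        · exact (integrable_norm_sq (Lp.memLp _)).indicator hP
        · filter_upwards [hval (u n)] with y hy
          by_cases h : y ∈ matrixPhase Q₀
          · rw [Set.indicator_of_mem h, Set.indicator_of_mem h, hy]
            exact hle n y
          · rw [Set.indicator_of_notMem h, Set.indicator_of_notMem h])
    filter_upwards [h1, hval u₀] with y h2 h3 h4
    rw [← h3]; exact h2 h4
  rw [mem_V_iff]
  filter_upwards [key (.inr (1, 1)) (.inr (0, 0)) 1 (by simp) fun n y => by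
      rw [one_mul]; exact le_add_of_nonneg_right (by positivity),
    key (.inr (1, 0)) (.inr (0, 1)) (-1) (by simp) fun n y => by
      rw [neg_one_mul, add_comm]; exact le_add_of_nonneg_left (by positivity)] with y h1 h2 hy
  refine ⟨?_, ?_⟩
  · rw [← h1 hy, one_mul]; rfl
  · rw [← h2 hy, neg_one_mul, add_comm]; rfl

/-- The phases are fixed and only constant matrices vary, so entrywise convergence of the matrices
is already convergence in L^∞. -/
theorem tendsto_toLinf_phaseCoeff (hQ₀ : MeasurableSet Q₀) {B₁ B₀ : ℕ → JetIdx → JetIdx → ℝ}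
    {C₁ C₀ : JetIdx → JetIdx → ℝ} (h1 : ∀ p q, Tendsto (fun n => B₁ n p q) atTop (𝓝 (C₁ p q)))
    (h0 : ∀ p q, Tendsto (fun n => B₀ n p q) atTop (𝓝 (C₀ p q))) (μ : Measure Plane) (p q : JetIdx) :
    Tendsto (fun n => toLinf μ fun y => (phaseCoeff Q₀ (B₁ n) (B₀ n) y p q : ℂ)) atTop
      (𝓝 (toLinf μ fun y => (phaseCoeff Q₀ C₁ C₀ y p q : ℂ))) := by
  rw [tendsto_iff_norm_sub_tendsto_zero]
  have hlim : Tendsto (fun n => |B₁ n p q - C₁ p q| + |B₀ n p q - C₀ p q|) atTop (𝓝 0) := by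
    have e1 := (tendsto_iff_norm_sub_tendsto_zero.1 (h1 p q))
    have e2 := (tendsto_iff_norm_sub_tendsto_zero.1 (h0 p q))
    simpa using e1.add e2
  refine squeeze_zero (fun _ => norm_nonneg _) (fun n => ?_) hlim
  refine norm_toLinf_sub_le ((bddCoeff_phaseCoeff hQ₀ _ _).memLp μ p q)
    ((bddCoeff_phaseCoeff hQ₀ _ _).memLp μ p q) (by positivity) (.of_forall fun y => ?_)
  rw [← Complex.ofReal_sub, Complex.norm_real, Real.norm_eq_abs]
  have e : phaseCoeff Q₀ (B₁ n) (B₀ n) y p q - phaseCoeff Q₀ C₁ C₀ y p q =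
      perChar (matrixPhase Q₀) y * (B₁ n p q - C₁ p q) + perChar Q₀ y * (B₀ n p q - C₀ p q) := by
    simp only [phaseCoeff]; ring
  rw [e]
  refine (abs_add_le _ _).trans (add_le_add ?_ ?_) <;> rw [abs_mul] <;>
    refine mul_le_of_le_one_left (abs_nonneg _) ?_ <;>
    rw [abs_of_nonneg (perChar_nonneg _ _)] <;> exact perChar_le_one _ _

theorem tendsto_block {A : ℕ → Matrix (Fin 4) (Fin 4) ℝ} {A₀ : Matrix (Fin 4) (Fin 4) ℝ}
    {R : ℕ → Matrix (Fin 2) (Fin 2) ℝ} {R₀ : Matrix (Fin 2) (Fin 2) ℝ}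
    (hA : Tendsto A atTop (𝓝 A₀)) (hR : Tendsto R atTop (𝓝 R₀)) (p q : JetIdx) :
    Tendsto (fun n => block (A n) (R n) p q) atTop (𝓝 (block A₀ R₀ p q)) := by
  have h1 : ∀ i j, Tendsto (fun n => A n i j) atTop (𝓝 (A₀ i j)) := fun i j =>
    tendsto_pi_nhds.1 (tendsto_pi_nhds.1 hA i) j
  have h2 : ∀ i j, Tendsto (fun n => R n i j) atTop (𝓝 (R₀ i j)) := fun i j =>
    tendsto_pi_nhds.1 (tendsto_pi_nhds.1 hR i) j
  match p, q with
  | .inl i, .inl j => exact h2 i j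
  | .inr a, .inr b => exact h1 _ _
  | .inl i, .inr b => exact tendsto_const_nhds
  | .inr a, .inl j => exact tendsto_const_nhds

/-! ### Coefficients reduced to test fields in V(θ), and their limits -/

theorem contract_one (J J' : JetIdx → ℂ) :
    contract (1 : Matrix (Fin 4) (Fin 4) ℝ) (gradCol J) (gradCol J') = gradPair J J' := by
  have : ((1 : Matrix (Fin 4) (Fin 4) ℝ).map fun t : ℝ => (t : ℂ)) = 1 :=
    Matrix.map_one _ (by simp) (by simp)
  rw [contract, this, Matrix.one_mulVec]
  simp only [gradCol, gradPair, dotProduct, Fintype.sum_prod_type, Fin.sum_univ_two,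
    Fin.sum_univ_four, Pi.star_apply, RCLike.star_def]
  simp
  ring

/-- The coefficient of the rescaled cell problem on test fields in `V(θ)`. -/
def reducedCoeff (e₀ e₁ : ℝ) (Q₀ : Set Plane) (a ε l : ℝ) : Plane → JetIdx → JetIdx → ℝ :=
  phaseCoeff Q₀ (block (a • 1) ((-l) • !![1, 0; 0, 1]))
    (block ((1 / (e₀ - e₁ + ε ^ 2)) • tensorA0 e₀ e₁ ε) ((-l) • inclWeight e₀ e₁))

/-- The matrix-phase coefficient is only seen where the test field has vanishing div and div^⊥, so
it may be exchanged for any other that agrees against such jets. -/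
theorem integral_sesq_congr_V {B₁ B₁' B₀ : JetIdx → JetIdx → ℝ}
    (h : ∀ J J', jdiv J' = 0 → jperp J' = 0 → sesq B₁ J J' = sesq B₁' J J')
    {θ : Plane} {u φ : H1Theta θ} (hφ : φ ∈ V Q₀ θ) :
    ∫ y in cell, sesq (phaseCoeff Q₀ B₁ B₀ y) (fun p => u.jetFun p y) (fun p => φ.jetFun p y) =
    ∫ y in cell, sesq (phaseCoeff Q₀ B₁' B₀ y) (fun p => u.jetFun p y) (fun p => φ.jetFun p y) := by
  refine integral_congr_ae ?_
  filter_upwards [(mem_V_iff φ).1 hφ, ae_restrict_mem measurableSet_cell] with y hy hyc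
  rw [sesq_phaseCoeff, sesq_phaseCoeff]
  by_cases hm : y ∈ matrixPhase Q₀
  · rw [h (fun p => u.jetFun p y) (fun p => φ.jetFun p y) (hy hm).1 (hy hm).2]
  · rw [perChar_of_mem_cell (P := matrixPhase Q₀) Set.sdiff_subset hyc, Set.indicator_of_notMem hm]
    simp

/-- The part s_ε/ε² carrying the divergences is annihilated by the test field, leaving the
coefficient (1 − s_ε)/ε², which converges. This is why test fields must lie exactly in V(θ), not
just close to it. -/
theorem integral_cellCoeff_V (ε l : ℝ) {θ : Plane} {u φ : H1Theta θ}
    (hφ : φ ∈ V Q₀ θ) :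
    ∫ y in cell, sesq (cellCoeff e₀ e₁ Q₀ ε l y) (fun p => u.jetFun p y) (fun p => φ.jetFun p y) =
    ∫ y in cell, sesq (reducedCoeff e₀ e₁ Q₀ (1 / ε ^ 2 * (1 - sEps e₁ ε)) ε l y)
      (fun p => u.jetFun p y) (fun p => φ.jetFun p y) := by
  refine integral_sesq_congr_V (fun J J' h1 h2 => ?_) hφ
  simp only [sesq_block, contract_smul, contract_tensorA1, contract_one, h1, h2]
  simp [mul_assoc]

theorem integral_limitCoeff_V (l : ℝ) {θ : Plane} {u φ : H1Theta θ}
    (hφ : φ ∈ V Q₀ θ) :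
    ∫ y in cell, sesq (reducedCoeff e₀ e₁ Q₀ (1 / (2 * e₁)) 0 l y)
      (fun p => u.jetFun p y) (fun p => φ.jetFun p y) =
    ∫ y in cell, sesq (limitCoeff e₀ e₁ Q₀ l y) (fun p => u.jetFun p y)
      (fun p => φ.jetFun p y) := by
  have : limitCoeff e₀ e₁ Q₀ l = phaseCoeff Q₀
      (block ((1 / (2 * e₁)) • limitMatrix) ((-l) • !![1, 0; 0, 1]))
      (block ((1 / (e₀ - e₁ + 0 ^ 2)) • tensorA0 e₀ e₁ 0) ((-l) • inclWeight e₀ e₁)) := by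
    rw [limitCoeff]; norm_num
  rw [this]
  refine integral_sesq_congr_V (fun J J' h1 h2 => ?_) hφ
  simp only [sesq_block, contract_smul, contract_limitMatrix h1 h2, contract_one]

theorem tendsto_sEps {ε : ℕ → ℝ} (hεlim : Tendsto ε atTop (𝓝 0)) :
    Tendsto (fun n => sEps e₁ (ε n)) atTop (𝓝 1) := by
  have h : Continuous fun t => sEps e₁ t := by unfold sEps; fun_prop
  have := (h.tendsto 0).comp hεlim
  simpa [sEps, Function.comp_def] using this

/-- From 1 − s² = ε²/e₁, the quotient equals 1/((1 + s)e₁), and s → 1. This is the origin of the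
factor 1/(2e₁) in the limit tensor. -/
theorem tendsto_one_sub_sEps (he₁ : 0 < e₁) {ε : ℕ → ℝ} (hε0 : ∀ n, 0 < ε n)
    (hε : ∀ n, ε n ^ 2 ≤ e₁ / 2) (hεlim : Tendsto ε atTop (𝓝 0)) :
    Tendsto (fun n => 1 / ε n ^ 2 * (1 - sEps e₁ (ε n))) atTop (𝓝 (1 / (2 * e₁))) := by
  have h1 : ∀ n, 1 / ε n ^ 2 * (1 - sEps e₁ (ε n)) = 1 / ((1 + sEps e₁ (ε n)) * e₁) := fun n => by
    have h2 : sEps e₁ (ε n) ^ 2 = 1 - ε n ^ 2 / e₁ := by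
      refine Real.sq_sqrt ?_
      rw [sub_nonneg, div_le_iff₀ he₁]; linarith [hε n]
    have h3 := sEps_nonneg e₁ (ε n)
    have h4 := hε0 n
    rw [div_mul_eq_mul_div, one_mul, div_eq_div_iff (by positivity) (by positivity)]
    have : ε n ^ 2 = (1 - sEps e₁ (ε n) ^ 2) * e₁ := by rw [h2]; field_simp; ring
    linear_combination -this
  simp_rw [h1]
  have h5 := ((tendsto_sEps (e₁ := e₁) hεlim).const_add 1).mul_const e₁
  have h6 := h5.inv₀ (by positivity)
  norm_num at h6 ⊢
  simpa [mul_comm] using h6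

theorem tendsto_tensorA0 {ε : ℕ → ℝ} (hεlim : Tendsto ε atTop (𝓝 0)) :
    Tendsto (fun n => tensorA0 e₀ e₁ (ε n)) atTop (𝓝 (tensorA0 e₀ e₁ 0)) := by
  have h : Continuous fun t => tensorA0 e₀ e₁ t := by
    refine continuous_matrix fun i j => ?_
    fin_cases i <;> fin_cases j <;> simp [tensorA0] <;> fun_prop
  exact (h.tendsto 0).comp hεlim

theorem bddCoeff_reducedCoeff (hQ₀ : MeasurableSet Q₀) (a ε l : ℝ) :
    BddCoeff (reducedCoeff e₀ e₁ Q₀ a ε l) := bddCoeff_phaseCoeff hQ₀ _ _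

theorem tendsto_reducedCoeff (he : e₁ < e₀) (hQ₀ : MeasurableSet Q₀) {a ε l : ℕ → ℝ} {a₀ l₀ : ℝ}
    (ha : Tendsto a atTop (𝓝 a₀)) (hε : Tendsto ε atTop (𝓝 0)) (hl : Tendsto l atTop (𝓝 l₀))
    (μ : Measure Plane) (p q : JetIdx) :
    Tendsto (fun n => toLinf μ fun y => (reducedCoeff e₀ e₁ Q₀ (a n) (ε n) (l n) y p q : ℂ)) atTop
      (𝓝 (toLinf μ fun y => (reducedCoeff e₀ e₁ Q₀ a₀ 0 l₀ y p q : ℂ))) := by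
  have hR : ∀ R : Matrix (Fin 2) (Fin 2) ℝ,
      Tendsto (fun k => (-l k) • R) atTop (𝓝 ((-l₀) • R)) := fun R => hl.neg.smul_const R
  have hA : Tendsto (fun k => a k • (1 : Matrix (Fin 4) (Fin 4) ℝ)) atTop (𝓝 (a₀ • 1)) :=
    ha.smul_const _
  have hB : Tendsto (fun k => (1 / (e₀ - e₁ + ε k ^ 2)) • tensorA0 e₀ e₁ (ε k)) atTop
      (𝓝 ((1 / (e₀ - e₁ + 0 ^ 2)) • tensorA0 e₀ e₁ 0)) := by
    refine Tendsto.smul ?_ (tendsto_tensorA0 hε)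
    have := ((hε.pow 2).const_add (e₀ - e₁)).inv₀ (by simp; linarith)
    simpa only [one_div] using this
  exact tendsto_toLinf_phaseCoeff hQ₀ (fun p q => tendsto_block hA (hR _) p q)
    (fun p q => tendsto_block hB (hR _) p q) μ p q

/-- Passing to the limit in sesquilinear forms: strongly convergent bounded coefficients, weakly
convergent fields and strongly convergent test fields. -/
theorem tendsto_integral_sesq {m : ℕ → Plane → JetIdx → JetIdx → ℝ} {m₀ : Plane → JetIdx → JetIdx → ℝ}
    (hm : ∀ n, BddCoeff (m n)) (hm₀ : BddCoeff m₀)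
    (hlim : ∀ p q, Tendsto (fun n => toLinf μQ fun y => (m n y p q : ℂ)) atTop
      (𝓝 (toLinf μQ fun y => (m₀ y p q : ℂ))))
    {θ : ℕ → Plane} {θ₀ : Plane} {u ψ : ∀ n, H1Theta (θ n)} {u₀ φ : H1Theta θ₀} {C : ℝ}
    (hC : ∀ n, ‖(u n).jet‖ ≤ C)
    (hw : ∀ p f, Tendsto (fun k => ⟪f, (u k).jet p⟫_ℂ) atTop (𝓝 ⟪f, u₀.jet p⟫_ℂ))
    (hψ : ∀ p, Tendsto (fun k => (ψ k).jet p) atTop (𝓝 (φ.jet p))) :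
    Tendsto (fun k => ∫ y in cell, sesq (m k y) (fun p => (u k).jetFun p y)
      (fun p => (ψ k).jetFun p y)) atTop
      (𝓝 (∫ y in cell, sesq (m₀ y) (fun p => u₀.jetFun p y) (fun p => φ.jetFun p y))) := by
  rw [integral_sesq hm₀ u₀.memLp_jetFun φ.memLp_jetFun]
  refine Tendsto.congr (fun k => (integral_sesq (hm k) (u k).memLp_jetFun
    (ψ k).memLp_jetFun).symm) ?_
  exact tendsto_finsetSum _ fun p _ => tendsto_finsetSum _ fun q _ =>
    tendsto_inner_smul (f := fun k => (u k).jet q) (f₀ := u₀.jet q) (g := fun k => (ψ k).jet p)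
      (C := C) (fun k => (norm_apply_le_jet (u k).jet q).trans (hC k)) (hw q) (hψ p) (hlim p q)

/-- Approximate solutions of the rescaled cell problems, normalised in `L²`, converge along a
subsequence to a solution of the limit problem. -/
theorem exists_limit_of_bounds (he₁ : 0 < e₁) (he : e₁ < e₀) (hopen : IsOpen Q₀)
    (hne : Q₀.Nonempty) (hsub : Q₀ ⊆ cell) (hbd : volume (frontier Q₀) = 0)
    {ε l δ : ℕ → ℝ} {l₀ : ℝ} {θ : ℕ → Plane} {θ₀ : Plane} (u : ∀ n, H1Theta (θ n))
    (hε0 : ∀ n, 0 < ε n) (hε : ∀ n, ε n ^ 2 ≤ e₁ / 2) (hε1 : ∀ n, ε n ^ 2 ≤ 1)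
    (hεlim : Tendsto ε atTop (𝓝 0)) (hcell : ∀ n, θ n ∈ cell) (hθ : Tendsto θ atTop (𝓝 θ₀))
    (hclose : ∀ n j, |(θ n - θ₀) j| ≤ 1 / 4) (hl : Tendsto l atTop (𝓝 l₀))
    (hnorm : ∀ n, ∑ i, ‖(u n).jet (.inl i)‖ ^ 2 = 1) (hδ : ∀ n, δ n ≤ coercConst e₀ e₁ / 2)
    (hδlim : Tendsto δ atTop (𝓝 0))
    (hres : ∀ n, ∀ φ : H1Theta (θ n), ‖∫ y in cell, sesq (cellCoeff e₀ e₁ Q₀ (ε n) (l n) y)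
      (fun p => (u n).jetFun p y) (fun p => φ.jetFun p y)‖ ≤ δ n * ‖(u n).jet‖ * ‖φ.jet‖) :
    ∃ (s : ℕ → ℕ) (u₀ : H1Theta θ₀), StrictMono s ∧ u₀ ∈ V Q₀ θ₀ ∧
      (∀ p f, Tendsto (fun k => ⟪f, (u (s k)).jet p⟫_ℂ) atTop (𝓝 ⟪f, u₀.jet p⟫_ℂ)) ∧
      (∀ i, Tendsto (fun k => (u (s k)).jet (.inl i)) atTop (𝓝 (u₀.jet (.inl i)))) ∧
      SolvesLimitProblem e₀ e₁ Q₀ l₀ u₀ := by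
  obtain ⟨L, hL⟩ : ∃ L, ∀ n, |l n| ≤ L := by
    obtain ⟨L, hL⟩ := (Metric.isBounded_range_of_tendsto l hl).exists_norm_le
    exact ⟨L, fun n => hL _ ⟨n, rfl⟩⟩
  have hb := fun n => energy_bound he₁ he hsub hbd hopen (hε0 n) (hε n) (hε1 n) (hL n) (u n) (hδ n)
    (hnorm n) (hres n (u n))
  set C := 2 + 2 * (L * (e₀ / e₁)) / coercConst e₀ e₁
  obtain ⟨s, u₀, hs, hw, hstrong⟩ := exists_subseq_h1Theta hθ hcell u fun n => (hb n).1
  have hsl := hs.tendsto_atTop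
  have hεs := hεlim.comp hsl
  have hV : u₀ ∈ V Q₀ θ₀ := by
    refine mem_V_of_weak (u := fun k => u (s k)) (fun k => (hb (s k)).1) hw ?_
    refine squeeze_zero (fun k => integral_nonneg fun y =>
      Set.indicator_nonneg (fun _ _ => by positivity) y) (fun k => (hb (s k)).2) ?_
    have := ((hεs.pow 2).const_mul 2).mul_const (coercConst e₀ e₁ + L * (e₀ / e₁))
    simpa using this
  refine ⟨s, u₀, hs, hV, hw, hstrong, fun φ hφ => ?_⟩
  -- The problem with index `s k` has to be tested in V(θ (s k)); the strong H¹ convergence of `ψ`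
  -- compensates for the merely weak convergence of the solutions.
  obtain ⟨ψ, hψV, hψ⟩ := exists_approx_V hopen hne hsub hbd (hθ.comp hsl)
    (fun k => hclose (s k)) hφ
  have hQ₀ := hopen.measurableSet
  have hψjet : Tendsto (fun k => ‖(ψ k).jet‖ ^ 2) atTop (𝓝 (‖φ.jet‖ ^ 2)) := by
    simp only [PiLp.norm_sq_eq_of_L2]
    exact tendsto_finsetSum _ fun p _ => (hψ p).norm.pow 2
  have hψnorm : Tendsto (fun k => ‖(ψ k).jet‖) atTop (𝓝 ‖φ.jet‖) := by
    have := (Real.continuous_sqrt.tendsto _).comp hψjet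
    simpa only [Function.comp_def, Real.sqrt_sq (norm_nonneg _)] using this
  have hzero : Tendsto (fun k => ∫ y in cell, sesq (cellCoeff e₀ e₁ Q₀ (ε (s k)) (l (s k)) y)
      (fun p => (u (s k)).jetFun p y) (fun p => (ψ k).jetFun p y)) atTop (𝓝 0) := by
    have hlim : Tendsto (fun k => |δ (s k)| * C * ‖(ψ k).jet‖) atTop (𝓝 0) := by
      have := ((hδlim.comp hsl).abs.mul_const C).mul hψnorm
      simpa using this
    refine squeeze_zero_norm (fun k => (hres (s k) (ψ k)).trans ?_) hlim
    refine mul_le_mul_of_nonneg_right ?_ (norm_nonneg _)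
    exact mul_le_mul (le_abs_self _) (hb (s k)).1 (norm_nonneg _) (abs_nonneg _)
  have hlimit : Tendsto (fun k => ∫ y in cell, sesq (cellCoeff e₀ e₁ Q₀ (ε (s k)) (l (s k)) y)
      (fun p => (u (s k)).jetFun p y) (fun p => (ψ k).jetFun p y)) atTop
      (𝓝 (∫ y in cell, sesq (reducedCoeff e₀ e₁ Q₀ (1 / (2 * e₁)) 0 l₀ y)
        (fun p => u₀.jetFun p y) (fun p => φ.jetFun p y))) := by
    simp only [integral_cellCoeff_V _ _ (hψV _)]
    exact tendsto_integral_sesq (fun k => bddCoeff_reducedCoeff hQ₀ _ _ _)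
      (bddCoeff_reducedCoeff hQ₀ _ _ _) (tendsto_reducedCoeff he hQ₀
        (tendsto_one_sub_sEps he₁ (fun k => hε0 (s k)) (fun k => hε (s k)) hεs) hεs (hl.comp hsl) μQ)
      (fun k => (hb (s k)).1) hw hψ
  have h0 := tendsto_nhds_unique hlimit hzero
  rw [integral_limitCoeff_V l₀ hφ, integral_limitCoeff hQ₀] at h0
  exact sub_eq_zero.1 h0

/-- A version of `exists_limit_of_bounds` with asymptotic assumptions only. -/
theorem exists_limit_of_residual (he₁ : 0 < e₁) (he : e₁ < e₀) (hopen : IsOpen Q₀)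
    (hne : Q₀.Nonempty) (hsub : Q₀ ⊆ cell) (hbd : volume (frontier Q₀) = 0)
    {ε l δ : ℕ → ℝ} {l₀ : ℝ} {θ : ℕ → Plane} {θ₀ : Plane} (u : ∀ n, H1Theta (θ n))
    (hε0 : ∀ n, 0 < ε n) (hεlim : Tendsto ε atTop (𝓝 0)) (hcell : ∀ n, θ n ∈ cell)
    (hθ : Tendsto θ atTop (𝓝 θ₀)) (hl : Tendsto l atTop (𝓝 l₀))
    (hnorm : ∀ n, ∑ i, ‖(u n).jet (.inl i)‖ ^ 2 = 1) (hδlim : Tendsto δ atTop (𝓝 0))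
    (hres : ∀ n, ∀ φ : H1Theta (θ n), ‖∫ y in cell, sesq (cellCoeff e₀ e₁ Q₀ (ε n) (l n) y)
      (fun p => (u n).jetFun p y) (fun p => φ.jetFun p y)‖ ≤ δ n * ‖(u n).jet‖ * ‖φ.jet‖) :
    ∃ (s : ℕ → ℕ) (u₀ : H1Theta θ₀), StrictMono s ∧ u₀ ∈ V Q₀ θ₀ ∧
      (∀ p f, Tendsto (fun k => ⟪f, (u (s k)).jet p⟫_ℂ) atTop (𝓝 ⟪f, u₀.jet p⟫_ℂ)) ∧
      (∀ i, Tendsto (fun k => (u (s k)).jet (.inl i)) atTop (𝓝 (u₀.jet (.inl i)))) ∧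
      SolvesLimitProblem e₀ e₁ Q₀ l₀ u₀ ∧ ¬ u₀.IsZero := by
  have hc := coercConst_pos he₁ he
  have hε2 : Tendsto (fun n => ε n ^ 2) atTop (𝓝 0) := by simpa using hεlim.pow 2
  have hθj : ∀ j, Tendsto (fun n => |(θ n - θ₀) j|) atTop (𝓝 0) := fun j => by
    have h1 : Continuous fun x : Plane => |(x - θ₀) j| := by fun_prop
    simpa [Function.comp_def] using (h1.tendsto θ₀).comp hθ
  have hev : ∀ᶠ n in atTop, (ε n ^ 2 ≤ e₁ / 2 ∧ ε n ^ 2 ≤ 1) ∧ (∀ j, |(θ n - θ₀) j| ≤ 1 / 4) ∧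
      δ n ≤ coercConst e₀ e₁ / 2 :=
    ((hε2.eventually_le_const (by positivity)).and (hε2.eventually_le_const one_pos)).and
      ((eventually_all.2 fun j => (hθj j).eventually_le_const (by norm_num)).and
        (hδlim.eventually_le_const (by positivity)))
  obtain ⟨N, hN⟩ := eventually_atTop.1 hev
  have hsh := tendsto_add_atTop_nat N
  have hN' := fun n => hN (n + N) (Nat.le_add_left N n)
  obtain ⟨s, u₀, hs, hV, hw, hstrong, hsol⟩ := exists_limit_of_bounds he₁ he hopen hne hsub hbd
    (fun n => u (n + N)) (fun n => hε0 (n + N)) (fun n => (hN' n).1.1) (fun n => (hN' n).1.2)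
    (hεlim.comp hsh) (fun n => hcell (n + N)) (hθ.comp hsh) (fun n => (hN' n).2.1) (hl.comp hsh)
    (fun n => hnorm (n + N)) (fun n => (hN' n).2.2) (hδlim.comp hsh) (fun n => hres (n + N))
  refine ⟨fun k => s k + N, u₀, fun a b h => Nat.add_lt_add_right (hs h) N, hV, hw, hstrong, hsol,
    fun h0 => ?_⟩
  -- Strong L² convergence preserves the normalisation, so the limit has norm 1.
  have h1 : Tendsto (fun k => ∑ i, ‖(u (s k + N)).jet (.inl i)‖ ^ 2) atTop
      (𝓝 (∑ i, ‖u₀.jet (.inl i)‖ ^ 2)) := tendsto_finsetSum _ fun i _ => (hstrong i).norm.pow 2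
  simp only [hnorm] at h1
  have h2 : ∀ i, u₀.jet (.inl i) = 0 := fun i => by
    rw [H1Closure.jet_apply]
    exact (MemLp.toLp_eq_toLp_iff (u₀.memLp_toFun i) MemLp.zero).2 (h0 i)
  simp only [h2] at h1
  have := tendsto_nhds_unique h1 tendsto_const_nhds
  norm_num at this

end HighContrast
end

noncomputable section

namespace HighContrast

open scoped ComplexConjugate ENNReal InnerProductSpace

/-! ### The limit Bloch spectrum and the compactness theorem -/

variable {e₀ e₁ : ℝ} {Q₀ : Set Plane}

/-- Under the constraints ∇u₂ is a rotation of ∇u₁, so both components contribute equally. The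
resulting 2 cancels the one in 1/(2e₁). -/
theorem gradPair_of_div_eq_zero {J J' : JetIdx → ℂ} (h1 : jdiv J = 0) (h2 : jperp J = 0)
    (h1' : jdiv J' = 0) (h2' : jperp J' = 0) :
    gradPair J J' = 2 * ∑ j, J (.inr (0, j)) * conj (J' (.inr (0, j))) := by
  have e1 : J (.inr (1, 1)) = -J (.inr (0, 0)) := by
    simp only [jdiv] at h1; linear_combination h1
  have e2 : J (.inr (1, 0)) = J (.inr (0, 1)) := by
    simp only [jperp] at h2; linear_combination -h2
  have e1' : J' (.inr (1, 1)) = -J' (.inr (0, 0)) := by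
    simp only [jdiv] at h1'; linear_combination h1'
  have e2' : J' (.inr (1, 0)) = J' (.inr (0, 1)) := by
    simp only [jperp] at h2'; linear_combination -h2'
  simp only [gradPair, Fintype.sum_prod_type, Fin.sum_univ_two, e1, e2, e1', e2', map_neg]
  ring

/-- The form of the limit Bloch operator and the form of the limit problem agree on `V(θ)`. -/
theorem bloch_form_eq (he₁ : 0 < e₁) (he : e₁ < e₀) (hsub : Q₀ ⊆ cell) (hopen : IsOpen Q₀)
    (hbd : volume (frontier Q₀) = 0) {θ : Plane} {u φ : H1Theta θ} (hu : u ∈ V Q₀ θ)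
    (hφ : φ ∈ V Q₀ θ) :
    ∫ y in cell, ((∑ j, u.grad 0 j y * star (φ.grad 0 j y))
        + (((e₀ / e₁ - 1)⁻¹ : ℝ) : ℂ) *
          (u.div y * star (φ.div y) + u.divPerp y * star (φ.divPerp y))) =
      e₁ * ∫ y in cell, contract (limitTensor e₀ e₁ Q₀ y) (u.gradVec y) (φ.gradVec y) := by
  rw [← integral_const_mul]
  refine integral_congr_ae ?_
  have hγ : (e₀ / e₁ - 1 : ℝ) ≠ 0 := (gamma_pos he₁ he).ne'
  have he₁' : (e₁ : ℂ) ≠ 0 := Complex.ofReal_ne_zero.2 he₁.ne'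
  have hten : ∀ y, limitTensor e₀ e₁ Q₀ y = (1 / (2 * e₁) * perChar (matrixPhase Q₀) y) • limitMatrix +
      (1 / (e₀ - e₁) * perChar Q₀ y) • tensorA0 e₀ e₁ 0 := fun y => by
    simp [limitTensor, tensorA0, limitMatrix]
  filter_upwards [perChar_cases hsub hbd hopen, (mem_V_iff u).1 hu, (mem_V_iff φ).1 hφ]
    with y hy h1 h2
  rw [hten, contract_add, contract_smul, contract_smul, H1Closure.gradVec_eq, H1Closure.gradVec_eq]
  rcases hy with ⟨hm, e1, e2⟩ | ⟨hm, e1, e2⟩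
  · obtain ⟨d1, d2⟩ := h1 hm
    obtain ⟨d3, d4⟩ := h2 hm
    rw [e1, e2, d1, d2, contract_limitMatrix (J' := fun p => φ.jetFun p y) d3 d4,
      gradPair_of_div_eq_zero (J := fun p => u.jetFun p y) (J' := fun p => φ.jetFun p y) d1 d2 d3 d4]
    push_cast
    simp only [zero_mul, add_zero, mul_zero, mul_one]
    field_simp
    rfl
  -- At ε = 0 the isotropic part drops out, and the inclusion form consists of the two divergence
  -- pairings and γ∇u₁·∇φ₁; the factor e₁/(e₀ − e₁) is γ⁻¹.
  · have hs : sEps e₁ 0 = 1 := by simp [sEps]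
    rw [e1, e2, contract_tensorA0, contract_tensorA1, hs]
    have hβ : e₁ * (1 / (e₀ - e₁)) = (e₀ / e₁ - 1)⁻¹ := by
      have : e₀ - e₁ ≠ 0 := by linarith
      field_simp
    have hβ' : (e₁ : ℂ) * ((1 / (e₀ - e₁) * 1 : ℝ) : ℂ) = (((e₀ / e₁ - 1)⁻¹ : ℝ) : ℂ) := by
      rw [← hβ]; push_cast; ring
    have hinv : (((e₀ / e₁ - 1)⁻¹ : ℝ) : ℂ) * ((e₀ / e₁ - 1 : ℝ) : ℂ) = 1 := by
      rw [← Complex.ofReal_mul, inv_mul_cancel₀ hγ, Complex.ofReal_one]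
    have alg : ∀ X D L G : ℂ, X + (((e₀ / e₁ - 1)⁻¹ : ℝ) : ℂ) * D =
        e₁ * (((1 / (2 * e₁) * 0 : ℝ) : ℂ) * L + ((1 / (e₀ - e₁) * 1 : ℝ) : ℂ) *
          (((1 - 1 : ℝ) : ℂ) * G + ((1 : ℝ) : ℂ) * D + ((e₀ / e₁ - 1 : ℝ) : ℂ) * X)) := by
      intro X D L G
      rw [mul_zero, sub_self, Complex.ofReal_zero, Complex.ofReal_one]
      linear_combination (-X) * hinv - (D + ((e₀ / e₁ - 1 : ℝ) : ℂ) * X) * hβ'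
    rw [Fin.sum_univ_two]
    exact alg _ _ _ _

theorem bloch_weight_eq (hsub : Q₀ ⊆ cell) (hopen : IsOpen Q₀)
    (hbd : volume (frontier Q₀) = 0) {θ : Plane} (u φ : H1Theta θ) :
    ∫ y in cell, (e₁ : ℂ) * ((∑ i, u.toFun i y * star (φ.toFun i y))
            + (((e₀ / e₁ - 1) * perChar Q₀ y : ℝ) : ℂ) * (u.toFun 0 y * star (φ.toFun 0 y))) =
      e₁ * ∫ y in cell, contract (weight e₀ e₁ Q₀ y) (u.val y) (φ.val y) := by
  rw [← integral_const_mul]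
  refine integral_congr_ae ?_
  filter_upwards [perChar_cases hsub hbd hopen] with y hy
  congr 1
  rcases hy with ⟨-, e1, e2⟩ | ⟨-, e1, e2⟩ <;>
    simp [weight, e1, e2, contract, dotProduct, Matrix.mulVec, Fin.sum_univ_two, H1Closure.val]
  ring

theorem mem_limitBlochSpectrum (he₁ : 0 < e₁) (he : e₁ < e₀) (hsub : Q₀ ⊆ cell) (hopen : IsOpen Q₀)
    (hbd : volume (frontier Q₀) = 0) {l : ℝ} {θ : Plane} {u : H1Theta θ} (hu : u ∈ V Q₀ θ)
    (hne : ¬ u.IsZero) (hsol : SolvesLimitProblem e₀ e₁ Q₀ l u) :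
    l ∈ limitBlochSpectrum e₀ e₁ Q₀ θ := by
  refine ⟨u, hu, hne, fun φ hφ => ?_⟩
  rw [bloch_form_eq he₁ he hsub hopen hbd hu hφ, bloch_weight_eq hsub hopen hbd, hsol φ hφ]
  ring

/-! ### Dependence on the quasimomentum modulo the lattice, and the compactness theorem -/

theorem smoothQuasiperiodic_sub_latticeVec (θ : Plane) (m : Fin 2 → ℤ) :
    smoothQuasiperiodic (θ - latticeVec m) = smoothQuasiperiodic θ := by
  ext φ
  have h : ∀ n, mode (θ - latticeVec m) (latticeVec n) = mode θ (latticeVec n) := fun n => by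
    have h1 := mode_add_left (θ - latticeVec m) (latticeVec m) (latticeVec n)
    rw [sub_add_cancel, mode_latticeVec, mul_one] at h1
    exact h1.symm
  rw [smoothQuasiperiodic_iff, smoothQuasiperiodic_iff]
  simp only [h]

theorem limitBlochSpectrum_congr {θ θ' : Plane}
    (h : smoothQuasiperiodic θ = smoothQuasiperiodic θ') :
    limitBlochSpectrum e₀ e₁ Q₀ θ = limitBlochSpectrum e₀ e₁ Q₀ θ' := by
  unfold limitBlochSpectrum V H1Theta
  rw [h]

/-- A limit of quasimomenta in [0,1)² may land on an excluded edge. A lattice translation brings it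
back into the cell without changing the quasiperiodicity class. -/
theorem limitBlochSpectrum_subset (θ : Plane) :
    limitBlochSpectrum e₀ e₁ Q₀ θ ⊆ limitSpectrum e₀ e₁ Q₀ := by
  obtain ⟨m, hm⟩ := exists_sub_mem_cell θ
  rw [← limitBlochSpectrum_congr (smoothQuasiperiodic_sub_latticeVec θ m)]
  exact Set.subset_biUnion_of_mem (u := fun θ => limitBlochSpectrum e₀ e₁ Q₀ θ) hm

theorem sum_norm_jet_sq {θ : Plane} (u : H1Theta θ) :
    ∑ i, ‖u.jet (.inl i)‖ ^ 2 = ∫ y in cell, ∑ i, ‖u.toFun i y‖ ^ 2 := by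
  rw [integral_finsetSum _ fun i _ => integrable_norm_sq (u.memLp_toFun i)]
  exact Finset.sum_congr rfl fun i _ => norm_toLp_sq (u.memLp_toFun i)

theorem sum_norm_jet_sub_sq {θ θ' : Plane} (u : H1Theta θ) (v : H1Theta θ') :
    ∑ i, ‖u.jet (.inl i) - v.jet (.inl i)‖ ^ 2 =
      ∫ y in cell, ∑ i, ‖u.toFun i y - v.toFun i y‖ ^ 2 := by
  have h : ∀ i, MemLp (fun y => u.toFun i y - v.toFun i y) 2 μQ := fun i =>
    (u.memLp_toFun i).sub (v.memLp_toFun i)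
  rw [integral_finsetSum _ fun i _ => integrable_norm_sq (h i)]
  refine Finset.sum_congr rfl fun i _ => ?_
  rw [H1Closure.jet_apply, H1Closure.jet_apply, ← MemLp.toLp_sub]
  exact norm_toLp_sq (h i)

/-- Compactness of normalised solutions of the rescaled cell problems. -/
theorem exists_limit_of_solvesCellProblem (he₁ : 0 < e₁) (he : e₁ < e₀) (hopen : IsOpen Q₀)
    (hne : Q₀.Nonempty) (hsub : Q₀ ⊆ cell) (hbd : volume (frontier Q₀) = 0)
    {ε l : ℕ → ℝ} {l₀ : ℝ} {θ : ℕ → Plane} {θ₀ : Plane} (u : ∀ n, H1Theta (θ n))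
    (hε0 : ∀ n, 0 < ε n) (hεlim : Tendsto ε atTop (𝓝 0)) (hcell : ∀ n, θ n ∈ cell)
    (hθ : Tendsto θ atTop (𝓝 θ₀)) (hl : Tendsto l atTop (𝓝 l₀))
    (hnorm : ∀ n, ∫ y in cell, ∑ i, ‖(u n).toFun i y‖ ^ 2 = 1)
    (hsol : ∀ n, SolvesCellProblem e₀ e₁ Q₀ (ε n) (l n) (u n)) :
    ∃ s : ℕ → ℕ, StrictMono s ∧ ∃ u₀ : H1Theta θ₀, u₀ ∈ V Q₀ θ₀ ∧ ¬ u₀.IsZero ∧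
      Tendsto (fun k => ∫ y in cell, ∑ i, ‖(u (s k)).toFun i y - u₀.toFun i y‖ ^ 2) atTop (𝓝 0) ∧
      (∀ (i j : Fin 2) (g : Plane → ℂ), MemLp g 2 (volume.restrict cell) →
        Tendsto (fun k => ∫ y in cell, (u (s k)).grad i j y * star (g y)) atTop
          (𝓝 (∫ y in cell, u₀.grad i j y * star (g y)))) ∧
      SolvesLimitProblem e₀ e₁ Q₀ l₀ u₀ := by
  -- Exact solutions are the case of residual zero.
  obtain ⟨s, u₀, hs, hV, hw, hstrong, hlim, hz⟩ := exists_limit_of_residual (δ := fun _ => 0) he₁ he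
    hopen hne hsub hbd u hε0 hεlim hcell hθ hl (fun n => by rw [sum_norm_jet_sq, hnorm])
    tendsto_const_nhds (fun n φ => by
      rw [integral_cellCoeff hopen.measurableSet, hsol n φ, sub_self]; simp)
  refine ⟨s, hs, u₀, hV, hz, ?_, fun i j g hg => ?_, hlim⟩
  · simp only [← sum_norm_jet_sub_sq]
    have h1 := fun i => ((hstrong i).sub_const (u₀.jet (.inl i))).norm.pow 2
    simpa using tendsto_finsetSum Finset.univ fun i _ => h1 i
  · have h1 := hw (.inr (i, j)) hg.toLp
    simp only [H1Closure.jet_apply, inner_toLp_toLp] at h1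
    exact h1

theorem isBounded_cell : Bornology.IsBounded cell :=
  isBounded_iff_forall_norm_le.2 ⟨2, fun _ hy => norm_le_two_of_mem_cell hy⟩

/-- Limits of spectral parameters of approximate Bloch waves belong to the limit spectrum. -/
theorem mem_limitSpectrum_of_residual (he₁ : 0 < e₁) (he : e₁ < e₀) (hopen : IsOpen Q₀)
    (hne : Q₀.Nonempty) (hsub : Q₀ ⊆ cell) (hbd : volume (frontier Q₀) = 0)
    {ε l δ : ℕ → ℝ} {l₀ : ℝ} {θ : ℕ → Plane} (u : ∀ n, H1Theta (θ n))
    (hε0 : ∀ n, 0 < ε n) (hεlim : Tendsto ε atTop (𝓝 0)) (hcell : ∀ n, θ n ∈ cell)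
    (hl : Tendsto l atTop (𝓝 l₀))
    (hnorm : ∀ n, ∑ i, ‖(u n).jet (.inl i)‖ ^ 2 = 1) (hδlim : Tendsto δ atTop (𝓝 0))
    (hres : ∀ n, ∀ φ : H1Theta (θ n), ‖∫ y in cell, sesq (cellCoeff e₀ e₁ Q₀ (ε n) (l n) y)
      (fun p => (u n).jetFun p y) (fun p => φ.jetFun p y)‖ ≤ δ n * ‖(u n).jet‖ * ‖φ.jet‖) :
    l₀ ∈ limitSpectrum e₀ e₁ Q₀ := by
  obtain ⟨θ₀, -, t, ht, hθ⟩ := tendsto_subseq_of_bounded isBounded_cell hcell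
  have htl := ht.tendsto_atTop
  obtain ⟨s, u₀, -, hV, -, -, hsol, hz⟩ := exists_limit_of_residual he₁ he hopen hne hsub hbd
    (fun n => u (t n)) (fun n => hε0 (t n)) (hεlim.comp htl) (fun n => hcell (t n)) hθ
    (hl.comp htl) (fun n => hnorm (t n)) (hδlim.comp htl) (fun n => hres (t n))
  exact limitBlochSpectrum_subset θ₀ (mem_limitBlochSpectrum he₁ he hsub hopen hbd hV hz hsol)

end HighContrast
end

noncomputable section

namespace HighContrast

open scoped ComplexConjugate ENNReal InnerProductSpace

/-! ### Approximate solutions in the spectrum of the problem in the plane -/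

/-- A symmetric form that is bounded below on a dense set of vectors of a closed subspace
defines a bijection of the subspace. -/
theorem solvable_of_bounded_below {H : Type*} [NormedAddCommGroup H] [InnerProductSpace ℂ H]
    [CompleteSpace H] (S : Submodule ℂ H) (M : H →L[ℂ] H) (hM : ∀ x y, ⟪M x, y⟫_ℂ = ⟪x, M y⟫_ℂ)
    {δ : ℝ} (hδ : 0 < δ)
    (h : ∀ w ∈ S, w ≠ 0 → ∃ v ∈ S, δ * ‖w‖ * ‖v‖ < ‖⟪v, M w⟫_ℂ‖) :
    (∀ F : H, ∃ w ∈ S.topologicalClosure, ∀ v ∈ S.topologicalClosure, ⟪v, M w⟫_ℂ = ⟪v, F⟫_ℂ) ∧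
    ∀ w ∈ S.topologicalClosure, (∀ v ∈ S.topologicalClosure, ⟪v, M w⟫_ℂ = 0) → w = 0 := by
  set W := S.topologicalClosure
  -- The compression of M to W represents the form restricted to W, so solving the variational
  -- problem amounts to inverting `T`.
  let T : W →L[ℂ] W := W.orthogonalProjectionOnto ∘L M ∘L W.subtypeL
  have hT : ∀ v w : W, ⟪v, T w⟫_ℂ = ⟪(v : H), M w⟫_ℂ := fun v w => by
    rw [Submodule.coe_inner]
    exact W.inner_orthogonalProjectionOnto_eq_of_mem_left v (M w)
  have hbelow : ∀ w : W, δ * ‖w‖ ≤ ‖T w‖ := by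
    have h1 : ∀ w ∈ S, ∀ hw : w ∈ W, δ * ‖w‖ ≤ ‖T ⟨w, hw⟩‖ := by
      intro w hwS hw
      by_cases h0 : w = 0
      · subst h0; simp
      obtain ⟨v, hv, hlt⟩ := h w hwS h0
      have hvW : v ∈ W := S.le_topologicalClosure hv
      rw [← hT ⟨v, hvW⟩ ⟨w, hw⟩] at hlt
      have h2 := hlt.le.trans (norm_inner_le_norm (𝕜 := ℂ) (⟨v, hvW⟩ : W) (T ⟨w, hw⟩))
      have hv0 : 0 < ‖v‖ := by
        rw [norm_pos_iff]
        rintro rfl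
        rw [hT] at hlt
        simp at hlt
      rw [mul_comm (‖(⟨v, hvW⟩ : W)‖)] at h2
      exact le_of_mul_le_mul_right h2 hv0
    intro w
    obtain ⟨x, hx, hlim⟩ := mem_closure_iff_seq_limit.1
      (show (w : H) ∈ closure (S : Set H) from w.2)
    have hxW : ∀ n, x n ∈ W := fun n => S.le_topologicalClosure (hx n)
    have hlim' : Tendsto (fun n => (⟨x n, hxW n⟩ : W)) atTop (𝓝 w) := tendsto_subtype_rng.2 hlim
    exact le_of_tendsto_of_tendsto (hlim'.norm.const_mul δ)
      (((T.continuous.tendsto w).comp hlim').norm) (.of_forall fun n => h1 _ (hx n) _)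
  have hzero : ∀ w : W, T w = 0 → w = 0 := fun w hw => by
    have h1 := hbelow w
    rw [hw, norm_zero] at h1
    exact norm_le_zero_iff.1 (nonpos_of_mul_nonpos_right h1 hδ)
  have hbij : Function.Bijective T := by
    -- The lower bound is the antilipschitz property. Density of the range follows from symmetry: a
    -- vector orthogonal to the range lies in the kernel of `T`, which is trivial.
    rw [ContinuousLinearMap.bijective_iff_dense_range_and_antilipschitz]
    refine ⟨?_, (δ⁻¹).toNNReal, T.antilipschitz_of_bound fun x => ?_⟩
    · rw [Submodule.topologicalClosure_eq_top_iff, Submodule.eq_bot_iff]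
      intro w hw
      refine hzero w (ext_inner_left ℂ fun v => ?_)
      rw [inner_zero_right, hT, ← hM, ← inner_conj_symm, ← hT, inner_eq_zero_symm.1, map_zero]
      exact hw (T v) ⟨v, rfl⟩
    · rw [Real.coe_toNNReal _ (inv_nonneg.2 hδ.le), le_inv_mul_iff₀ hδ]
      exact hbelow x
  refine ⟨fun F => ?_, fun w hw h0 => ?_⟩
  · obtain ⟨w, hw⟩ := hbij.2 (W.orthogonalProjectionOnto F)
    refine ⟨w, w.2, fun v hv => ?_⟩
    rw [← hT ⟨v, hv⟩ w, hw, Submodule.coe_inner]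
    exact W.inner_orthogonalProjectionOnto_eq_of_mem_left ⟨v, hv⟩ F
  · have h1 := hzero ⟨w, hw⟩ (ext_inner_left ℂ fun v => by
      rw [inner_zero_right, hT]; exact h0 v v.2)
    exact congrArg Subtype.val h1

/-! ### The form in the plane and its approximate solutions -/

theorem sesq_symm {m : JetIdx → JetIdx → ℝ} (hm : ∀ p q, m p q = m q p) (J J' : JetIdx → ℂ) :
    conj (sesq m J J') = sesq m J' J := by
  simp only [sesq, map_sum, map_mul, Complex.conj_ofReal, Complex.conj_conj]
  rw [Finset.sum_comm]
  refine Finset.sum_congr rfl fun p _ => Finset.sum_congr rfl fun q _ => ?_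
  rw [hm q p]; ring

theorem opM_symm {μ : Measure Plane} {m : Plane → JetIdx → JetIdx → ℝ} (hm : BddCoeff m)
    (hsymm : ∀ y p q, m y p q = m y q p) (U Φ : JetSpace μ) :
    ⟪opM (fun p q => toLinf μ fun y => (m y p q : ℂ)) U, Φ⟫_ℂ =
      ⟪U, opM (fun p q => toLinf μ fun y => (m y p q : ℂ)) Φ⟫_ℂ := by
  have hU : ∀ U : JetSpace μ, toJet (fun p => U p) (fun p => Lp.memLp (U p)) = U := fun U => by
    ext p : 1
    exact Lp.toLp_coeFn (U p) (Lp.memLp (U p))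
  rw [← hU U, ← hU Φ, ← inner_conj_symm, inner_opM_toJet hm, inner_opM_toJet hm, ← integral_conj]
  simp only [sesq_symm (hsymm _)]

theorem testClass_smoothCompactSupport : TestClass smoothCompactSupport Set.univ where
  zero_mem := ⟨contDiff_const, HasCompactSupport.zero⟩
  add_mem f hf g hg := ⟨hf.1.add hg.1, hf.2.add hg.2⟩
  smul_mem c f hf := ⟨contDiff_const.mul hf.1, hf.2.mul_left⟩
  contDiff f hf := hf.1
  memLp f hf := by
    rw [Measure.restrict_univ]
    exact hf.1.continuous.memLp_of_hasCompactSupport hf.2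
  memLp_pderiv f hf j := by
    rw [Measure.restrict_univ]
    exact (continuous_pderiv hf.1 j).memLp_of_hasCompactSupport (hf.2.fderiv_apply ℝ _)

variable {e₀ e₁ : ℝ} {Q₀ : Set Plane}

theorem integral_planeCoeff (hQ₀ : MeasurableSet Q₀) (ε l : ℝ) (u φ : H1Plane) :
    ∫ x in Set.univ, sesq (planeCoeff e₀ e₁ Q₀ ε l (ε⁻¹ • x)) (fun p => u.jetFun p x)
      (fun p => φ.jetFun p x) =
      (∫ x, contract (planeTensor e₀ e₁ Q₀ ε (ε⁻¹ • x)) (u.gradVec x) (φ.gradVec x)) -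
        l * ∫ x, contract (weight e₀ e₁ Q₀ (ε⁻¹ • x)) (u.val x) (φ.val x) := by
  have hg : Measurable fun x : Plane => ε⁻¹ • x := measurable_const_smul _
  refine (integral_sesq_phase_comp hQ₀ hg _ _ _ u.memLp_jetFun φ.memLp_jetFun).trans ?_
  simp only [Measure.restrict_univ]
  refine congrArg₂ (fun a b : ℂ => a - b) (integral_congr_ae (.of_forall fun y => ?_)) rfl
  simp only [planeTensor, contract_add, contract_smul, H1Closure.gradVec_eq]
  push_cast; ring

theorem block_symm {A : Matrix (Fin 4) (Fin 4) ℝ} {R : Matrix (Fin 2) (Fin 2) ℝ} (hA : A.IsSymm)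
    (hR : R.IsSymm) (p q : JetIdx) : block A R p q = block A R q p := by
  match p, q with
  | .inl i, .inl j => exact hR.apply j i
  | .inr a, .inr b => exact hA.apply _ _
  | .inl i, .inr b => rfl
  | .inr a, .inl j => rfl

theorem planeCoeff_symm (ε l : ℝ) (y : Plane) (p q : JetIdx) :
    planeCoeff e₀ e₁ Q₀ ε l y p q = planeCoeff e₀ e₁ Q₀ ε l y q p := by
  have h1 : (tensorA1 e₁ ε).IsSymm := by
    ext i j; fin_cases i <;> fin_cases j <;> simp [tensorA1]
  have h0 : (tensorA0 e₀ e₁ ε).IsSymm := by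
    ext i j; fin_cases i <;> fin_cases j <;> simp [tensorA0]
  have hR1 : (!![1, 0; 0, 1] : Matrix (Fin 2) (Fin 2) ℝ).IsSymm := by
    ext i j; fin_cases i <;> fin_cases j <;> simp
  have hR0 : (inclWeight e₀ e₁).IsSymm := by
    ext i j; fin_cases i <;> fin_cases j <;> simp [inclWeight]
  rw [planeCoeff, phaseCoeff, phaseCoeff, block_symm h1 (hR1.smul _),
    block_symm (h0.smul _) (hR0.smul _)]

theorem bddCoeff_planeCoeff (hQ₀ : MeasurableSet Q₀) (ε l : ℝ) :
    BddCoeff fun x => planeCoeff e₀ e₁ Q₀ ε l (ε⁻¹ • x) :=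
  BddCoeff.comp (bddCoeff_phaseCoeff hQ₀ _ _) (measurable_const_smul _)

/-- Otherwise the form would be bounded below, in the inf–sup sense, on smooth compactly supported
fields, and `solvable_of_bounded_below` would make the operator minus l bijective. The residual is
measured in the dual of H¹, so no regularity of the operator domain is needed. -/
theorem exists_planeWave (hQ₀ : MeasurableSet Q₀) {ε l : ℝ} (hl : l ∈ planeSpectrum e₀ e₁ Q₀ ε)
    {δ : ℝ} (hδ : 0 < δ) :
    ∃ w ∈ H1Closure.smoothJets testClass_smoothCompactSupport, w ≠ 0 ∧
      ∀ v ∈ H1Closure.smoothJets testClass_smoothCompactSupport,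
        ‖⟪v, opM (fun p q => toLinf _ fun x => (planeCoeff e₀ e₁ Q₀ ε l (ε⁻¹ • x) p q : ℂ)) w⟫_ℂ‖ ≤
          δ * ‖w‖ * ‖v‖ := by
  have hm := bddCoeff_planeCoeff (e₀ := e₀) (e₁ := e₁) hQ₀ ε l
  have hg : Measurable fun x : Plane => ε⁻¹ • x := measurable_const_smul _
  by_contra! hcon
  obtain ⟨hsurj, hinj⟩ := solvable_of_bounded_below
    (H1Closure.smoothJets testClass_smoothCompactSupport)
    (opM fun p q => toLinf _ fun x => (planeCoeff e₀ e₁ Q₀ ε l (ε⁻¹ • x) p q : ℂ))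
    (opM_symm hm fun y => planeCoeff_symm ε l _) hδ hcon
  refine hl ⟨fun f hf => ?_, fun u hu i => ?_⟩
  · have hf' : ∀ p, MemLp ((Sum.elim f fun _ => 0 : JetIdx → Plane → ℂ) p) 2
        (volume.restrict Set.univ) := by
      rw [Measure.restrict_univ]
      rintro (i | ij)
      · exact hf i
      · exact MemLp.zero
    -- The right-hand side ρf is written as the same kind of form, with zero gradient block and
    -- parameter −1, since the value block carries the factor `-l`.
    have hm' := (bddCoeff_phaseCoeff hQ₀ (block 0 ((- (-1 : ℝ)) • !![1, 0; 0, 1]))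
      (block 0 ((-(-1 : ℝ)) • inclWeight e₀ e₁))).comp hg
    obtain ⟨w, hwW, hw⟩ := hsurj (opM (fun p q => toLinf _ fun x =>
      (phaseCoeff Q₀ (block 0 ((- (-1 : ℝ)) • !![1, 0; 0, 1]))
        (block 0 ((-(-1 : ℝ)) • inclWeight e₀ e₁)) (ε⁻¹ • x) p q : ℂ)) (toJet _ hf'))
    obtain ⟨u, rfl⟩ := (H1Closure.mem_closure_smoothJets _).1 hwW
    refine ⟨u, fun φ => ?_⟩
    have h1 := hw φ.jet ((H1Closure.mem_closure_smoothJets _).2 ⟨φ, rfl⟩)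
    rw [H1Closure.jet, H1Closure.jet, inner_opM_toJet hm, inner_opM_toJet hm',
      integral_planeCoeff hQ₀, integral_sesq_phase_comp hQ₀ hg _ _ _ hf' φ.memLp_jetFun] at h1
    rw [h1]
    simp [contract_zero]
    rfl
  · have h1 := hinj u.jet ((H1Closure.mem_closure_smoothJets _).2 ⟨u, rfl⟩) fun v hv => by
      obtain ⟨φ, rfl⟩ := (H1Closure.mem_closure_smoothJets _).1 hv
      rw [H1Closure.jet, H1Closure.jet, inner_opM_toJet hm, integral_planeCoeff hQ₀, hu φ]
      simp [contract]
    have h2 := u.coeFn_jet (.inl i)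
    rw [h1] at h2
    filter_upwards [h2, Lp.coeFn_zero ℂ 2 (volume.restrict Set.univ)] with y h3 h4
    exact h3.symm.trans h4

end HighContrast
end

noncomputable section

namespace HighContrast

open scoped ComplexConjugate ENNReal InnerProductSpace

/-! ### Rescaling -/

variable {e₀ e₁ : ℝ} {Q₀ : Set Plane}

theorem pderiv_comp_smul {φ : Plane → ℂ} (hφ : ContDiff ℝ ∞ φ) (c : ℝ) (j : Fin 2) (y : Plane) :
    pderiv j (fun y => φ (c • y)) y = c * pderiv j φ (c • y) := by
  have h1 : HasFDerivAt (fun y : Plane => c • y) (c • ContinuousLinearMap.id ℝ Plane) y :=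
    (hasFDerivAt_id y).const_smul c
  have h2 := ((hφ.differentiable (by simp)) (c • y)).hasFDerivAt.comp y h1
  have h3 : fderiv ℝ (fun y => φ (c • y)) y =
      (fderiv ℝ φ (c • y)).comp (c • ContinuousLinearMap.id ℝ Plane) := h2.fderiv
  rw [pderiv, h3]
  simp [pderiv]

/-- The scaling factors of the entries of a jet. -/
def jetScale (c : ℝ) : JetIdx → ℝ := Sum.elim (fun _ => 1) fun _ => c

theorem smoothJet_comp_smul {φ : Fin 2 → Plane → ℂ} (hφ : ∀ i, ContDiff ℝ ∞ (φ i)) (c : ℝ)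
    (p : JetIdx) (y : Plane) :
    smoothJet (fun i y => φ i (c • y)) p y = jetScale c p * smoothJet φ p (c • y) := by
  match p with
  | .inl i => simp [smoothJet, jetScale]
  | .inr ij => exact pderiv_comp_smul (hφ _) c _ y

theorem comp_smul_mem_smoothCompactSupport {φ : Plane → ℂ} (hφ : φ ∈ smoothCompactSupport) {c : ℝ}
    (hc : c ≠ 0) : (fun y => φ (c • y)) ∈ smoothCompactSupport :=
  ⟨hφ.1.comp (contDiff_const_smul c), hφ.2.comp_homeomorph (Homeomorph.smulOfNeZero c hc)⟩

/-- The jet of a smooth compactly supported field. -/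
abbrev planeJet (φ : Fin 2 → Plane → ℂ) (hφ : ∀ i, φ i ∈ smoothCompactSupport) :
    JetSpace (volume.restrict Set.univ) :=
  (H1Closure.ofSmooth testClass_smoothCompactSupport φ hφ).jet

theorem memLp_smoothJet {S : Set (Plane → ℂ)} {Ω : Set Plane} (hS : TestClass S Ω)
    {φ : Fin 2 → Plane → ℂ} (hφ : ∀ i, φ i ∈ S) (p : JetIdx) :
    MemLp (smoothJet φ p) 2 (volume.restrict Ω) :=
  (H1Closure.ofSmooth hS φ hφ).memLp_jetFun p

theorem inner_opM_ofSmooth {S : Set (Plane → ℂ)} {Ω : Set Plane} (hS : TestClass S Ω)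
    {m : Plane → JetIdx → JetIdx → ℝ} (hm : BddCoeff m) {φ ψ : Fin 2 → Plane → ℂ}
    (hφ : ∀ i, φ i ∈ S) (hψ : ∀ i, ψ i ∈ S) :
    ⟪(H1Closure.ofSmooth hS ψ hψ).jet, opM (fun p q => toLinf _ fun y => (m y p q : ℂ))
      (H1Closure.ofSmooth hS φ hφ).jet⟫_ℂ =
      ∫ y in Ω, sesq (m y) (fun p => smoothJet φ p y) (fun p => smoothJet ψ p y) :=
  inner_opM_toJet hm _ _

theorem norm_planeJet_sq {φ : Fin 2 → Plane → ℂ} (hφ : ∀ i, φ i ∈ smoothCompactSupport) :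
    ‖planeJet φ hφ‖ ^ 2 = ∑ p, ∫ y, ‖smoothJet φ p y‖ ^ 2 := by
  rw [planeJet, H1Closure.jet, norm_toJet_sq]
  simp only [Measure.restrict_univ]
  rfl

theorem integral_eq_smul_comp_smul {E : Type*} [NormedAddCommGroup E] [NormedSpace ℝ E]
    (f : Plane → E) {c : ℝ} (hc : 0 < c) : ∫ x, f x = c ^ 2 • ∫ y, f (c • y) := by
  rw [Measure.integral_comp_smul_of_nonneg volume f c (hR := hc.le)]
  simp only [finrank_euclideanSpace, Fintype.card_fin, smul_smul]
  rw [mul_inv_cancel₀ (by positivity), one_smul]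

/-- The change of variables gives c² on the values; on the derivatives the Jacobian cancels against
the chain rule and gives 1. Both are at most 1 + c². -/
theorem norm_planeJet_le_comp_smul {φ : Fin 2 → Plane → ℂ} (hφ : ∀ i, φ i ∈ smoothCompactSupport)
    {c : ℝ} (hc : 0 < c) : ‖planeJet φ hφ‖ ^ 2 ≤
      (1 + c ^ 2) * ‖planeJet (fun i y => φ i (c • y))
        (fun i => comp_smul_mem_smoothCompactSupport (hφ i) hc.ne')‖ ^ 2 := by
  rw [norm_planeJet_sq, norm_planeJet_sq, Finset.mul_sum]
  refine Finset.sum_le_sum fun p _ => ?_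
  rw [integral_eq_smul_comp_smul (fun y => ‖smoothJet φ p y‖ ^ 2) hc, smul_eq_mul]
  have h1 : ∫ y, ‖smoothJet (fun i y => φ i (c • y)) p y‖ ^ 2 =
      jetScale c p ^ 2 * ∫ y, ‖smoothJet φ p (c • y)‖ ^ 2 := by
    rw [← integral_const_mul]
    refine integral_congr_ae (.of_forall fun y => ?_)
    simp only [smoothJet_comp_smul (fun i => (hφ i).1), norm_mul, mul_pow, Complex.norm_real,
      Real.norm_eq_abs, sq_abs]
  rw [h1, ← mul_assoc]
  refine mul_le_mul_of_nonneg_right ?_ (integral_nonneg fun _ => by positivity)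
  match p with
  | .inl i => simp [jetScale]
  | .inr ij => simp only [jetScale, Sum.elim_inr]; nlinarith [sq_nonneg (c ^ 2)]

/-- The tensor in the plane is ε² times that of the cell, and each of the two gradients takes one
factor ε; the value block is unchanged. -/
theorem sesq_planeCoeff {ε : ℝ} (hε : ε ≠ 0) (l : ℝ) (y : Plane) (J J' : JetIdx → ℂ) :
    sesq (planeCoeff e₀ e₁ Q₀ ε l y) J J' = sesq (cellCoeff e₀ e₁ Q₀ ε l y)
      (fun p => jetScale ε p * J p) (fun p => jetScale ε p * J' p) := by
  have hcol : ∀ (A : Matrix (Fin 4) (Fin 4) ℝ), contract A (gradCol fun p => jetScale ε p * J p)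
      (gradCol fun p => jetScale ε p * J' p) = (ε : ℂ) ^ 2 * contract A (gradCol J) (gradCol J') := by
    intro A
    simp only [contract, gradCol, jetScale, dotProduct, Matrix.mulVec, Fin.sum_univ_four,
      Matrix.map_apply, Pi.star_apply, Sum.elim_inr]
    simp
    ring
  have hε' : (ε : ℂ) ≠ 0 := Complex.ofReal_ne_zero.2 hε
  rw [planeCoeff, cellCoeff, sesq_phaseCoeff, sesq_phaseCoeff, sesq_block, sesq_block, sesq_block,
    sesq_block]
  simp only [contract_smul, hcol]
  simp only [jetScale, Sum.elim_inl, Complex.ofReal_one, one_mul]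
  push_cast
  field_simp

/-- In the spectrum there are approximate solutions of the rescaled problem in the plane. -/
theorem exists_planeWave_rescaled (hQ₀ : MeasurableSet Q₀) {ε l : ℝ} (hε : 0 < ε)
    (hl : l ∈ planeSpectrum e₀ e₁ Q₀ ε) {δ : ℝ} (hδ : 0 < δ) :
    ∃ (w : Fin 2 → Plane → ℂ) (hw : ∀ i, w i ∈ smoothCompactSupport), planeJet w hw ≠ 0 ∧
      ∀ (ψ : Fin 2 → Plane → ℂ) (hψ : ∀ i, ψ i ∈ smoothCompactSupport),
        ‖∫ y, sesq (cellCoeff e₀ e₁ Q₀ ε l y) (fun p => smoothJet w p y) (fun p => smoothJet ψ p y)‖ ≤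
          δ * ‖planeJet w hw‖ * ‖planeJet ψ hψ‖ := by
  -- Accounts for the Jacobian ε² of the integral and for the loss √(1 + ε²) in each of the two
  -- norms.
  have hδ' : 0 < δ * ε ^ 2 / (1 + ε ^ 2) := by positivity
  obtain ⟨_, ⟨w, hw, rfl⟩, hw0, hres⟩ := exists_planeWave hQ₀ hl hδ'
  have hsc : ∀ {φ : Fin 2 → Plane → ℂ} (hφ : ∀ i, φ i ∈ smoothCompactSupport), ‖planeJet φ hφ‖ ≤
      √(1 + ε ^ 2) * ‖planeJet (fun i y => φ i (ε • y))
        (fun i => comp_smul_mem_smoothCompactSupport (hφ i) hε.ne')‖ := fun hφ => by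
    have h1 := Real.sqrt_le_sqrt (norm_planeJet_le_comp_smul hφ hε)
    rwa [Real.sqrt_sq (norm_nonneg _), Real.sqrt_mul (by positivity),
      Real.sqrt_sq (norm_nonneg _)] at h1
  refine ⟨fun i y => w i (ε • y), fun i => comp_smul_mem_smoothCompactSupport (hw i) hε.ne',
    fun h0 => hw0 ?_, fun ψ hψ => ?_⟩
  · have h1 := hsc hw
    rw [h0, norm_zero, mul_zero] at h1
    exact norm_le_zero_iff.1 h1
  · set ψ' : Fin 2 → Plane → ℂ := fun i x => ψ i (ε⁻¹ • x) with hψ'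
    have hψ'S : ∀ i, ψ' i ∈ smoothCompactSupport := fun i =>
      comp_smul_mem_smoothCompactSupport (hψ i) (inv_ne_zero hε.ne')
    have hback : (fun i y => ψ' i (ε • y)) = ψ := by
      funext i y
      simp [hψ', smul_smul, inv_mul_cancel₀ hε.ne']
    have h1 := hres _ ⟨ψ', hψ'S, rfl⟩
    rw [inner_opM_ofSmooth _ (bddCoeff_planeCoeff hQ₀ ε l)] at h1
    have h2 : ∫ x in Set.univ, sesq (planeCoeff e₀ e₁ Q₀ ε l (ε⁻¹ • x)) (fun p => smoothJet w p x)
        (fun p => smoothJet ψ' p x) = (ε : ℂ) ^ 2 * ∫ y, sesq (cellCoeff e₀ e₁ Q₀ ε l y)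
        (fun p => smoothJet (fun i y => w i (ε • y)) p y) (fun p => smoothJet ψ p y) := by
      rw [Measure.restrict_univ, integral_eq_smul_comp_smul _ hε, Complex.real_smul]
      push_cast
      congr 1
      refine integral_congr_ae (.of_forall fun y => ?_)
      simp only [smul_smul, inv_mul_cancel₀ hε.ne', one_smul]
      rw [sesq_planeCoeff hε.ne']
      simp only [← smoothJet_comp_smul (fun i => (hw i).1), ← smoothJet_comp_smul (fun i => (hψ'S i).1)]
      rw [hback]
    rw [h2, norm_mul, norm_pow, Complex.norm_real, Real.norm_of_nonneg hε.le] at h1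
    have h3 := hsc hψ'S
    simp only [hback] at h3
    have h4 : ε ^ 2 * ‖∫ y, sesq (cellCoeff e₀ e₁ Q₀ ε l y)
        (fun p => smoothJet (fun i y => w i (ε • y)) p y) (fun p => smoothJet ψ p y)‖ ≤
        δ * ε ^ 2 / (1 + ε ^ 2) * (√(1 + ε ^ 2) * ‖planeJet _
          (fun i => comp_smul_mem_smoothCompactSupport (hw i) hε.ne')‖) *
          (√(1 + ε ^ 2) * ‖planeJet ψ hψ‖) := by
      refine h1.trans ?_
      exact mul_le_mul (mul_le_mul_of_nonneg_left (hsc hw) hδ'.le) h3 (norm_nonneg _) (by positivity)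
    have h5 : √(1 + ε ^ 2) * √(1 + ε ^ 2) = 1 + ε ^ 2 := Real.mul_self_sqrt (by positivity)
    set a := ‖planeJet _ (fun i => comp_smul_mem_smoothCompactSupport (hw i) hε.ne')‖
    set b := ‖planeJet ψ hψ‖
    refine le_of_mul_le_mul_left (h4.trans_eq ?_) (by positivity : 0 < ε ^ 2)
    calc δ * ε ^ 2 / (1 + ε ^ 2) * (√(1 + ε ^ 2) * a) * (√(1 + ε ^ 2) * b)
        = δ * ε ^ 2 / (1 + ε ^ 2) * (√(1 + ε ^ 2) * √(1 + ε ^ 2)) * (a * b) := by ring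
      _ = ε ^ 2 * (δ * a * b) := by rw [h5]; field_simp

end HighContrast
end

noncomputable section

namespace HighContrast

open scoped ComplexConjugate ENNReal InnerProductSpace

/-! ### The discrete Bloch transform -/

/-- The exponential `exp(2πi t)`. -/
def unitExp (t : ℝ) : ℂ := Complex.exp (2 * Real.pi * Complex.I * t)

/-- Geometric sum over an N-th root of unity. The offset `a` only adds a common phase; it serves
both the quasimomenta, with offset 0, and the translates numbered from −K, with offset K. -/
theorem sum_unitExp {N : ℕ} (m m' : Fin N) (a : ℝ) :
    ∑ k : Fin N, unitExp (((m : ℝ) - m') * (k - a) / N) = if m = m' then (N : ℂ) else 0 := by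
  have hN : 0 < N := m.pos
  have hN' : (N : ℂ) ≠ 0 := Nat.cast_ne_zero.2 hN.ne'
  split_ifs with h
  · subst h
    simp [unitExp]
  · set z := unitExp (((m : ℝ) - m') / N) with hz
    have h1 : ∀ k : Fin N, unitExp (((m : ℝ) - m') * (k - a) / N) =
        unitExp (-(((m : ℝ) - m') * a / N)) * z ^ (k : ℕ) := fun k => by
      rw [hz]
      simp only [unitExp, ← Complex.exp_nat_mul, ← Complex.exp_add]
      congr 1
      push_cast; ring
    simp_rw [h1, ← Finset.mul_sum]
    rw [Fin.sum_univ_eq_sum_range (fun k => z ^ k), geom_sum_eq]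
    · have h2 : z ^ N = 1 := by
        rw [hz, unitExp, ← Complex.exp_nat_mul, Complex.exp_eq_one_iff]
        refine ⟨(m : ℤ) - m', ?_⟩
        push_cast
        field_simp
      rw [h2]; simp
    · intro h2
      rw [hz, unitExp, Complex.exp_eq_one_iff] at h2
      obtain ⟨n, hn⟩ := h2
      have h3 : (((m : ℝ) - m') / N : ℝ) = n := by
        have h4 : (((((m : ℝ) - m') / N : ℝ)) : ℂ) = n := by
          refine mul_left_cancel₀ Complex.two_pi_I_ne_zero ?_
          rw [hn]; ring
        exact_mod_cast h4
      rw [div_eq_iff (by positivity)] at h3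
      have h5 : (m : ℤ) - m' = n * N := by exact_mod_cast h3
      have h6 : n = 0 := by
        have h7 : |(m : ℤ) - m'| < N := by
          rw [abs_lt]
          have := m.isLt
          have := m'.isLt
          omega
        rw [h5, abs_mul, Nat.abs_cast] at h7
        have h8 : |n| < 1 := by
          by_contra! hc
          nlinarith [(Nat.cast_pos (α := ℤ)).2 hN]
        exact Int.abs_lt_one_iff.1 h8
      rw [h6, zero_mul] at h5
      exact h (Fin.ext (by omega))

/-- The quasimomenta in `N⁻¹ ℤ² ∩ [0,1)²`. -/
def gridFreq {N : ℕ} (f : Fin 2 → Fin N) : Plane := WithLp.toLp 2 fun j => (f j : ℝ) / N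

/-- The integer points of the square `[-K, K)²`. -/
def gridShift {K : ℕ} (i : Fin 2 → Fin (2 * K)) : Fin 2 → ℤ := fun j => (i j : ℤ) - K

/-- The matrix of the discrete Bloch transform. -/
def gridMode {K : ℕ} (f i : Fin 2 → Fin (2 * K)) : ℂ := mode (gridFreq f) (latticeVec (gridShift i))

theorem gridFreq_mem_cell {N : ℕ} (f : Fin 2 → Fin N) : gridFreq f ∈ cell := fun j => by
  have h : (0 : ℝ) < N := Nat.cast_pos.2 (f j).pos
  refine ⟨by simp only [gridFreq]; positivity, ?_⟩
  simp only [gridFreq]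
  rw [div_lt_one h]
  exact_mod_cast (f j).isLt

theorem gridShift_injective {K : ℕ} : Function.Injective (gridShift (K := K)) := fun i i' h => by
  funext j
  have := congrFun h j
  simp only [gridShift] at this
  exact Fin.ext (by omega)

theorem conj_unitExp (t : ℝ) : conj (unitExp t) = unitExp (-t) := by
  rw [unitExp, unitExp, ← Complex.exp_conj]
  congr 1
  simp only [map_mul, Complex.conj_ofReal, Complex.conj_I, map_ofNat]
  push_cast; ring

theorem unitExp_add (s t : ℝ) : unitExp (s + t) = unitExp s * unitExp t := by
  simp only [unitExp, ← Complex.exp_add]; congr 1; push_cast; ring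

theorem mode_eq_prod (ξ y : Plane) : mode ξ y = ∏ j, unitExp (ξ j * y j) := by
  rw [Fin.prod_univ_two, ← unitExp_add, mode, Fin.sum_univ_two]; rfl

theorem sum_prod_grid {N : ℕ} (m m' : Fin 2 → Fin N) (a : ℝ) :
    ∑ k : Fin 2 → Fin N, ∏ j, unitExp (((m j : ℝ) - m' j) * (k j - a) / N) =
      if m = m' then (N : ℂ) ^ 2 else 0 := by
  rw [← Fintype.prod_sum (fun j (k : Fin N) => unitExp (((m j : ℝ) - m' j) * (k - a) / N))]
  simp only [sum_unitExp, Fin.prod_univ_two, funext_iff, Fin.forall_fin_two]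
  split_ifs <;> simp_all [pow_two]

/-- Orthogonality in both indices is needed: summing over quasimomenta gives Parseval for the
transform, and summing over translates (`sum_gridMode_shift`) bounds superposed test fields. The
double conjugate matches the shape required by `sum_norm_sq_of_orthogonal`. -/
theorem sum_gridMode_freq {K : ℕ} (i i' : Fin 2 → Fin (2 * K)) :
    ∑ f, conj (gridMode f i) * conj (conj (gridMode f i')) =
      if i = i' then ((((2 * K : ℕ) : ℝ) ^ 2 : ℝ) : ℂ) else 0 := by
  have h := sum_prod_grid i' i 0
  simp only [@eq_comm _ i' i] at h
  rw [Complex.ofReal_pow, Complex.ofReal_natCast, ← h]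
  refine Finset.sum_congr rfl fun f _ => ?_
  rw [Complex.conj_conj, gridMode, gridMode, mode_eq_prod, mode_eq_prod, map_prod, ← Finset.prod_mul_distrib]
  refine Finset.prod_congr rfl fun j _ => ?_
  rw [conj_unitExp, ← unitExp_add]
  congr 1
  simp only [gridFreq, gridShift, latticeVec_apply]
  push_cast; ring

theorem sum_gridMode_shift {K : ℕ} (f g : Fin 2 → Fin (2 * K)) :
    ∑ i, gridMode f i * conj (gridMode g i) = if f = g then ((((2 * K : ℕ) : ℝ) ^ 2 : ℝ) : ℂ) else 0 := by
  rw [Complex.ofReal_pow, Complex.ofReal_natCast, ← sum_prod_grid f g K]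
  refine Finset.sum_congr rfl fun i _ => ?_
  rw [gridMode, gridMode, mode_eq_prod, mode_eq_prod, map_prod, ← Finset.prod_mul_distrib]
  refine Finset.prod_congr rfl fun j _ => ?_
  rw [conj_unitExp, ← unitExp_add]
  congr 1
  simp only [gridFreq, gridShift, latticeVec_apply]
  push_cast; ring

/-- Parseval's identity for matrices with orthogonal columns. -/
theorem sum_norm_sq_of_orthogonal {ι κ : Type*} [Fintype ι] [Fintype κ] [DecidableEq ι]
    {c : κ → ι → ℂ} {A : ℝ} (h : ∀ i i', ∑ f, c f i * conj (c f i') = if i = i' then (A : ℂ) else 0)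
    (x : ι → ℂ) : ∑ f, ‖∑ i, c f i * x i‖ ^ 2 = A * ∑ i, ‖x i‖ ^ 2 := by
  have h1 : ((∑ f, ‖∑ i, c f i * x i‖ ^ 2 : ℝ) : ℂ) =
      ∑ i, ∑ i', (x i * conj (x i')) * ∑ f, c f i * conj (c f i') := by
    push_cast
    simp_rw [← Complex.mul_conj', map_sum, map_mul, Finset.sum_mul_sum, Finset.mul_sum]
    rw [Finset.sum_comm]
    refine Finset.sum_congr rfl fun i _ => ?_
    rw [Finset.sum_comm]
    exact Finset.sum_congr rfl fun i' _ => Finset.sum_congr rfl fun f _ => by ring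
  have h2 : ((∑ f, ‖∑ i, c f i * x i‖ ^ 2 : ℝ) : ℂ) = ((A * ∑ i, ‖x i‖ ^ 2 : ℝ) : ℂ) := by
    rw [h1]
    simp only [h, mul_ite, mul_zero, Finset.sum_ite_eq, Finset.mem_univ, if_true]
    push_cast
    rw [Finset.mul_sum]
    exact Finset.sum_congr rfl fun i _ => by rw [Complex.mul_conj', mul_comm]
  exact_mod_cast h2

/-! ### The Bloch transform of functions with bounded support -/

/-- The Bloch transform `∑ₙ exp(-2πi θ·n) w(y + n)`. -/
def bloch (θ : Plane) (w : Plane → ℂ) (y : Plane) : ℂ :=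
  ∑' n : Fin 2 → ℤ, conj (mode θ (latticeVec n)) * w (y + latticeVec n)

theorem bloch_add_latticeVec (θ : Plane) (w : Plane → ℂ) (y : Plane) (m : Fin 2 → ℤ) :
    bloch θ w (y + latticeVec m) = mode θ (latticeVec m) * bloch θ w y := by
  rw [bloch, bloch, ← tsum_mul_left, ← (Equiv.subRight m).tsum_eq]
  refine tsum_congr fun n => ?_
  rw [Equiv.subRight_apply, latticeVec_sub, sub_eq_add_neg (latticeVec n), mode_add_right, map_mul,
    ← sub_eq_add_neg, add_assoc, add_sub_cancel]
  have h : conj (mode θ (-latticeVec m)) = mode θ (latticeVec m) := by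
    have h1 := mode_add_right θ (latticeVec m) (-latticeVec m)
    rw [add_neg_cancel] at h1
    have h2 : mode θ 0 = 1 := by simp [mode]
    have h3 := mode_mul_conj θ (-latticeVec m)
    rw [h2] at h1
    refine mul_left_cancel₀ (mode_ne_zero θ (-latticeVec m)) ?_
    rw [h3, mul_comm, h1]
  rw [h]; ring

theorem finite_norm_latticeVec_le (r : ℝ) : {n : Fin 2 → ℤ | ‖latticeVec n‖ ≤ r}.Finite := by
  refine (Set.Finite.pi' fun _ : Fin 2 => Set.finite_Icc (-⌈r⌉) ⌈r⌉).subset fun n hn j => ?_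
  have h1 : |(n j : ℝ)| ≤ ‖latticeVec n‖ := PiLp.norm_apply_le (latticeVec n) j
  have h2 : |(n j : ℝ)| ≤ ⌈r⌉ := (h1.trans hn).trans (Int.le_ceil r)
  rw [abs_le] at h2
  exact ⟨by exact_mod_cast h2.1, by exact_mod_cast h2.2⟩

/-- On bounded sets the Bloch transform is a finite sum. -/
theorem bloch_eq_sum {R r : ℝ} {w : Plane → ℂ} (hw : ∀ y, R ≤ ‖y‖ → w y = 0) (θ : Plane) {y : Plane}
    (hy : ‖y‖ ≤ r) : bloch θ w y = ∑ n ∈ (finite_norm_latticeVec_le (R + r)).toFinset,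
      conj (mode θ (latticeVec n)) * w (y + latticeVec n) := by
  refine tsum_eq_sum fun n hn => ?_
  rw [Set.Finite.mem_toFinset, Set.mem_ofPred_eq, not_le] at hn
  rw [hw, mul_zero]
  have h1 := norm_sub_norm_le (latticeVec n) (-y)
  rw [norm_neg, sub_neg_eq_add, add_comm (latticeVec n)] at h1
  linarith

theorem pderiv_eq_zero_of_norm {R : ℝ} {w : Plane → ℂ} (hw : ∀ y, R < ‖y‖ → w y = 0)
    (j : Fin 2) (y : Plane) (hy : R < ‖y‖) : pderiv j w y = 0 := by
  have h1 : w =ᶠ[𝓝 y] fun _ => 0 := by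
    filter_upwards [(isOpen_lt continuous_const continuous_norm).mem_nhds hy] with z hz using hw z hz
  rw [pderiv, h1.fderiv_eq]
  simp

theorem pderiv_sum {ι : Type*} (s : Finset ι) {g : ι → Plane → ℂ} (hg : ∀ i, ContDiff ℝ ∞ (g i))
    (j : Fin 2) (y : Plane) : pderiv j (fun y => ∑ i ∈ s, g i y) y = ∑ i ∈ s, pderiv j (g i) y := by
  rw [pderiv, fderiv_fun_sum fun i _ => ((hg i).differentiable (by simp)) y]
  simp [pderiv]

theorem pderiv_comp_add {g : Plane → ℂ} (v : Plane) (j : Fin 2) (y : Plane) :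
    pderiv j (fun y => g (y + v)) y = pderiv j g (y + v) := by
  rw [pderiv, fderiv_comp_add_right]; rfl

theorem bloch_eventuallyEq {R : ℝ} {w : Plane → ℂ} (hw : ∀ y, R ≤ ‖y‖ → w y = 0) (θ y : Plane) :
    bloch θ w =ᶠ[𝓝 y] fun z => ∑ n ∈ (finite_norm_latticeVec_le (R + (‖y‖ + 1))).toFinset,
      conj (mode θ (latticeVec n)) * w (z + latticeVec n) := by
  filter_upwards [(isOpen_lt continuous_norm continuous_const).mem_nhds (lt_add_one ‖y‖)] with z hz
  exact bloch_eq_sum hw θ (le_of_lt hz)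

theorem contDiff_bloch {R : ℝ} {w : Plane → ℂ} (hw : ∀ y, R ≤ ‖y‖ → w y = 0)
    (hwd : ContDiff ℝ ∞ w) (θ : Plane) : ContDiff ℝ ∞ (bloch θ w) := by
  rw [contDiff_iff_contDiffAt]
  intro y
  refine ContDiffAt.congr_of_eventuallyEq ?_ (bloch_eventuallyEq hw θ y)
  exact (ContDiff.sum fun n _ => contDiff_const.mul
    (hwd.comp (contDiff_id.add contDiff_const))).contDiffAt

theorem bloch_mem_smoothQuasiperiodic {R : ℝ} {w : Plane → ℂ} (hw : ∀ y, R ≤ ‖y‖ → w y = 0)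
    (hwd : ContDiff ℝ ∞ w) (θ : Plane) : bloch θ w ∈ smoothQuasiperiodic θ :=
  (smoothQuasiperiodic_iff θ _).2 ⟨contDiff_bloch hw hwd θ, fun y m => bloch_add_latticeVec θ w y m⟩

theorem pderiv_bloch {R : ℝ} {w : Plane → ℂ} (hw : ∀ y, R < ‖y‖ → w y = 0)
    (hwd : ContDiff ℝ ∞ w) (θ : Plane) (j : Fin 2) (y : Plane) :
    pderiv j (bloch θ w) y = bloch θ (pderiv j w) y := by
  have hw' : ∀ y, R + 1 ≤ ‖y‖ → w y = 0 := fun y hy => hw y (by linarith)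
  have hd : ∀ y, R + 1 ≤ ‖y‖ → pderiv j w y = 0 := fun y hy =>
    pderiv_eq_zero_of_norm hw j y (by linarith)
  have hsm : ∀ n, ContDiff ℝ ∞ fun z : Plane => w (z + latticeVec n) := fun n =>
    hwd.comp (contDiff_id.add contDiff_const)
  rw [pderiv, (bloch_eventuallyEq hw' θ y).fderiv_eq, (bloch_eventuallyEq hd θ y).eq_of_nhds]
  refine (pderiv_sum _ (fun n => contDiff_const.mul (hsm n)) j y).trans ?_
  refine Finset.sum_congr rfl fun n _ => ?_
  rw [pderiv_const_mul (hsm n), pderiv_comp_add]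

/-- As 0 ≤ y_j < 1, the bound |y_j + n_j| < K forces −K ≤ n_j < K, which is exactly 2K integers. -/
theorem exists_gridShift_eq {K : ℕ} {y : Plane} (hy : y ∈ cell) {n : Fin 2 → ℤ}
    (h : ‖y + latticeVec n‖ < K) : ∃ i : Fin 2 → Fin (2 * K), gridShift i = n := by
  have h1 : ∀ j, -(K : ℤ) ≤ n j ∧ n j < K := fun j => by
    have h2 : |y j + n j| ≤ ‖y + latticeVec n‖ := PiLp.norm_apply_le (y + latticeVec n) j
    have h3 := abs_lt.1 (h2.trans_lt h)
    have h4 := hy j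
    have h5 : (-(K : ℤ) - 1 : ℝ) < n j := by push_cast; linarith [h3.1, h4.2]
    have h6 : (n j : ℝ) < (K : ℤ) := by push_cast; linarith [h3.2, h4.1]
    have h7 : -(K : ℤ) - 1 < n j := by exact_mod_cast h5
    exact ⟨by omega, by exact_mod_cast h6⟩
  refine ⟨fun j => ⟨(n j + K).toNat, ?_⟩, ?_⟩
  · have := h1 j; omega
  · funext j
    have := h1 j
    simp only [gridShift]
    omega

theorem bloch_eq_grid_sum {K : ℕ} {w : Plane → ℂ} (hw : ∀ y, K ≤ ‖y‖ → w y = 0)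
    (f : Fin 2 → Fin (2 * K)) {y : Plane} (hy : y ∈ cell) :
    bloch (gridFreq f) w y = ∑ i, conj (gridMode f i) * w (y + latticeVec (gridShift i)) := by
  rw [bloch, ← gridShift_injective.tsum_eq, tsum_fintype]
  · rfl
  · intro n hn
    by_contra hc
    refine hn ?_
    simp only
    rw [hw, mul_zero]
    by_contra! hlt
    exact hc (exists_gridShift_eq hy hlt)

/-- Integrals of functions supported in a square as integrals over the cell. -/
theorem integral_eq_grid_sum {E : Type*} [NormedAddCommGroup E] [NormedSpace ℝ E] {K : ℕ}
    {G : Plane → E} (hG : ∀ y, K ≤ ‖y‖ → G y = 0) (hint : Integrable G) :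
    ∫ y, G y = ∑ i : Fin 2 → Fin (2 * K), ∫ y in cell, G (y + latticeVec (gridShift i)) := by
  let S : (Fin 2 → Fin (2 * K)) → Set Plane := fun i => (fun y => y - latticeVec (gridShift i)) ⁻¹' cell
  have hS : ∀ i, MeasurableSet (S i) := fun i => measurableSet_cell.preimage (measurable_id.sub_const _)
  have hdisj : Pairwise (Function.onFun Disjoint S) := by
    intro i i' hii'
    rw [Function.onFun, Set.disjoint_left]
    intro y hy hy'
    refine hii' (gridShift_injective ?_)
    have h1 : y - latticeVec (gridShift i) + latticeVec (gridShift i - gridShift i') ∈ cell := by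
      rw [latticeVec_sub, sub_add_sub_cancel]; exact hy'
    exact sub_eq_zero.1 (eq_zero_of_mem_cell hy h1)
  have hcov : ∀ y, y ∉ ⋃ i, S i → G y = 0 := fun y hy => by
    refine hG y ?_
    by_contra! hlt
    obtain ⟨n, hn⟩ := exists_sub_mem_cell y
    obtain ⟨i, hi⟩ := exists_gridShift_eq (K := K) hn (n := n) (by rwa [sub_add_cancel])
    exact hy (Set.mem_iUnion.2 ⟨i, by simpa only [S, Set.mem_preimage, hi] using hn⟩)
  rw [← setIntegral_eq_integral_of_forall_compl_eq_zero hcov,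
    integral_iUnion_fintype hS hdisj fun i => hint.integrableOn]
  refine Finset.sum_congr rfl fun i _ => ?_
  have h1 := (measurePreserving_add_right (volume : Measure Plane)
    (latticeVec (gridShift i))).setIntegral_preimage_emb
    (measurableEmbedding_addRight (latticeVec (gridShift i))) G (S i)
  rw [← h1]
  congr 2
  ext y
  simp [S]

end HighContrast
end

noncomputable section

namespace HighContrast

open scoped ComplexConjugate ENNReal InnerProductSpace

/-! ### From approximate waves in the plane to approximate Bloch waves -/

/-- After scaling by K, the radius 1/2 is where the cutoff must be invisible to the plane field, and
3/4 < 1 keeps its support inside the translates of the grid. -/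
theorem exists_bump : ∃ B : Plane → ℂ, ContDiff ℝ ∞ B ∧ HasCompactSupport B ∧
    (∀ y, ‖y‖ ≤ 1 / 2 → B y = 1) ∧ (∀ y, 3 / 4 ≤ ‖y‖ → B y = 0) ∧ ∀ y, ‖B y‖ ≤ 1 := by
  obtain ⟨b, hb1, hb2⟩ : ∃ b : ContDiffBump (0 : Plane), b.rIn = 1 / 2 ∧ b.rOut = 3 / 4 :=
    ⟨⟨1 / 2, 3 / 4, by norm_num, by norm_num⟩, rfl, rfl⟩
  have hb : ContDiff ℝ ∞ fun y : Plane => b y := b.contDiff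
  have hs : HasCompactSupport fun y : Plane => ((b y : ℝ) : ℂ) :=
    b.hasCompactSupport.comp_left (g := fun t : ℝ => (t : ℂ)) Complex.ofReal_zero
  refine ⟨fun y => (b y : ℂ), Complex.ofRealCLM.contDiff.comp hb, hs, fun y hy => ?_, fun y hy => ?_, fun y => ?_⟩
  · beta_reduce
    rw [b.one_of_mem_closedBall (by rwa [mem_closedBall_zero_iff, hb1]), Complex.ofReal_one]
  · beta_reduce
    rw [b.zero_of_le_dist (by rwa [dist_zero_right, hb2]), Complex.ofReal_zero]
  · rw [Complex.norm_real, Real.norm_of_nonneg b.nonneg]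
    exact b.le_one

/-- Cutoff functions on large balls with uniformly bounded gradients. -/
theorem exists_cutoff : ∃ L : ℝ, ∀ K : ℕ, 0 < K → ∃ η : Plane → ℂ, ContDiff ℝ ∞ η ∧
    (∀ y, ‖y‖ < K / 2 → η y = 1) ∧ (∀ y, 3 / 4 * (K : ℝ) < ‖y‖ → η y = 0) ∧ (∀ y, ‖η y‖ ≤ 1) ∧
    ∀ j y, ‖pderiv j η y‖ ≤ L := by
  obtain ⟨B, hB, hBc, hB1, hB0, hBn⟩ := exists_bump
  have hb : ∀ j, ∃ C, ∀ y, ‖pderiv j B y‖ ≤ C := fun j =>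
    (continuous_pderiv hB j).bounded_above_of_compact_support (hBc.fderiv_apply ℝ _)
  choose C hC using hb
  have hC0 : ∀ j, 0 ≤ C j := fun j => (norm_nonneg _).trans (hC j 0)
  refine ⟨∑ j, C j, fun K hK => ?_⟩
  have hK' : (0 : ℝ) < K := Nat.cast_pos.2 hK
  have hnorm : ∀ y : Plane, ‖(K : ℝ)⁻¹ • y‖ = ‖y‖ / K := fun y => by
    rw [norm_smul, norm_inv, Real.norm_of_nonneg hK'.le, div_eq_inv_mul]
  refine ⟨fun y => B ((K : ℝ)⁻¹ • y), hB.comp (contDiff_const_smul _), fun y hy => ?_, fun y hy => ?_,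
    fun y => hBn _, fun j y => ?_⟩
  · refine hB1 _ ?_
    rw [hnorm, div_le_iff₀ hK']
    linarith
  · refine hB0 _ ?_
    rw [hnorm, le_div_iff₀ hK']
    linarith
  · rw [pderiv_comp_smul hB, norm_mul, Complex.norm_real, norm_inv, Real.norm_of_nonneg hK'.le]
    -- Stretching only shrinks derivatives, so `L` is independent of K; hence so is the final loss
    -- constant.
    have h1 : (K : ℝ)⁻¹ ≤ 1 := inv_le_one_of_one_le₀ (by exact_mod_cast hK)
    calc (K : ℝ)⁻¹ * ‖pderiv j B ((K : ℝ)⁻¹ • y)‖ ≤ 1 * C j :=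
          mul_le_mul h1 (hC j _) (norm_nonneg _) zero_le_one
      _ ≤ ∑ j, C j := by
          rw [one_mul]
          exact Finset.single_le_sum (fun j _ => hC0 j) (Finset.mem_univ j)

/-- Product rule and |a + b|² ≤ 2|a|² + 2|b|²: each value enters two derivatives, which makes 4L².
-/
theorem sum_norm_smoothJet_mul_le {η : Plane → ℂ} {L : ℝ} (hη : ContDiff ℝ ∞ η)
    (hη1 : ∀ y, ‖η y‖ ≤ 1) (hL : ∀ j y, ‖pderiv j η y‖ ≤ L) {Φ : Fin 2 → Plane → ℂ}
    (hΦ : ∀ k, ContDiff ℝ ∞ (Φ k)) (y : Plane) :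
    ∑ p, ‖smoothJet (fun k y => η y * Φ k y) p y‖ ^ 2 ≤
      (2 + 4 * L ^ 2) * ∑ p, ‖smoothJet Φ p y‖ ^ 2 := by
  have hval : ∀ k, ‖smoothJet (fun k y => η y * Φ k y) (.inl k) y‖ ^ 2 ≤ ‖Φ k y‖ ^ 2 := fun k => by
    have : ‖η y * Φ k y‖ ≤ ‖Φ k y‖ := by
      rw [norm_mul]; exact mul_le_of_le_one_left (norm_nonneg _) (hη1 y)
    exact pow_le_pow_left₀ (norm_nonneg _) this 2
  have hder : ∀ k j, ‖smoothJet (fun k y => η y * Φ k y) (.inr (k, j)) y‖ ^ 2 ≤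
      2 * ‖pderiv j (Φ k) y‖ ^ 2 + 2 * L ^ 2 * ‖Φ k y‖ ^ 2 := fun k j => by
    have h1 : smoothJet (fun k y => η y * Φ k y) (.inr (k, j)) y =
        η y * pderiv j (Φ k) y + pderiv j η y * Φ k y := pderiv_mul hη (hΦ k) j y
    rw [h1]
    refine (norm_add_sq_le _ _).trans (add_le_add ?_ ?_)
    · refine mul_le_mul_of_nonneg_left (pow_le_pow_left₀ (norm_nonneg _) ?_ 2) two_pos.le
      rw [norm_mul]; exact mul_le_of_le_one_left (norm_nonneg _) (hη1 y)
    · rw [mul_assoc, ← mul_pow]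
      refine mul_le_mul_of_nonneg_left (pow_le_pow_left₀ (norm_nonneg _) ?_ 2) two_pos.le
      rw [norm_mul]; exact mul_le_mul_of_nonneg_right (hL j y) (norm_nonneg _)
  rw [Fintype.sum_sum_type, Fintype.sum_sum_type, Fintype.sum_prod_type, Fintype.sum_prod_type]
  simp only [Fin.sum_univ_two]
  have h0 : ∀ k, smoothJet Φ (.inl k) y = Φ k y := fun _ => rfl
  have h1 : ∀ k j, smoothJet Φ (.inr (k, j)) y = pderiv j (Φ k) y := fun _ _ => rfl
  simp only [h0, h1]
  have hL2 : 0 ≤ L ^ 2 := sq_nonneg L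
  have hs : ∀ k j, 0 ≤ L ^ 2 * ‖pderiv j (Φ k) y‖ ^ 2 := fun k j => by positivity
  have hn : ∀ k, 0 ≤ ‖Φ k y‖ ^ 2 := fun k => by positivity
  linarith [hval 0, hval 1, hder 0 0, hder 0 1, hder 1 0, hder 1 1, hs 0 0, hs 0 1, hs 1 0, hs 1 1,
    hn 0, hn 1]

/-! ### Jets of superpositions and of Bloch transforms -/

theorem smoothJet_sum {ι : Type*} [Fintype ι] {φ : ι → Fin 2 → Plane → ℂ}
    (hφ : ∀ f k, ContDiff ℝ ∞ (φ f k)) (p : JetIdx) (y : Plane) :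
    smoothJet (fun k y => ∑ f, φ f k y) p y = ∑ f, smoothJet (φ f) p y := by
  match p with
  | .inl k => rfl
  | .inr (k, j) => exact pderiv_sum _ (fun f => hφ f k) j y

theorem smoothJet_add_latticeVec {θ : Plane} {φ : Fin 2 → Plane → ℂ}
    (hφ : ∀ k, φ k ∈ smoothQuasiperiodic θ) (p : JetIdx) (y : Plane) (n : Fin 2 → ℤ) :
    smoothJet φ p (y + latticeVec n) = mode θ (latticeVec n) * smoothJet φ p y := by
  match p with
  | .inl k => exact (hφ k).2 y n
  | .inr (k, j) =>
    have h1 : (fun y => φ k (y + latticeVec n)) = fun y => mode θ (latticeVec n) * φ k y :=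
      funext fun y => (hφ k).2 y n
    have h2 := pderiv_comp_add (g := φ k) (latticeVec n) j y
    rw [h1, pderiv_const_mul (hφ k).1] at h2
    exact h2.symm

theorem smoothJet_eq_zero {R : ℝ} {w : Fin 2 → Plane → ℂ} (hw : ∀ k y, R < ‖y‖ → w k y = 0)
    (p : JetIdx) {y : Plane} (hy : R < ‖y‖) : smoothJet w p y = 0 := by
  match p with
  | .inl k => exact hw k y hy
  | .inr (k, j) => exact pderiv_eq_zero_of_norm (hw k) j y hy

theorem smoothJet_bloch {R : ℝ} {w : Fin 2 → Plane → ℂ} (hw : ∀ k y, R < ‖y‖ → w k y = 0)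
    (hwd : ∀ k, ContDiff ℝ ∞ (w k)) (θ : Plane) (p : JetIdx) (y : Plane) :
    smoothJet (fun k => bloch θ (w k)) p y = bloch θ (smoothJet w p) y := by
  match p with
  | .inl k => rfl
  | .inr (k, j) => exact pderiv_bloch (hw k) (hwd k) θ j y

/-- The jet of a smooth quasiperiodic field on the cell. -/
abbrev cellJet {θ : Plane} (φ : Fin 2 → Plane → ℂ) (hφ : ∀ i, φ i ∈ smoothQuasiperiodic θ) :
    JetSpace (volume.restrict cell) :=
  (H1Closure.ofSmooth (testClass_smoothQuasiperiodic θ) φ hφ).jet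

theorem norm_cellJet_sq {θ : Plane} {φ : Fin 2 → Plane → ℂ} (hφ : ∀ i, φ i ∈ smoothQuasiperiodic θ) :
    ‖cellJet φ hφ‖ ^ 2 = ∑ p, ∫ y in cell, ‖smoothJet φ p y‖ ^ 2 := by
  rw [cellJet, H1Closure.jet, norm_toJet_sq]; rfl

theorem bloch_mem {R : ℝ} {w : Plane → ℂ} (hw : ∀ y, R < ‖y‖ → w y = 0) (hwd : ContDiff ℝ ∞ w)
    (θ : Plane) : bloch θ w ∈ smoothQuasiperiodic θ :=
  bloch_mem_smoothQuasiperiodic (R := R + 1) (fun y hy => hw y (by linarith)) hwd θ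

theorem integral_cell_grid_sum {E : Type*} [NormedAddCommGroup E] [NormedSpace ℝ E] {K : ℕ}
    {G : Plane → E} (hG : ∀ y, K ≤ ‖y‖ → G y = 0) (hint : Integrable G) :
    ∫ y in cell, ∑ i : Fin 2 → Fin (2 * K), G (y + latticeVec (gridShift i)) = ∫ y, G y := by
  rw [integral_eq_grid_sum hG hint]
  exact integral_finsetSum _ fun i _ => (hint.comp_add_right (latticeVec (gridShift i))).restrict

section

variable {K : ℕ} {R : ℝ} {w : Fin 2 → Plane → ℂ}

theorem smoothJet_bloch_grid (hRK : R < K) (f : Fin 2 → Fin (2 * K)) (p : JetIdx) {y : Plane}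
    (hw : ∀ k, w k ∈ smoothCompactSupport) (hwR : ∀ k y, R < ‖y‖ → w k y = 0) (hy : y ∈ cell) :
    smoothJet (fun k => bloch (gridFreq f) (w k)) p y =
      ∑ i, conj (gridMode f i) * smoothJet w p (y + latticeVec (gridShift i)) := by
  rw [smoothJet_bloch hwR (fun k => (hw k).1)]
  exact bloch_eq_grid_sum (fun y hy => smoothJet_eq_zero hwR p (hRK.trans_le hy)) f hy

theorem memLp_plane_smoothJet (hw : ∀ k, w k ∈ smoothCompactSupport) (p : JetIdx) :
    MemLp (smoothJet w p) 2 volume := by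
  have := memLp_smoothJet testClass_smoothCompactSupport hw p
  rwa [Measure.restrict_univ] at this

/-- Parseval's identity for the discrete Bloch transform of jets. -/
theorem sum_norm_cellJet_bloch (hw : ∀ k, w k ∈ smoothCompactSupport)
    (hwR : ∀ k y, R < ‖y‖ → w k y = 0) (hRK : R < K) :
    ∑ f : Fin 2 → Fin (2 * K), ‖cellJet (fun k => bloch (gridFreq f) (w k))
      (fun k => bloch_mem (hwR k) (hw k).1 (gridFreq f))‖ ^ 2 =
      ((2 * K : ℕ) : ℝ) ^ 2 * ‖planeJet w hw‖ ^ 2 := by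
  simp only [norm_cellJet_sq, norm_planeJet_sq]
  rw [Finset.sum_comm, Finset.mul_sum]
  refine Finset.sum_congr rfl fun p _ => ?_
  have hint := integrable_norm_sq (memLp_plane_smoothJet hw p)
  rw [← integral_finsetSum _ fun f _ => integrable_norm_sq (memLp_smoothJet
    (testClass_smoothQuasiperiodic (gridFreq f))
    (fun k => bloch_mem (hwR k) (hw k).1 (gridFreq f)) p),
    ← integral_cell_grid_sum (K := K) (G := fun y => ‖smoothJet w p y‖ ^ 2)
      (fun y hy => by simp [smoothJet_eq_zero hwR p (hRK.trans_le hy)]) hint, ← integral_const_mul]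
  refine setIntegral_congr_fun measurableSet_cell fun y hy => ?_
  simp only [smoothJet_bloch_grid hRK _ p hw hwR hy]
  exact sum_norm_sq_of_orthogonal (sum_gridMode_freq (K := K)) _

variable {φ : (Fin 2 → Fin (2 * K)) → Fin 2 → Plane → ℂ}

theorem smoothJet_sum_grid (hφ : ∀ f k, φ f k ∈ smoothQuasiperiodic (gridFreq f)) (p : JetIdx)
    (y : Plane) (i : Fin 2 → Fin (2 * K)) :
    smoothJet (fun k y => ∑ f, φ f k y) p (y + latticeVec (gridShift i)) =
      ∑ f, gridMode f i * smoothJet (φ f) p y := by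
  rw [smoothJet_sum fun f k => (hφ f k).1]
  exact Finset.sum_congr rfl fun f _ => smoothJet_add_latticeVec (hφ f) p y _

theorem cutoff_mem {η : Plane → ℂ} (hη : ContDiff ℝ ∞ η) {r : ℝ} (hη0 : ∀ y, r < ‖y‖ → η y = 0)
    (hφ : ∀ f k, φ f k ∈ smoothQuasiperiodic (gridFreq f)) (k : Fin 2) :
    (fun y => η y * ∑ f, φ f k y) ∈ smoothCompactSupport := by
  refine ⟨hη.mul (ContDiff.sum fun f _ => (hφ f k).1), HasCompactSupport.mul_right ?_⟩
  refine HasCompactSupport.intro (isCompact_closedBall (0 : Plane) r) fun y hy => hη0 y ?_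
  rwa [mem_closedBall_zero_iff, not_le] at hy

/-- The norm of a truncated superposition of quasiperiodic fields. -/
theorem norm_planeJet_cutoff_le (hφ : ∀ f k, φ f k ∈ smoothQuasiperiodic (gridFreq f)) {η : Plane → ℂ} {L r : ℝ} (hη : ContDiff ℝ ∞ η)
    (hη0 : ∀ y, r < ‖y‖ → η y = 0) (hrK : r < K) (hη1 : ∀ y, ‖η y‖ ≤ 1)
    (hL : ∀ j y, ‖pderiv j η y‖ ≤ L) :
    ‖planeJet (fun k y => η y * ∑ f, φ f k y) (cutoff_mem hη hη0 hφ)‖ ^ 2 ≤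
      (2 + 4 * L ^ 2) * (((2 * K : ℕ) : ℝ) ^ 2 * ∑ f, ‖cellJet (φ f) (hφ f)‖ ^ 2) := by
  have hmem := cutoff_mem hη hη0 hφ
  have hle := fun y => sum_norm_smoothJet_mul_le hη hη1 hL
    (Φ := fun k y => ∑ f, φ f k y) (fun k => ContDiff.sum fun f _ => (hφ f k).1) y
  have hψc : ∀ p y, (K : ℝ) ≤ ‖y‖ → smoothJet (fun k y => η y * ∑ f, φ f k y) p y = 0 :=
    fun p y hy => smoothJet_eq_zero (R := r) (fun k y hy => by simp [hη0 y hy]) p (hrK.trans_le hy)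
  have hint := fun p => integrable_norm_sq (memLp_plane_smoothJet hmem p)
  have hcell := fun f p => integrable_norm_sq (memLp_smoothJet
    (testClass_smoothQuasiperiodic (gridFreq f)) (hφ f) p)
  rw [norm_planeJet_sq, ← integral_finsetSum _ fun p _ => hint p,
    ← integral_cell_grid_sum (K := K)
      (G := fun y => ∑ p, ‖smoothJet (fun k y => η y * ∑ f, φ f k y) p y‖ ^ 2)
      (fun y hy => by simp [hψc _ y hy]) (integrable_finsetSum _ fun p _ => hint p)]
  have hrhs : (2 + 4 * L ^ 2) * (((2 * K : ℕ) : ℝ) ^ 2 * ∑ f, ‖cellJet (φ f) (hφ f)‖ ^ 2) =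
      ∫ y in cell, (2 + 4 * L ^ 2) * (((2 * K : ℕ) : ℝ) ^ 2 *
        ∑ f, ∑ p, ‖smoothJet (φ f) p y‖ ^ 2) := by
    rw [integral_const_mul, integral_const_mul, integral_finsetSum _ fun f _ =>
      integrable_finsetSum _ fun p _ => hcell f p]
    congr 2
    refine Finset.sum_congr rfl fun f _ => ?_
    rw [norm_cellJet_sq, integral_finsetSum _ fun p _ => hcell f p]
  rw [hrhs]
  refine setIntegral_mono_on ?_ ?_ measurableSet_cell fun y _ => ?_
  · exact integrable_finsetSum _ fun i _ => ((integrable_finsetSum _ fun p _ =>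
      hint p).comp_add_right (latticeVec (gridShift i))).restrict
  · exact ((integrable_finsetSum _ fun f _ => integrable_finsetSum _ fun p _ =>
      hcell f p).const_mul _).const_mul _
  · have horth : ∀ f g : Fin 2 → Fin (2 * K), ∑ i, gridMode f i * conj (gridMode g i) =
        if f = g then ((((2 * K : ℕ) : ℝ) ^ 2 : ℝ) : ℂ) else 0 := sum_gridMode_shift
    -- On the i-th translate the superposed fields pick up the phases `gridMode f i`. Orthogonality
    -- over i then evaluates the sum exactly, so only the cutoff costs a constant.
    calc ∑ i, ∑ p, ‖smoothJet (fun k y => η y * ∑ f, φ f k y) p (y + latticeVec (gridShift i))‖ ^ 2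
        ≤ ∑ i, (2 + 4 * L ^ 2) * ∑ p, ‖∑ f, gridMode f i * smoothJet (φ f) p y‖ ^ 2 := by
          refine Finset.sum_le_sum fun i _ => (hle _).trans_eq ?_
          simp only [smoothJet_sum_grid hφ]
      _ = (2 + 4 * L ^ 2) * ∑ p, ∑ i, ‖∑ f, gridMode f i * smoothJet (φ f) p y‖ ^ 2 := by
          rw [← Finset.mul_sum, Finset.sum_comm]
      _ = _ := by
          congr 1
          rw [Finset.sum_comm (s := Finset.univ (α := Fin 2 → Fin (2 * K))), Finset.mul_sum]
          exact Finset.sum_congr rfl fun p _ =>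
            sum_norm_sq_of_orthogonal (c := fun i f => gridMode f i) horth _

theorem sesq_sum_left {ι : Type*} [Fintype ι] (m : JetIdx → JetIdx → ℝ) (c : ι → ℂ)
    (J : ι → JetIdx → ℂ) (J' : JetIdx → ℂ) :
    sesq m (fun p => ∑ i, c i * J i p) J' = ∑ i, c i * sesq m (J i) J' := by
  simp only [sesq, Finset.mul_sum, Finset.sum_mul]
  symm
  rw [Finset.sum_comm]
  refine Finset.sum_congr rfl fun p _ => ?_
  rw [Finset.sum_comm]
  exact Finset.sum_congr rfl fun q _ => Finset.sum_congr rfl fun i _ => by ring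

theorem sesq_sum_right {ι : Type*} [Fintype ι] (m : JetIdx → JetIdx → ℝ) (c : ι → ℂ)
    (J : JetIdx → ℂ) (J' : ι → JetIdx → ℂ) :
    sesq m J (fun p => ∑ i, c i * J' i p) = ∑ i, conj (c i) * sesq m J (J' i) := by
  simp only [sesq, map_sum, map_mul, Finset.mul_sum]
  symm
  rw [Finset.sum_comm]
  refine Finset.sum_congr rfl fun p _ => ?_
  rw [Finset.sum_comm]
  exact Finset.sum_congr rfl fun q _ => Finset.sum_congr rfl fun i _ => by ring

theorem sesq_zero_left (m : JetIdx → JetIdx → ℝ) (J' : JetIdx → ℂ) :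
    sesq m (fun _ => 0) J' = 0 := by simp [sesq]

/-- The form on Bloch transforms, tested with quasiperiodic fields, as a form in the plane. -/
theorem sum_form_bloch (hw : ∀ k, w k ∈ smoothCompactSupport) (hwR : ∀ k y, R < ‖y‖ → w k y = 0)
    (hφ : ∀ f k, φ f k ∈ smoothQuasiperiodic (gridFreq f)) {a : Plane → JetIdx → JetIdx → ℝ} (ha : BddCoeff a)
    (hper : ∀ y n, a (y + latticeVec n) = a y) {η : Plane → ℂ} {r : ℝ} (hη : ContDiff ℝ ∞ η)
    (hη0 : ∀ y, r < ‖y‖ → η y = 0) (hRK : R < K) {r' : ℝ} (hRr : R < r')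
    (hη1 : ∀ y, ‖y‖ < r' → η y = 1) :
    ∑ f, ∫ y in cell, sesq (a y) (fun p => smoothJet (fun k => bloch (gridFreq f) (w k)) p y)
      (fun p => smoothJet (φ f) p y) =
    ∫ y, sesq (a y) (fun p => smoothJet w p y)
      (fun p => smoothJet (fun k y => η y * ∑ f, φ f k y) p y) := by
  have hmem := cutoff_mem hη hη0 hφ
  -- η equals 1 near every point of the ball of radius r' > R, which contains the support of w; the
  -- cutoff is therefore invisible to the form.
  have hcut : ∀ p y, ‖y‖ < r' → smoothJet (fun k y => η y * ∑ f, φ f k y) p y =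
      smoothJet (fun k y => ∑ f, φ f k y) p y := by
    intro p y hy
    have hev : η =ᶠ[𝓝 y] fun _ => 1 := by
      filter_upwards [(isOpen_lt continuous_norm continuous_const).mem_nhds hy] with z hz
        using hη1 z hz
    match p with
    | .inl k => simp [smoothJet, hη1 y hy]
    | .inr (k, j) =>
      have h2 : (fun y => η y * ∑ f, φ f k y) =ᶠ[𝓝 y] fun y => ∑ f, φ f k y := by
        filter_upwards [hev] with z hz
        rw [hz, one_mul]
      simp only [smoothJet, Sum.elim_inr, pderiv]
      rw [h2.fderiv_eq]
  have hint : Integrable fun y => sesq (a y) (fun p => smoothJet w p y)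
      (fun p => smoothJet (fun k y => η y * ∑ f, φ f k y) p y) :=
    integrable_sesq ha (memLp_plane_smoothJet hw) (memLp_plane_smoothJet hmem)
  rw [← integral_cell_grid_sum (K := K) (fun y hy => by
      simp only [smoothJet_eq_zero hwR _ (hRK.trans_le hy)]
      exact sesq_zero_left _ _) hint,
    ← integral_finsetSum _ fun f _ => integrable_sesq ha
      (memLp_smoothJet (testClass_smoothQuasiperiodic (gridFreq f))
        (fun k => bloch_mem (hwR k) (hw k).1 (gridFreq f)))
      (memLp_smoothJet (testClass_smoothQuasiperiodic (gridFreq f)) (hφ f))]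
  refine setIntegral_congr_fun measurableSet_cell fun y hy => ?_
  have h1 : ∀ i, sesq (a (y + latticeVec (gridShift i)))
      (fun p => smoothJet w p (y + latticeVec (gridShift i)))
      (fun p => smoothJet (fun k y => η y * ∑ f, φ f k y) p (y + latticeVec (gridShift i))) =
      ∑ f, conj (gridMode f i) * sesq (a y) (fun p => smoothJet w p (y + latticeVec (gridShift i)))
        (fun p => smoothJet (φ f) p y) := fun i => by
    rw [hper, ← sesq_sum_right]
    by_cases h : ‖y + latticeVec (gridShift i)‖ < r'
    · simp only [hcut _ _ h, smoothJet_sum_grid hφ]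
    · simp only [smoothJet_eq_zero hwR _ (hRr.trans_le (not_lt.1 h)), sesq_zero_left]
  simp only [h1, smoothJet_bloch_grid hRK _ _ hw hwR hy, sesq_sum_left]
  exact Finset.sum_comm

end

end HighContrast
end

noncomputable section

namespace HighContrast

open scoped ComplexConjugate ENNReal InnerProductSpace

/-! ### Approximate Bloch waves -/

/-- Rotating the test vector makes its pairing real and positive, so that pairings at different
quasimomenta can later be added without cancellation. -/
theorem exists_normalized_test {H : Type*} [NormedAddCommGroup H] [InnerProductSpace ℂ H]
    (S : Submodule ℂ H) (X : H) {κ t : ℝ} (hκ : 0 ≤ κ) (ht : 0 < t)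
    (h : ∃ v ∈ S, κ * ‖v‖ < ‖⟪v, X⟫_ℂ‖) :
    ∃ v ∈ S, ‖v‖ = t ∧ ∃ r : ℝ, ⟪v, X⟫_ℂ = r ∧ κ * t < r := by
  obtain ⟨v, hv, hlt⟩ := h
  set z := ⟪v, X⟫_ℂ with hz
  have hz0 : 0 < ‖z‖ := (mul_nonneg hκ (norm_nonneg v)).trans_lt hlt
  have hv0 : 0 < ‖v‖ := by
    rw [norm_pos_iff]
    rintro rfl
    rw [hz, inner_zero_left, norm_zero] at hz0
    exact hz0.false
  have hzC : (‖z‖ : ℂ) ≠ 0 := Complex.ofReal_ne_zero.2 hz0.ne'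
  -- The inner product is conjugate-linear in its first argument, so the phase z/‖z‖ turns z into
  -- ‖z‖.
  refine ⟨(((t / ‖v‖ : ℝ) : ℂ) * (z / ‖z‖)) • v, S.smul_mem _ hv, ?_, t / ‖v‖ * ‖z‖, ?_, ?_⟩
  · rw [norm_smul, norm_mul, norm_div, Complex.norm_real, Complex.norm_real, norm_norm,
      div_self hz0.ne', mul_one, Real.norm_of_nonneg (by positivity), div_mul_cancel₀ _ hv0.ne']
  · rw [inner_smul_left, ← hz, map_mul, Complex.conj_ofReal, map_div₀, Complex.conj_ofReal,
      Complex.ofReal_mul, mul_assoc, div_mul_eq_mul_div, Complex.conj_mul', pow_two,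
      mul_div_assoc, div_self hzC, mul_one]
  · rw [div_mul_eq_mul_div, lt_div_iff₀ hv0, mul_assoc, mul_comm t ‖v‖, ← mul_assoc,
      mul_comm t ‖z‖]
    exact mul_lt_mul_of_pos_right hlt ht

theorem inner_opM_jet {S : Set (Plane → ℂ)} {Ω : Set Plane} {m : Plane → JetIdx → JetIdx → ℝ}
    (hm : BddCoeff m) (u φ : H1Closure S Ω) :
    ⟪φ.jet, opM (fun p q => toLinf _ fun y => (m y p q : ℂ)) u.jet⟫_ℂ =
      ∫ y in Ω, sesq (m y) (fun p => u.jetFun p y) (fun p => φ.jetFun p y) :=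
  inner_opM_toJet hm _ _

theorem exists_support_radius {w : Fin 2 → Plane → ℂ} (hw : ∀ k, w k ∈ smoothCompactSupport) :
    ∃ R : ℝ, ∀ k y, R < ‖y‖ → w k y = 0 := by
  have h : ∀ k, ∃ R : ℝ, ∀ y, R < ‖y‖ → w k y = 0 := fun k => by
    obtain ⟨R, hR⟩ := isBounded_iff_forall_norm_le.1 (hw k).2.isCompact.isBounded
    refine ⟨R, fun y hy => ?_⟩
    by_contra hne
    exact (hR y (subset_tsupport _ hne)).not_gt hy
  choose R hR using h
  refine ⟨∑ k, |R k|, fun k y hy => hR k y (lt_of_le_of_lt ?_ hy)⟩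
  exact (le_abs_self _).trans (Finset.single_le_sum (f := fun k => |R k|)
    (fun _ _ => abs_nonneg _) (Finset.mem_univ k))

/-- Approximate solutions with compact support yield approximate Bloch waves, with a loss by a
constant factor only. -/
theorem exists_blochWave : ∃ C : ℝ, 0 < C ∧ ∀ a : Plane → JetIdx → JetIdx → ℝ, BddCoeff a →
    (∀ y n, a (y + latticeVec n) = a y) → ∀ δ : ℝ, 0 < δ →
    ∀ (w : Fin 2 → Plane → ℂ) (hw : ∀ i, w i ∈ smoothCompactSupport), planeJet w hw ≠ 0 →
    (∀ (ψ : Fin 2 → Plane → ℂ) (hψ : ∀ i, ψ i ∈ smoothCompactSupport),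
      ‖∫ y, sesq (a y) (fun p => smoothJet w p y) (fun p => smoothJet ψ p y)‖ ≤
        δ * ‖planeJet w hw‖ * ‖planeJet ψ hψ‖) →
    ∃ θ ∈ cell, ∃ v : H1Theta θ, v.jet ≠ 0 ∧ ∀ φ : H1Theta θ,
      ‖∫ y in cell, sesq (a y) (fun p => v.jetFun p y) (fun p => φ.jetFun p y)‖ ≤
        C * δ * ‖v.jet‖ * ‖φ.jet‖ := by
  obtain ⟨L, hcutoff⟩ := exists_cutoff
  set C := √(2 + 4 * L ^ 2) with hC
  have hC2 : C ^ 2 = 2 + 4 * L ^ 2 := Real.sq_sqrt (by positivity)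
  have hC0 : 0 < C := Real.sqrt_pos.2 (by positivity)
  refine ⟨C, hC0, fun a ha hper δ hδ w hw hw0 hres => ?_⟩
  obtain ⟨R, hR⟩ := exists_support_radius hw
  -- The support must lie in the ball of radius K/2, on which the cutoff is 1.
  obtain ⟨K, hK⟩ := exists_nat_gt (max (2 * R) 0)
  have hK0 : (0 : ℝ) < K := (le_max_right _ _).trans_lt hK
  have hRK2 : R < K / 2 := by linarith [(le_max_left (2 * R) 0).trans_lt hK]
  have hRK : R < K := by linarith
  obtain ⟨η, hη, hη1, hη0, hηn, hηL⟩ := hcutoff K (by exact_mod_cast hK0)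
  by_contra! hcon
  let T : ∀ f : Fin 2 → Fin (2 * K), TestClass (smoothQuasiperiodic (gridFreq f)) cell :=
    fun f => testClass_smoothQuasiperiodic _
  have hvm := fun (f : Fin 2 → Fin (2 * K)) k => bloch_mem (hR k) (hw k).1 (gridFreq f)
  -- Each fibre of the Bloch transform gets a smooth test field, no longer than the fibre, with a
  -- real pairing exceeding Cδ times the squared norm. A zero fibre gets the zero field, whence the
  -- separate weak and strict inequalities.
  have key : ∀ f : Fin 2 → Fin (2 * K), ∃ (φ : Fin 2 → Plane → ℂ)
      (hφ : ∀ k, φ k ∈ smoothQuasiperiodic (gridFreq f)) (r : ℝ),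
      ‖cellJet φ hφ‖ ≤ ‖cellJet _ (hvm f)‖ ∧
      ∫ y in cell, sesq (a y) (fun p => smoothJet (fun k => bloch (gridFreq f) (w k)) p y)
        (fun p => smoothJet φ p y) = r ∧
      C * δ * ‖cellJet _ (hvm f)‖ ^ 2 ≤ r ∧
      (cellJet _ (hvm f) ≠ 0 → C * δ * ‖cellJet _ (hvm f)‖ ^ 2 < r) := by
    intro f
    set X := opM (fun p q => toLinf _ fun y => (a y p q : ℂ)) (cellJet _ (hvm f)) with hX
    by_cases h0 : cellJet _ (hvm f) = 0
    · obtain ⟨φ, hφ, hφ0⟩ := (H1Closure.smoothJets (T f)).zero_mem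
      refine ⟨φ, hφ, 0, ?_, ?_, ?_, fun h => absurd h0 h⟩
      · rw [h0, cellJet, hφ0]
      · rw [← inner_opM_ofSmooth (T f) ha (hvm f) hφ, hφ0, inner_zero_left, Complex.ofReal_zero]
      · rw [h0]; simp
    · have ht : 0 < ‖cellJet _ (hvm f)‖ := norm_pos_iff.2 h0
      set t := ‖cellJet _ (hvm f)‖
      obtain ⟨φ, hφ⟩ := hcon (gridFreq f) (gridFreq_mem_cell f)
        (H1Closure.ofSmooth (T f) _ (hvm f)) h0
      rw [← inner_opM_jet ha] at hφ
      -- The test field supplied is only in H¹_θ; the strict inequality is an open condition, so a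
      -- smooth one exists by density.
      have hopen : IsOpen {U : JetSpace (volume.restrict cell) | C * δ * t * ‖U‖ < ‖⟪U, X⟫_ℂ‖} :=
        isOpen_lt (by fun_prop) (by fun_prop)
      have hcl := (H1Closure.mem_closure_smoothJets (T f)).2 ⟨φ, rfl⟩
      obtain ⟨U, hU1, hU2⟩ := mem_closure_iff.1
        (show φ.jet ∈ closure (H1Closure.smoothJets (T f) : Set _) from hcl) _ hopen hφ
      obtain ⟨_, ⟨φ', hφ', rfl⟩, hnorm, r, hr, hlt⟩ := exists_normalized_test
        (H1Closure.smoothJets (T f)) X (by positivity) ht ⟨U, hU2, hU1⟩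
      have hlt' : C * δ * t ^ 2 < r := by rwa [pow_two, ← mul_assoc]
      exact ⟨φ', hφ', r, hnorm.le, (inner_opM_ofSmooth (T f) ha (hvm f) hφ').symm.trans hr,
        hlt'.le, fun _ => hlt'⟩
  choose φ hφ r hnorm hint hr hr' using key
  have hpars := sum_norm_cellJet_bloch hw hR hRK
  have hform := sum_form_bloch hw hR hφ ha hper hη hη0 hRK hRK2 hη1
  simp only [hint] at hform
  have hψ := norm_planeJet_cutoff_le hφ hη hη0 (by linarith) hηn hηL
  have hresψ := hres _ (cutoff_mem hη hη0 hφ)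
  rw [← hform, ← Complex.ofReal_sum, Complex.norm_real] at hresψ
  set N2 : ℝ := ((2 * K : ℕ) : ℝ) ^ 2 with hN2
  have hN0 : 0 < N2 := by
    have : (0 : ℝ) < ((2 * K : ℕ) : ℝ) := by push_cast; linarith
    positivity
  have hW : 0 < ‖planeJet w hw‖ := norm_pos_iff.2 hw0
  have hψ2 : ‖planeJet _ (cutoff_mem hη hη0 hφ)‖ ≤ C * N2 * ‖planeJet w hw‖ := by
    refine abs_le_of_sq_le_sq' ?_ (by positivity) |>.2
    refine hψ.trans ?_
    have h1 : ∑ f, ‖cellJet (φ f) (hφ f)‖ ^ 2 ≤ N2 * ‖planeJet w hw‖ ^ 2 := by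
      rw [← hpars]
      exact Finset.sum_le_sum fun f _ => pow_le_pow_left₀ (norm_nonneg _) (hnorm f) 2
    calc (2 + 4 * L ^ 2) * (N2 * ∑ f, ‖cellJet (φ f) (hφ f)‖ ^ 2)
        ≤ (2 + 4 * L ^ 2) * (N2 * (N2 * ‖planeJet w hw‖ ^ 2)) := by gcongr
      _ = (C * N2 * ‖planeJet w hw‖) ^ 2 := by rw [← hC2]; ring
  have hupper : ∑ f, r f ≤ C * δ * (N2 * ‖planeJet w hw‖ ^ 2) := by
    refine (Real.le_norm_self _).trans (hresψ.trans ?_)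
    calc δ * ‖planeJet w hw‖ * ‖planeJet _ (cutoff_mem hη hη0 hφ)‖
        ≤ δ * ‖planeJet w hw‖ * (C * N2 * ‖planeJet w hw‖) :=
          mul_le_mul_of_nonneg_left hψ2 (by positivity)
      _ = C * δ * (N2 * ‖planeJet w hw‖ ^ 2) := by ring
  -- Strictness comes from a non-zero fibre, which exists by Parseval because w is not zero.
  have hlower : C * δ * (N2 * ‖planeJet w hw‖ ^ 2) < ∑ f, r f := by
    rw [← hpars, Finset.mul_sum]
    refine Finset.sum_lt_sum (fun f _ => hr f) ?_
    by_contra! hall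
    have hz : ∀ f, cellJet _ (hvm f) = 0 := fun f => by
      by_contra hne
      exact (hall f (Finset.mem_univ f)).not_gt (hr' f hne)
    have h2 : N2 * ‖planeJet w hw‖ ^ 2 = 0 := by
      rw [← hpars]
      exact Finset.sum_eq_zero fun f _ => by rw [hz f]; simp
    exact (by positivity : N2 * ‖planeJet w hw‖ ^ 2 ≠ 0) h2
  exact hupper.not_gt hlower

/-- The Fourier coefficients of the gradient are determined by those of the values. A non-zero jet
thus has non-zero values and can be normalised in L². -/
theorem jet_eq_zero_of_values {θ : Plane} (v : H1Theta θ) (h : ∀ i, v.jet (.inl i) = 0) :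
    v.jet = 0 := by
  ext p : 1
  match p with
  | .inl i => exact h i
  | .inr (i, j) =>
    refine ext_inner_modeL (θ := θ) fun k => ?_
    have h1 := quasiJet_jet v i k j
    rw [h i, inner_zero_right, mul_zero] at h1
    rw [h1]
    exact (inner_zero_right _).symm

/-- Normalisation of approximate Bloch waves in `L²`. -/
theorem exists_normalized_wave {a : Plane → JetIdx → JetIdx → ℝ} (ha : BddCoeff a) {θ : Plane}
    {v : H1Theta θ} (hv : v.jet ≠ 0) {κ : ℝ}
    (hres : ∀ φ : H1Theta θ,
      ‖∫ y in cell, sesq (a y) (fun p => v.jetFun p y) (fun p => φ.jetFun p y)‖ ≤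
        κ * ‖v.jet‖ * ‖φ.jet‖) :
    ∃ v' : H1Theta θ, ∑ i, ‖v'.jet (.inl i)‖ ^ 2 = 1 ∧ ∀ φ : H1Theta θ,
      ‖∫ y in cell, sesq (a y) (fun p => v'.jetFun p y) (fun p => φ.jetFun p y)‖ ≤
        κ * ‖v'.jet‖ * ‖φ.jet‖ := by
  set s := ∑ i, ‖v.jet (.inl i)‖ ^ 2 with hs
  have hs0 : 0 < s := by
    refine (Finset.sum_nonneg fun i _ => by positivity).lt_of_ne fun h0 => hv ?_
    refine jet_eq_zero_of_values v fun i => ?_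
    have := (Finset.sum_eq_zero_iff_of_nonneg fun i _ => by positivity).1 h0.symm i (Finset.mem_univ i)
    simpa using this
  -- The scalar multiple of the field is obtained from the closed subspace of jets.
  have hcl := (H1Closure.mem_closure_smoothJets (testClass_smoothQuasiperiodic θ)).2 ⟨v, rfl⟩
  obtain ⟨v', hv'⟩ := (H1Closure.mem_closure_smoothJets (testClass_smoothQuasiperiodic θ)).1
    (Submodule.smul_mem _ (((√s)⁻¹ : ℝ) : ℂ) hcl)
  have hc : ‖(((√s)⁻¹ : ℝ) : ℂ)‖ = (√s)⁻¹ := by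
    rw [Complex.norm_real, Real.norm_of_nonneg (by positivity)]
  refine ⟨v', ?_, fun φ => ?_⟩
  · have h1 : ∀ i, ‖v'.jet (.inl i)‖ ^ 2 = s⁻¹ * ‖v.jet (.inl i)‖ ^ 2 := fun i => by
      rw [hv', PiLp.smul_apply, norm_smul, hc, mul_pow, inv_pow, Real.sq_sqrt hs0.le]
    simp only [h1, ← Finset.mul_sum]
    exact inv_mul_cancel₀ hs0.ne'
  · have h1 := mul_le_mul_of_nonneg_left (hres φ) (norm_nonneg (((√s)⁻¹ : ℝ) : ℂ))
    rw [← inner_opM_jet ha, hv', map_smul, inner_smul_right, norm_mul, inner_opM_jet ha, norm_smul]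
    exact h1.trans_eq (by ring)

variable {e₀ e₁ : ℝ} {Q₀ : Set Plane}

/-- Limits of points of the spectra belong to the limit spectrum. -/
theorem mem_limitSpectrum_of_tendsto (he₁ : 0 < e₁) (he : e₁ < e₀) (hopen : IsOpen Q₀)
    (hne : Q₀.Nonempty) (hsub : Q₀ ⊆ cell) (hbd : volume (frontier Q₀) = 0)
    {ε l : ℕ → ℝ} {l₀ : ℝ} (hε0 : ∀ n, 0 < ε n) (hεlim : Tendsto ε atTop (𝓝 0))
    (hspec : ∀ n, l n ∈ planeSpectrum e₀ e₁ Q₀ (ε n)) (hl : Tendsto l atTop (𝓝 l₀)) :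
    l₀ ∈ limitSpectrum e₀ e₁ Q₀ := by
  obtain ⟨C, hC, hbloch⟩ := exists_blochWave
  have hQ₀ := hopen.measurableSet
  have hwave : ∀ n : ℕ, ∃ θ ∈ cell, ∃ v : H1Theta θ, ∑ i, ‖v.jet (.inl i)‖ ^ 2 = 1 ∧
      ∀ φ : H1Theta θ, ‖∫ y in cell, sesq (cellCoeff e₀ e₁ Q₀ (ε n) (l n) y)
        (fun p => v.jetFun p y) (fun p => φ.jetFun p y)‖ ≤
        1 / ((n : ℝ) + 1) * ‖v.jet‖ * ‖φ.jet‖ := by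
    intro n
    -- The universal constant C is compensated in advance, independently of ε n, so the residual of
    -- the Bloch wave is at most 1/(n+1).
    have hδ : 0 < 1 / (C * ((n : ℝ) + 1)) := by positivity
    have hb : BddCoeff (cellCoeff e₀ e₁ Q₀ (ε n) (l n)) := bddCoeff_phaseCoeff hQ₀ _ _
    obtain ⟨w, hw, hw0, hres⟩ := exists_planeWave_rescaled hQ₀ (hε0 n) (hspec n) hδ
    obtain ⟨θ, hθ, v, hv0, hv⟩ := hbloch _ hb (fun y m => by
      funext p q
      simp only [cellCoeff, phaseCoeff, perChar_add_latticeVec]) _ hδ w hw hw0 hres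
    have hCδ : C * (1 / (C * ((n : ℝ) + 1))) = 1 / ((n : ℝ) + 1) := by field_simp
    rw [hCδ] at hv
    obtain ⟨v', hv'1, hv'2⟩ := exists_normalized_wave hb hv0 hv
    exact ⟨θ, hθ, v', hv'1, hv'2⟩
  choose θ hθ v hv hres using hwave
  exact mem_limitSpectrum_of_residual he₁ he hopen hne hsub hbd v hε0 hεlim hθ hl hv
    tendsto_one_div_add_atTop_nhds_zero_nat hres

end HighContrast
end

theorem mainTheorem4 (e₀ e₁ : ℝ) (he₁ : 0 < e₁) (he : e₁ < e₀)
    (Q₀ : Set HighContrast.Plane) (hopen : IsOpen Q₀) (hne : Q₀.Nonempty)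
    (hcl : closure Q₀ ⊆ HighContrast.cell) (hbd : volume (frontier Q₀) = 0) :
    -- compactness of normalized Bloch eigenfunctions and the limit eigenproblem
    (∀ (ε : ℕ → ℝ) (l : ℕ → ℝ) (l₀ : ℝ) (θ : ℕ → HighContrast.Plane) (θ₀ : HighContrast.Plane)
        (u : ∀ n, HighContrast.H1Theta (θ n)),
      (∀ n, 0 < ε n) → Tendsto ε atTop (𝓝 0) →
      (∀ n, θ n ∈ HighContrast.cell) → Tendsto θ atTop (𝓝 θ₀) →
      Tendsto l atTop (𝓝 l₀) →
      (∀ n, ∫ y in HighContrast.cell, ∑ i, ‖(u n).toFun i y‖ ^ 2 = 1) →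
      (∀ n, HighContrast.SolvesCellProblem e₀ e₁ Q₀ (ε n) (l n) (u n)) →
      ∃ s : ℕ → ℕ, StrictMono s ∧ ∃ u₀ : HighContrast.H1Theta θ₀,
        u₀ ∈ HighContrast.V Q₀ θ₀ ∧ ¬ u₀.IsZero ∧
        -- strong convergence in `L²(Q)`
        Tendsto (fun k => ∫ y in HighContrast.cell,
          ∑ i, ‖(u (s k)).toFun i y - u₀.toFun i y‖ ^ 2) atTop (𝓝 0) ∧
        -- weak convergence of the gradients in `L²(Q)`
        (∀ (i j : Fin 2) (g : HighContrast.Plane → ℂ),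
          MemLp g 2 (volume.restrict HighContrast.cell) →
          Tendsto (fun k => ∫ y in HighContrast.cell, (u (s k)).grad i j y * star (g y)) atTop
            (𝓝 (∫ y in HighContrast.cell, u₀.grad i j y * star (g y)))) ∧
        HighContrast.SolvesLimitProblem e₀ e₁ Q₀ l₀ u₀) ∧
    -- spectral completeness
    (∀ (ε : ℕ → ℝ) (l : ℕ → ℝ) (l₀ : ℝ),
      (∀ n, 0 < ε n) → Tendsto ε atTop (𝓝 0) →
      (∀ n, l n ∈ HighContrast.planeSpectrum e₀ e₁ Q₀ (ε n)) → Tendsto l atTop (𝓝 l₀) →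
      l₀ ∈ HighContrast.limitSpectrum e₀ e₁ Q₀) := by
  refine ⟨fun ε l l₀ θ θ₀ u hε0 hεlim hcell hθ hl hnorm hsol => ?_, fun ε l l₀ hε0 hεlim hspec hl => ?_⟩
  · exact HighContrast.exists_limit_of_solvesCellProblem he₁ he hopen hne (subset_closure.trans hcl)
      hbd u hε0 hεlim hcell hθ hl hnorm hsol
  · exact HighContrast.mem_limitSpectrum_of_tendsto he₁ he hopen hne (subset_closure.trans hcl) hbd
      hε0 hεlim hspec hl
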